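/- There is an absolute constant $c>0$ such that, for all $\tau\in(0,1)$, $q_0,q_1,q_2,q_3\ge 0$ and $M$, there are $C_0=C_0(\tau,q_0,\dots,q_3,M)>0$ and $n_0=n_0(\tau,q_0,\dots,q_3,M)$ such that, with $C_1:=c\,C_0$, the following holds for all $n\ge n_0$ ($n\geq 1$), $p$, $d$. Put $\mathbf q:=\max\{3q_1,q_1+q_2,q_3\}$, $\bar{\mathbf q}_0:=2\lceil q_0\mathbf q/2\rceil$, $q^*:=2^{(\bar{\mathbf q}_0+4)/2}$, $\log_+x:=\max\{1,\log x\}$. Assume: (1) $\tau\le p/n\le 1/\tau$. (2) $\ell_1,\dots,\ell_n:\mathbb R\to\mathbb R$ are continuous (for instance convex), $R:\mathbb R^p\to\mathbb R$ is a function, and there are $\bar\rho\in(0,1]$, $L_{\ell_i}\ge 1$ and functions $\mathcal D_\ell,\mathcal M_\ell:(0,\bar\rho)\to\mathbb R_{\ge0}$ with $\mathcal M_\ell\le 1\le\mathcal D_\ell$ such that $|\ell_i(x)|\le L_{\ell_i}(1+|x|^{q_0})$ for all $i,x$, and such that for every $\rho\in(0,\bar\rho)$ and $i$ there is $\ell_{i;\rho}\in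 C^3(\mathbb R)$, $\ell_{i;\rho}\ge0$, with $\|\ell_{i;\rho}-\ell_i\|_\infty\le\mathcal M_\ell(\rho)$ and $|\ell_{i;\rho}^{(k)}(x)|\le\mathcal D_\ell(\rho)\,(1+|\ell_{i;\rho}(x)|^{q_k})$ for all $x$ and $k=1,2,3$. (3) $X_1,\dots,X_n$ are i.i.d. random vectors in $\mathbb R^p$ with $E[X_i]=0$, $E[X_iX_i^\top]=\Sigma/n$, $\Sigma$ positive definite, $\lambda_{\max}(\Sigma)\le M$, and $(E|\sqrt n\,X_{i,j}|^{q^*})^{1/q^*}\le M$ for all $i,j$. (4) The distribution of $X_i$ is $d$-block dependent: $\{1,\dots,p\}$ has a partition into $k\le p$ cells $B_1,\dots,B_k$ with $|B_a|\le d$ such that the subvectors $(X_{i,j})_{j\in B_1},\dots,(X_{i,j})_{j\in B_k}$ are independent. Let $G_1,\dots,G_n$ be i.i.d. $N(0,\Sigma/n)$, and for $Z\in\{X,G\}$ let $H(w,Z):=\frac1n\sum_{i=1}^n\ell_i(Z_i^\top w)+R(w)$. For $L,\delta>0$ put $\mathcal M_R(L,\delta):=\sup\{|R(w)-R(w')|: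 w,w'\in[-L,L]^p,\ \|w-w'\|_\infty\le\delta\}\in[0,\infty]$, and put $$\sigma_n:=\frac{p\,d^{3+\bar{\mathbf q}_0/2}}{n^{5/2}}+\frac{p\,d^2}{n^{3/2}}+\frac{p\,d^{\bar{\mathbf q}_0+2}}{n^{(\bar{\mathbf q}_0+3)/2}},\qquad \omega_n:=n^{-(q_0q_1+3)/2}\sigma_n,\qquad Av:=\frac1n\sum_{i=1}^nL_{\ell_i}^{\mathbf q},$$ $$r_R(L):=\inf_{\rho\in(0,\bar\rho)}\Big\{\mathcal M_\ell(\rho)+\mathcal D_\ell(\rho)^3\inf_{\delta\in(0,\omega_n)}\Big[\mathcal M_R(L,\delta)+Av^{1/3}\,L^{(\bar{\mathbf q}_0+3)/3}\,\log_+^{2/3}(L/\delta)\,\sigma_n^{1/3}\Big]\Big\}.$$ Then for every $L_n\ge1$ and every nonempty $\mathcal S_n\subset[-L_n,L_n]^p$, where $\min$ denotes the infimum if it is not attained: (a) for every $g\in C^3(\mathbb R)$, with $K_g:=1+\max_{0\le k\le3}\|g^{(k)}\|_\infty\in[1,\infty]$, $$\Big|E\,g\Big(\min_{w\in\mathcal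 S_n}H(w,X)\Big)-E\,g\Big(\min_{w\in\mathcal S_n}H(w,G)\Big)\Big|\le C_0\,K_g\,r_R(L_n);$$ (b) for all $z\in\mathbb R$ and $\varepsilon>0$, $$\Pr\Big(\min_{w\in\mathcal S_n}H(w,X)>z+3\varepsilon\Big)\le\Pr\Big(\min_{w\in\mathcal S_n}H(w,G)>z+\varepsilon\Big)+C_1\max\{1,\varepsilon^{-3}\}\,r_R(L_n),$$ and the same inequality holds with $X$ and $G$ interchanged. -/

import Mathlib

open MeasureTheory ProbabilityTheory Set
open scoped ENNReal

/-- `d`-block dependence of a random vector `X` in `ℝ^p`: the coordinates can be partitioned into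
`k ≤ p` cells of size at most `d` such that the subvectors of `X` belonging to the different
cells are independent. -/
def BlockDependent {Ω : Type*} [MeasurableSpace Ω] {p : ℕ} (d : ℕ)
    (X : Ω → EuclideanSpace ℝ (Fin p)) (μ : Measure Ω) : Prop :=
  ∃ k : ℕ, k ≤ p ∧ ∃ B : Fin k → Finset (Fin p),
    Pairwise (fun a b => Disjoint (B a) (B b)) ∧
    (∀ j : Fin p, ∃ a, j ∈ B a) ∧
    (∀ a, (B a).card ≤ d) ∧
    iIndepFun (fun (a : Fin k) (ω : Ω) (j : B a) => X ω j) μ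

/-- The empirical risk `H(w, A) = (1/n) ∑ i, ℓ i (A i ⬝ w) + R w` of the design matrix with
rows `A i`. -/
noncomputable def empRisk {n p : ℕ} (ℓ : Fin n → ℝ → ℝ) (R : EuclideanSpace ℝ (Fin p) → ℝ)
    (w : EuclideanSpace ℝ (Fin p)) (A : Fin n → EuclideanSpace ℝ (Fin p)) : ℝ :=
  (1 / (n : ℝ)) * ∑ i, ℓ i (∑ j, A i j * w j) + R w

/-- The minimized (infimal) empirical risk over `w ∈ S`. -/
noncomputable def minRisk {n p : ℕ} (ℓ : Fin n → ℝ → ℝ) (R : EuclideanSpace ℝ (Fin p) → ℝ)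
    (S : Set (EuclideanSpace ℝ (Fin p))) (A : Fin n → EuclideanSpace ℝ (Fin p)) : ℝ :=
  ⨅ w : S, empRisk ℓ R w A

/-- The cube `[-L, L]^p`. -/
def cube (p : ℕ) (L : ℝ) : Set (EuclideanSpace ℝ (Fin p)) :=
  {w | ∀ j, |w j| ≤ L}

/-- The exponent `𝐪 = max {3 q₁, q₁ + q₂, q₃}`. -/
noncomputable def bq (q : Fin 4 → ℝ) : ℝ := max (3 * q 1) (max (q 1 + q 2) (q 3))

/-- The even integer `2 ⌈q₀ 𝐪 / 2⌉`. -/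
noncomputable def bq0 (q : Fin 4 → ℝ) : ℕ := 2 * ⌈q 0 * bq q / 2⌉₊

/-- The moment order `q* = 2 ^ ((bq0 + 4) / 2)`; the exponent is an integer. -/
noncomputable def qStar (q : Fin 4 → ℝ) : ℕ := 2 ^ ((bq0 q + 4) / 2)

/-- The assumption on the losses: polynomial growth, and smooth nonnegative approximations
`ℓs ρ i` of `ℓ i` with self-bounding derivatives. Only the values of `Ml` and `Dl` on `(0, ρbar)`
matter. -/
structure LossAssumption {n : ℕ} (q : Fin 4 → ℝ) (ρbar : ℝ) (Lℓ : Fin n → ℝ)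
    (Dl Ml : ℝ → ℝ) (ℓ : Fin n → ℝ → ℝ) : Prop where
  q_nonneg : ∀ k, 0 ≤ q k
  ρbar_mem : ρbar ∈ Ioc (0 : ℝ) 1
  one_le_Lℓ : ∀ i, 1 ≤ Lℓ i
  Ml_mem : ∀ ρ ∈ Ioo 0 ρbar, Ml ρ ∈ Icc (0 : ℝ) 1
  one_le_Dl : ∀ ρ ∈ Ioo 0 ρbar, 1 ≤ Dl ρ
  growth : ∀ i x, |ℓ i x| / (1 + |x| ^ q 0) ≤ Lℓ i
  approx : ∃ ℓs : ℝ → Fin n → ℝ → ℝ, ∀ ρ ∈ Ioo 0 ρbar, ∀ i,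
    (∀ x, 0 ≤ ℓs ρ i x) ∧
    ContDiff ℝ 3 (ℓs ρ i) ∧
    (∀ x, |ℓs ρ i x - ℓ i x| ≤ Ml ρ) ∧
    (∀ k : Fin 4, k ≠ 0 → ∀ x,
      |iteratedDeriv k (ℓs ρ i) x| / (1 + |ℓs ρ i x| ^ q k) ≤ Dl ρ)

/-- The modulus of continuity of `R` on `[-L, L]^p` in the uniform norm, valued in `[0, ∞]`. -/
noncomputable def modR {p : ℕ} (R : EuclideanSpace ℝ (Fin p) → ℝ) (L δ : ℝ) : ℝ≥0∞ :=
  ⨆ (w ∈ cube p L) (w' ∈ cube p L) (_ : ∀ j, |w j - w' j| ≤ δ), ENNReal.ofReal |R w - R w'|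

/-- `log₊ x = max {1, log x}`. -/
noncomputable def logPlus (x : ℝ) : ℝ := max 1 (Real.log x)

/-- The quantity `σ_n`. -/
noncomputable def sigmaN (n p d : ℕ) (q : Fin 4 → ℝ) : ℝ :=
  (p : ℝ) * (d : ℝ) ^ (3 + (bq0 q : ℝ) / 2) / (n : ℝ) ^ (5 / 2 : ℝ)
    + (p : ℝ) * (d : ℝ) ^ 2 / (n : ℝ) ^ (3 / 2 : ℝ)
    + (p : ℝ) * (d : ℝ) ^ (bq0 q + 2) / (n : ℝ) ^ (((bq0 q : ℝ) + 3) / 2)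

/-- The quantity `ω_n`. -/
noncomputable def omegaN (n p d : ℕ) (q : Fin 4 → ℝ) : ℝ :=
  (n : ℝ) ^ (-(q 0 * q 1 + 3) / 2) * sigmaN n p d q

/-- The average `(1/n) ∑ i, (Lℓ i) ^ 𝐪`. -/
noncomputable def avL {n : ℕ} (q : Fin 4 → ℝ) (Lℓ : Fin n → ℝ) : ℝ :=
  (1 / (n : ℝ)) * ∑ i, Lℓ i ^ bq q

/-- The rate `r_R(L)`, valued in `[0, ∞]`. -/
noncomputable def rateR {n p : ℕ} (d : ℕ) (q : Fin 4 → ℝ) (ρbar : ℝ) (Lℓ : Fin n → ℝ)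
    (Dl Ml : ℝ → ℝ) (R : EuclideanSpace ℝ (Fin p) → ℝ) (L : ℝ) : ℝ≥0∞ :=
  ⨅ ρ ∈ Ioo 0 ρbar, (ENNReal.ofReal (Ml ρ) + ENNReal.ofReal (Dl ρ ^ 3) *
    ⨅ δ ∈ Ioo 0 (omegaN n p d q), (modR R L δ +
      ENNReal.ofReal (avL q Lℓ ^ (1 / 3 : ℝ) * L ^ (((bq0 q : ℝ) + 3) / 3)
        * logPlus (L / δ) ^ (2 / 3 : ℝ) * sigmaN n p d q ^ (1 / 3 : ℝ))))

/-- `K_g = 1 + max_{k = 0, …, 3} ‖g⁽ᵏ⁾‖_∞`, valued in `[0, ∞]`. -/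
noncomputable def Kg (g : ℝ → ℝ) : ℝ≥0∞ :=
  1 + ⨆ (k : Fin 4) (x : ℝ), ENNReal.ofReal |iteratedDeriv k g x|

section WeightedAverage

variable {W : Type*} [Fintype W]

/-- The average of `a` with respect to the (unnormalized) weights `c`. -/
noncomputable def wavg (c a : W → ℝ) : ℝ := (∑ w, c w * a w) / ∑ w, c w

theorem wavg_nonneg {c a : W → ℝ} (hc : ∀ w, 0 < c w) (ha : ∀ w, 0 ≤ a w) : 0 ≤ wavg c a :=
  div_nonneg (Finset.sum_nonneg fun w _ => mul_nonneg (hc w).le (ha w))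
    (Finset.sum_nonneg fun w _ => (hc w).le)

theorem wavg_mono {c a a' : W → ℝ} (hc : ∀ w, 0 < c w) (h : ∀ w, a w ≤ a' w) :
    wavg c a ≤ wavg c a' :=
  div_le_div_of_nonneg_right
    (Finset.sum_le_sum fun w _ => mul_le_mul_of_nonneg_left (h w) (hc w).le)
    (Finset.sum_nonneg fun w _ => (hc w).le)

theorem abs_wavg_le {c a : W → ℝ} (hc : ∀ w, 0 < c w) : |wavg c a| ≤ wavg c (fun w => |a w|) := by
  unfold wavg
  rw [abs_div, abs_of_nonneg (Finset.sum_nonneg fun w _ => (hc w).le : 0 ≤ ∑ w, c w)]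
  refine div_le_div_of_nonneg_right ?_ (Finset.sum_nonneg fun w _ => (hc w).le)
  refine (Finset.abs_sum_le_sum_abs _ _).trans (Finset.sum_le_sum fun w _ => ?_)
  rw [abs_mul, abs_of_pos (hc w)]

theorem wavg_const_mul (c a : W → ℝ) (k : ℝ) : wavg c (fun w => k * a w) = k * wavg c a := by
  unfold wavg
  rw [← mul_div_assoc, Finset.mul_sum]
  congr 1
  exact Finset.sum_congr rfl fun w _ => by ring

/-- **Chebyshev's association inequality**, in cross-multiplied form. -/
theorem sum_mul_sum_le_of_comonotone {c a e : W → ℝ} (hc : ∀ w, 0 ≤ c w)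
    (h : ∀ w w', 0 ≤ (a w - a w') * (e w - e w')) :
    (∑ w, c w * a w) * (∑ w, c w * e w) ≤ (∑ w, c w) * ∑ w, c w * (a w * e w) := by
  have key : 0 ≤ ∑ w, ∑ w', c w * c w' * ((a w - a w') * (e w - e w')) :=
    Finset.sum_nonneg fun w _ => Finset.sum_nonneg fun w' _ =>
      mul_nonneg (mul_nonneg (hc w) (hc w')) (h w w')
  have e1 : ∑ w, ∑ w', c w * c w' * ((a w - a w') * (e w - e w'))
      = (∑ w, c w * (a w * e w)) * (∑ w, c w) + (∑ w, c w) * (∑ w, c w * (a w * e w))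
        - (∑ w, c w * a w) * (∑ w, c w * e w) - (∑ w, c w * e w) * (∑ w, c w * a w) := by
    simp only [Finset.sum_mul_sum, ← Finset.sum_add_distrib, ← Finset.sum_sub_distrib]
    exact Finset.sum_congr rfl fun w _ => Finset.sum_congr rfl fun w' _ => by ring
  rw [e1] at key
  linarith [mul_comm (∑ w, c w * (a w * e w)) (∑ w, c w),
    mul_comm (∑ w, c w * e w) (∑ w, c w * a w)]

variable [Nonempty W]

theorem sum_weights_pos {c : W → ℝ} (hc : ∀ w, 0 < c w) : 0 < ∑ w, c w :=
  Finset.sum_pos (fun w _ => hc w) Finset.univ_nonempty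

theorem wavg_mul_wavg_le {c a e : W → ℝ} (hc : ∀ w, 0 < c w)
    (h : ∀ w w', 0 ≤ (a w - a w') * (e w - e w')) :
    wavg c a * wavg c e ≤ wavg c (fun w => a w * e w) := by
  unfold wavg
  have hp := sum_weights_pos hc
  rw [div_mul_div_comm, div_le_div_iff₀ (mul_pos hp hp) hp]
  nlinarith [sum_mul_sum_le_of_comonotone (fun w => (hc w).le) h]

/-- Tilting the weights by a factor that decreases with `a` decreases the average of `a`. -/
theorem wavg_tilt_le {c a e : W → ℝ} (hc : ∀ w, 0 < c w) (he : ∀ w, 0 < e w)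
    (h : ∀ w w', (a w - a w') * (e w - e w') ≤ 0) :
    wavg (fun w => c w * e w) a ≤ wavg c a := by
  unfold wavg
  rw [div_le_div_iff₀ (sum_weights_pos fun w => mul_pos (hc w) (he w)) (sum_weights_pos hc)]
  have := sum_mul_sum_le_of_comonotone (c := c) (a := fun w => - a w) (e := e)
    (fun w => (hc w).le) (fun w w' => by nlinarith [h w w'])
  simp only [mul_neg, neg_mul, Finset.sum_neg_distrib] at this
  have e1 : ∑ w, c w * e w * a w = ∑ w, c w * (a w * e w) :=
    Finset.sum_congr rfl fun w _ => by ring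
  rw [e1]
  linarith [mul_comm (∑ w, c w * (a w * e w)) (∑ w, c w)]

theorem hasDerivAt_gibbs_wavg {c : W → ℝ} (hc : ∀ w, 0 < c w) {b : ℝ} {F F' A A' : W → ℝ → ℝ}
    {t : ℝ} (hF : ∀ w, HasDerivAt (F w) (F' w t) t) (hA : ∀ w, HasDerivAt (A w) (A' w t) t) :
    HasDerivAt (fun t => wavg (fun w => c w * Real.exp (-b * F w t)) (fun w => A w t))
      (wavg (fun w => c w * Real.exp (-b * F w t)) (fun w => A' w t)
        - b * (wavg (fun w => c w * Real.exp (-b * F w t)) (fun w => A w t * F' w t)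
          - wavg (fun w => c w * Real.exp (-b * F w t)) (fun w => A w t)
            * wavg (fun w => c w * Real.exp (-b * F w t)) (fun w => F' w t))) t := by
  have hE : ∀ w, HasDerivAt (fun t => c w * Real.exp (-b * F w t))
      (c w * (Real.exp (-b * F w t) * (-b * F' w t))) t := fun w =>
    (((hF w).const_mul (-b)).exp).const_mul (c w)
  have hS := HasDerivAt.fun_sum (u := Finset.univ) fun w _ => hE w
  have hN := HasDerivAt.fun_sum (u := Finset.univ) fun w _ => (hE w).fun_mul (hA w)
  have hp : 0 < ∑ w, c w * Real.exp (-b * F w t) :=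
    sum_weights_pos fun w => mul_pos (hc w) (Real.exp_pos _)
  refine HasDerivAt.congr_deriv (hN.fun_div hS hp.ne') ?_
  have e1 : ∑ w, (c w * (Real.exp (-b * F w t) * (-b * F' w t)) * A w t
        + c w * Real.exp (-b * F w t) * A' w t)
      = -b * (∑ w, c w * Real.exp (-b * F w t) * (A w t * F' w t))
        + ∑ w, c w * Real.exp (-b * F w t) * A' w t := by
    rw [Finset.mul_sum, ← Finset.sum_add_distrib]
    exact Finset.sum_congr rfl fun w _ => by ring
  have e2 : ∑ w, c w * (Real.exp (-b * F w t) * (-b * F' w t))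
      = -b * ∑ w, c w * Real.exp (-b * F w t) * F' w t := by
    rw [Finset.mul_sum]
    exact Finset.sum_congr rfl fun w _ => by ring
  rw [e1, e2]
  unfold wavg
  field_simp
  ring

theorem hasDerivAt_log_gibbs {c : W → ℝ} (hc : ∀ w, 0 < c w) {b : ℝ} {F F' : W → ℝ → ℝ}
    {t : ℝ} (hF : ∀ w, HasDerivAt (F w) (F' w t) t) :
    HasDerivAt (fun t => Real.log (∑ w, c w * Real.exp (-b * F w t)))
      (-b * wavg (fun w => c w * Real.exp (-b * F w t)) (fun w => F' w t)) t := by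
  have hE : ∀ w, HasDerivAt (fun t => c w * Real.exp (-b * F w t))
      (c w * (Real.exp (-b * F w t) * (-b * F' w t))) t := fun w =>
    (((hF w).const_mul (-b)).exp).const_mul (c w)
  have hS := HasDerivAt.fun_sum (u := Finset.univ) fun w _ => hE w
  have hp : 0 < ∑ w, c w * Real.exp (-b * F w t) :=
    sum_weights_pos fun w => mul_pos (hc w) (Real.exp_pos _)
  refine HasDerivAt.congr_deriv (hS.log hp.ne') ?_
  unfold wavg
  rw [← mul_div_assoc, Finset.mul_sum]
  congr 1
  exact Finset.sum_congr rfl fun w _ => by ring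

end WeightedAverage

section Taylor

theorem abs_sub_le_of_deriv_bound {f f' : ℝ → ℝ} (hf : ∀ t, HasDerivAt f (f' t) t) {K : ℝ}
    (hK : ∀ t ∈ Icc (0 : ℝ) 1, |f' t| ≤ K) {t : ℝ} (ht : t ∈ Icc (0 : ℝ) 1) :
    |f t - f 0| ≤ K := by
  have h := (convex_Icc (0 : ℝ) 1).norm_image_sub_le_of_norm_hasDerivWithin_le
    (fun s _ => (hf s).hasDerivWithinAt) (fun s hs => by simpa using hK s hs)
    (left_mem_Icc.2 zero_le_one) ht
  have hK0 : 0 ≤ K := (abs_nonneg _).trans (hK t ht)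
  simp only [Real.norm_eq_abs, sub_zero, abs_of_nonneg ht.1] at h
  nlinarith [ht.2]

/-- Second order Taylor expansion at `0`, evaluated at `1`. -/
theorem abs_taylor_two_le {f f₁ f₂ f₃ : ℝ → ℝ} (h₁ : ∀ t, HasDerivAt f (f₁ t) t)
    (h₂ : ∀ t, HasDerivAt f₁ (f₂ t) t) (h₃ : ∀ t, HasDerivAt f₂ (f₃ t) t) {K : ℝ}
    (hK : ∀ t ∈ Icc (0 : ℝ) 1, |f₃ t| ≤ K) :
    |f 1 - (f 0 + f₁ 0 + f₂ 0 / 2)| ≤ K := by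
  have a₂ : ∀ t ∈ Icc (0 : ℝ) 1, |f₂ t - f₂ 0| ≤ K := fun t ht =>
    abs_sub_le_of_deriv_bound h₃ hK ht
  have a₁ : ∀ t ∈ Icc (0 : ℝ) 1, |f₁ t - f₁ 0 - f₂ 0 * t| ≤ K := fun t ht => by
    have := abs_sub_le_of_deriv_bound (f := fun t => f₁ t - f₂ 0 * t) (f' := fun t => f₂ t - f₂ 0)
      (fun t => ((h₂ t).fun_sub ((hasDerivAt_id' t).const_mul (f₂ 0))).congr_deriv (by ring)) a₂ ht
    simp only [mul_zero, sub_zero] at this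
    convert this using 2
    ring
  have a₀ := abs_sub_le_of_deriv_bound (f := fun t => f t - f₁ 0 * t - f₂ 0 * (t ^ 2 / 2))
    (f' := fun t => f₁ t - f₁ 0 - f₂ 0 * t)
    (fun t => (((h₁ t).fun_sub ((hasDerivAt_id' t).const_mul (f₁ 0))).fun_sub
        ((((hasDerivAt_id' t).fun_pow 2).div_const 2).const_mul (f₂ 0))).congr_deriv
          (by norm_num)) a₁ (right_mem_Icc.2 zero_le_one)
  convert a₀ using 2
  ring

end Taylor

section SoftminLine

theorem mul_sub_nonneg_of_monotoneOn {G G' : ℝ → ℝ} (hG : MonotoneOn G (Ici 0))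
    (hG' : MonotoneOn G' (Ici 0)) {u v : ℝ} (hu : 0 ≤ u) (hv : 0 ≤ v) :
    0 ≤ (G u - G v) * (G' u - G' v) := by
  rcases le_total u v with h | h
  · exact mul_nonneg_of_nonpos_of_nonpos (sub_nonpos.2 (hG hu hv h)) (sub_nonpos.2 (hG' hu hv h))
  · exact mul_nonneg (sub_nonneg.2 (hG hv hu h)) (sub_nonneg.2 (hG' hv hu h))

/-- The third derivative of `g ∘ φ`, for a log-partition function `φ` whose mixed moments are
bounded by `B`. -/
theorem abs_third_deriv_comp_softmin_le {N b K B g₁ g₂ g₃ X₁ X₂ X₃ X₁₁ X₁₂ X₁₁₁ : ℝ}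
    (hN : 1 ≤ N) (hb : 1 ≤ b) (hg₁ : |g₁| ≤ K) (hg₂ : |g₂| ≤ K) (hg₃ : |g₃| ≤ K)
    (h₃ : |X₃| ≤ B) (h₁₂ : |X₁₂| ≤ B) (h₁₂' : |X₁ * X₂| ≤ B) (h₁₁₁ : |X₁₁₁| ≤ B)
    (h₁₁₁' : |X₁₁ * X₁| ≤ B) (h₁₁₁'' : |X₁ ^ 3| ≤ B) :
    |g₃ * (X₁ / N) ^ 3 + 3 * g₂ * (X₁ / N) * ((X₂ - b * (X₁₁ - X₁ * X₁)) / N)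
      + g₁ * ((X₃ - 3 * b * X₁₂ + 3 * b * (X₁ * X₂) + b ^ 2 * X₁₁₁ - 3 * b ^ 2 * (X₁₁ * X₁)
        + 2 * b ^ 2 * X₁ ^ 3) / N)| ≤ 23 * K * b ^ 2 * B / N := by
  have hB : 0 ≤ B := (abs_nonneg _).trans h₃
  have hK : 0 ≤ K := (abs_nonneg _).trans hg₁
  have hN0 : 0 < N := by linarith
  have hb2 : b ≤ b ^ 2 := by nlinarith
  have hb1 : 1 ≤ b ^ 2 := by nlinarith
  have hBb : b * B ≤ b ^ 2 * B := mul_le_mul_of_nonneg_right hb2 hB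
  have hBb1 : B ≤ b ^ 2 * B := le_mul_of_one_le_left hB hb1
  have hbm : ∀ x : ℝ, |x| ≤ B → |b * x| ≤ b ^ 2 * B := fun x hx => by
    rw [abs_mul, abs_of_pos (by linarith : 0 < b)]
    exact (mul_le_mul_of_nonneg_left hx (by linarith)).trans hBb
  have hbbm : ∀ x : ℝ, |x| ≤ B → |b ^ 2 * x| ≤ b ^ 2 * B := fun x hx => by
    rw [abs_mul, abs_of_pos (by linarith : 0 < b ^ 2)]
    exact mul_le_mul_of_nonneg_left hx (by linarith)
  have t₃ : |X₃ - 3 * b * X₁₂ + 3 * b * (X₁ * X₂) + b ^ 2 * X₁₁₁ - 3 * b ^ 2 * (X₁₁ * X₁)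
        + 2 * b ^ 2 * X₁ ^ 3| ≤ 13 * (b ^ 2 * B) := by
    have a1 := abs_le.1 (h₃.trans hBb1)
    have a2 := abs_le.1 (hbm _ h₁₂)
    have a3 := abs_le.1 (hbm _ h₁₂')
    have a4 := abs_le.1 (hbbm _ h₁₁₁)
    have a5 := abs_le.1 (hbbm _ h₁₁₁')
    have a6 := abs_le.1 (hbbm _ h₁₁₁'')
    rw [abs_le]
    constructor <;> linarith [a1.1, a1.2]
  have t₂ : |X₁ * (X₂ - b * (X₁₁ - X₁ * X₁))| ≤ 3 * (b ^ 2 * B) := by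
    have a3 := abs_le.1 (h₁₂'.trans hBb1)
    have a5 := abs_le.1 (hbm _ h₁₁₁')
    have a6 := abs_le.1 (hbm _ h₁₁₁'')
    have e : X₁ * (X₂ - b * (X₁₁ - X₁ * X₁)) = X₁ * X₂ - b * (X₁₁ * X₁) + b * X₁ ^ 3 := by ring
    rw [e, abs_le]
    constructor <;> linarith [a3.1, a3.2]
  have t₁ : |X₁ ^ 3| ≤ b ^ 2 * B := h₁₁₁''.trans hBb1
  have hP : 0 ≤ b ^ 2 * B := by positivity
  have hN2 : N ≤ N ^ 2 := by nlinarith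
  have hN3 : N ≤ N ^ 3 := by nlinarith
  have s₁ : |g₃ * (X₁ / N) ^ 3| ≤ K * (b ^ 2 * B / N) := by
    rw [abs_mul]
    refine mul_le_mul hg₃ ?_ (abs_nonneg _) hK
    rw [div_pow, abs_div, abs_of_pos (pow_pos hN0 3)]
    exact div_le_div₀ hP t₁ hN0 hN3
  have s₂ : |3 * g₂ * (X₁ / N) * ((X₂ - b * (X₁₁ - X₁ * X₁)) / N)|
      ≤ K * (9 * (b ^ 2 * B) / N) := by
    have e : 3 * g₂ * (X₁ / N) * ((X₂ - b * (X₁₁ - X₁ * X₁)) / N)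
        = g₂ * (3 * (X₁ * (X₂ - b * (X₁₁ - X₁ * X₁))) / N ^ 2) := by
      field_simp
    rw [e, abs_mul]
    refine mul_le_mul hg₂ ?_ (abs_nonneg _) hK
    rw [abs_div, abs_of_pos (pow_pos hN0 2), abs_mul, abs_of_pos (by norm_num : (0 : ℝ) < 3)]
    exact div_le_div₀ (by linarith) (by linarith) hN0 hN2
  have s₃ : |g₁ * ((X₃ - 3 * b * X₁₂ + 3 * b * (X₁ * X₂) + b ^ 2 * X₁₁₁ - 3 * b ^ 2 * (X₁₁ * X₁)
        + 2 * b ^ 2 * X₁ ^ 3) / N)| ≤ K * (13 * (b ^ 2 * B) / N) := by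
    rw [abs_mul]
    refine mul_le_mul hg₁ ?_ (abs_nonneg _) hK
    rw [abs_div, abs_of_pos hN0]
    exact div_le_div_of_nonneg_right t₃ hN0.le
  refine ((abs_add_le _ _).trans (add_le_add_left (abs_add_le _ _) _)).trans ?_
  refine (add_le_add (add_le_add s₁ s₂) s₃).trans (le_of_eq ?_)
  ring

variable {W : Type*} [Fintype W] [Nonempty W]

/-- Second order expansion, in the increment `y`, of a smooth function of the soft minimum
`-(N b)⁻¹ log ∑ w, c w exp (-b f (r w + y w))`, with a remainder controlled by the untilted
average of `Ψ ∘ f`. -/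
theorem exists_softmin_expansion {N b K D : ℝ} (hN : 1 ≤ N) (hb : 1 ≤ b) (hD : 1 ≤ D)
    {g g₁ g₂ g₃ : ℝ → ℝ} (dg : ∀ x, HasDerivAt g (g₁ x) x) (dg₁ : ∀ x, HasDerivAt g₁ (g₂ x) x)
    (dg₂ : ∀ x, HasDerivAt g₂ (g₃ x) x) (hg₁ : ∀ x, |g₁ x| ≤ K) (hg₂ : ∀ x, |g₂ x| ≤ K)
    (hg₃ : ∀ x, |g₃ x| ≤ K)
    {f f₁ f₂ f₃ : ℝ → ℝ} (hf : ∀ x, 0 ≤ f x) (df : ∀ x, HasDerivAt f (f₁ x) x)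
    (df₁ : ∀ x, HasDerivAt f₁ (f₂ x) x) (df₂ : ∀ x, HasDerivAt f₂ (f₃ x) x)
    {G₁ G₂ G₃ Ψ : ℝ → ℝ} (mG₁ : MonotoneOn G₁ (Ici 0)) (mG₂ : MonotoneOn G₂ (Ici 0))
    (mΨ : MonotoneOn Ψ (Ici 0)) (G₁0 : ∀ u, 0 ≤ u → 0 ≤ G₁ u) (G₂0 : ∀ u, 0 ≤ u → 0 ≤ G₂ u)
    (hΨ₁ : ∀ u, 0 ≤ u → G₁ u ^ 3 ≤ Ψ u) (hΨ₂ : ∀ u, 0 ≤ u → G₁ u * G₂ u ≤ Ψ u)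
    (hΨ₃ : ∀ u, 0 ≤ u → G₃ u ≤ Ψ u)
    (hf₁ : ∀ x, |f₁ x| ≤ D * G₁ (f x)) (hf₂ : ∀ x, |f₂ x| ≤ D * G₂ (f x))
    (hf₃ : ∀ x, |f₃ x| ≤ D * G₃ (f x))
    {c : W → ℝ} (hc : ∀ w, 0 < c w) (r : W → ℝ) :
    ∃ (Φ₀ : ℝ) (α : W → ℝ) (γ : W → W → ℝ), ∀ (y : W → ℝ) (η Ξ : ℝ), (∀ w, |y w| ≤ η) →
      (∀ t ∈ Icc (0 : ℝ) 1, wavg c (fun w => Ψ (f (r w + t * y w))) ≤ Ξ) →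
      |g (-(1 / (N * b)) * Real.log (∑ w, c w * Real.exp (-b * f (r w + y w))))
        - (Φ₀ + ∑ w, α w * y w + ∑ w, ∑ w', γ w w' * (y w * y w'))|
      ≤ 23 * K * b ^ 2 * (D ^ 3 * η ^ 3 * Ξ) / N := by
  classical
  have hN0 : 0 < N := by linarith
  have hb0 : 0 < b := by linarith
  set m₀ : W → ℝ := fun w => c w * Real.exp (-b * f (r w)) with hm₀
  set φ₀ : ℝ := -(1 / (N * b)) * Real.log (∑ w, m₀ w) with hφ₀
  set Z : ℝ := ∑ w, m₀ w with hZ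
  refine ⟨g φ₀, fun w => g₁ φ₀ / N * (m₀ w * f₁ (r w) / Z),
    fun w w' => (g₂ φ₀ / N ^ 2 + g₁ φ₀ / N * b) / 2 * (m₀ w * f₁ (r w) / Z)
      * (m₀ w' * f₁ (r w') / Z) + if w = w' then g₁ φ₀ / N / 2
        * (m₀ w * (f₂ (r w) - b * f₁ (r w) ^ 2) / Z) else 0, ?_⟩
  intro y η Ξ hy hΞ
  set F : W → ℝ → ℝ := fun w t => f (r w + t * y w) with hF
  set F₁ : W → ℝ → ℝ := fun w t => f₁ (r w + t * y w) * y w with hF₁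
  set F₂ : W → ℝ → ℝ := fun w t => f₂ (r w + t * y w) * y w ^ 2 with hF₂
  set F₃ : W → ℝ → ℝ := fun w t => f₃ (r w + t * y w) * y w ^ 3 with hF₃
  have dl : ∀ w t, HasDerivAt (fun t => r w + t * y w) (y w) t := fun w t => by
    simpa using ((hasDerivAt_id' t).mul_const (y w)).const_add (r w)
  have dF : ∀ t w, HasDerivAt (F w) (F₁ w t) t := fun t w => (df _).comp t (dl w t)
  have dF₁ : ∀ t w, HasDerivAt (F₁ w) (F₂ w t) t := fun t w =>
    (((df₁ _).comp t (dl w t)).mul_const (y w)).congr_deriv (by simp only [hF₂]; ring)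
  have dF₂ : ∀ t w, HasDerivAt (F₂ w) (F₃ w t) t := fun t w =>
    (((df₂ _).comp t (dl w t)).mul_const (y w ^ 2)).congr_deriv (by simp only [hF₃]; ring)
  set m : ℝ → W → ℝ := fun t w => c w * Real.exp (-b * F w t) with hm
  have hmpos : ∀ t w, 0 < m t w := fun t w => mul_pos (hc w) (Real.exp_pos _)
  set X₁ : ℝ → ℝ := fun t => wavg (m t) (fun w => F₁ w t) with hX₁
  set X₂ : ℝ → ℝ := fun t => wavg (m t) (fun w => F₂ w t) with hX₂
  set X₃ : ℝ → ℝ := fun t => wavg (m t) (fun w => F₃ w t) with hX₃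
  set X₁₁ : ℝ → ℝ := fun t => wavg (m t) (fun w => F₁ w t * F₁ w t) with hX₁₁
  set X₁₂ : ℝ → ℝ := fun t => wavg (m t) (fun w => F₂ w t * F₁ w t) with hX₁₂
  set X₁₁₁ : ℝ → ℝ := fun t => wavg (m t) (fun w => F₁ w t * F₁ w t * F₁ w t) with hX₁₁₁
  set φ : ℝ → ℝ := fun t => -(1 / (N * b)) * Real.log (∑ w, m t w) with hφ
  have dφ : ∀ t, HasDerivAt φ (X₁ t / N) t := fun t =>
    ((hasDerivAt_log_gibbs hc (b := b) (dF t)).const_mul (-(1 / (N * b)))).congr_deriv (by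
      simp only [hX₁, hm]; field_simp)
  have dX₁ : ∀ t, HasDerivAt X₁ (X₂ t - b * (X₁₁ t - X₁ t * X₁ t)) t := fun t =>
    hasDerivAt_gibbs_wavg hc (b := b) (dF t) (dF₁ t)
  have dX₂ : ∀ t, HasDerivAt X₂ (X₃ t - b * (X₁₂ t - X₂ t * X₁ t)) t := fun t =>
    hasDerivAt_gibbs_wavg hc (b := b) (dF t) (dF₂ t)
  have dX₁₁ : ∀ t, HasDerivAt X₁₁ (2 * X₁₂ t - b * (X₁₁₁ t - X₁₁ t * X₁ t)) t := fun t => by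
    have h := hasDerivAt_gibbs_wavg hc (b := b) (dF t) (A := fun w t => F₁ w t * F₁ w t)
      (A' := fun w t => 2 * (F₂ w t * F₁ w t))
      (fun w => ((dF₁ t w).fun_mul (dF₁ t w)).congr_deriv (by ring))
    rw [wavg_const_mul] at h
    exact h
  have d₁ : ∀ t, HasDerivAt (fun t => g (φ t)) (g₁ (φ t) * (X₁ t / N)) t := fun t =>
    (dg (φ t)).comp t (dφ t)
  have d₂ : ∀ t, HasDerivAt (fun t => g₁ (φ t) * (X₁ t / N))
      (g₂ (φ t) * (X₁ t / N) ^ 2 + g₁ (φ t) * ((X₂ t - b * (X₁₁ t - X₁ t * X₁ t)) / N)) t :=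
    fun t => (((dg₁ (φ t)).comp t (dφ t)).fun_mul ((dX₁ t).div_const N)).congr_deriv (by
      simp only [Function.comp]; ring)
  have d₃ : ∀ t, HasDerivAt
      (fun t => g₂ (φ t) * (X₁ t / N) ^ 2 + g₁ (φ t) * ((X₂ t - b * (X₁₁ t - X₁ t * X₁ t)) / N))
      (g₃ (φ t) * (X₁ t / N) ^ 3
        + 3 * g₂ (φ t) * (X₁ t / N) * ((X₂ t - b * (X₁₁ t - X₁ t * X₁ t)) / N)
        + g₁ (φ t) * ((X₃ t - 3 * b * X₁₂ t + 3 * b * (X₁ t * X₂ t) + b ^ 2 * X₁₁₁ t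
          - 3 * b ^ 2 * (X₁₁ t * X₁ t) + 2 * b ^ 2 * X₁ t ^ 3) / N)) t := fun t => by
    refine ((((dg₂ (φ t)).comp t (dφ t)).fun_mul (((dX₁ t).div_const N).fun_pow 2)).fun_add
      (((dg₁ (φ t)).comp t (dφ t)).fun_mul
        (((dX₂ t).fun_sub (((dX₁₁ t).fun_sub ((dX₁ t).fun_mul (dX₁ t))).const_mul b)).div_const
          N))).congr_deriv ?_
    simp only [Function.comp]
    push_cast
    ring
  have hη : 0 ≤ η := (abs_nonneg _).trans (hy (Classical.arbitrary W))
  have hF0 : ∀ w t, 0 ≤ F w t := fun w t => hf _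
  have bF₁ : ∀ w t, |F₁ w t| ≤ D * η * G₁ (F w t) := fun w t => by
    rw [hF₁, abs_mul]
    calc _ ≤ (D * G₁ (F w t)) * η := mul_le_mul (hf₁ _) (hy w) (abs_nonneg _)
          (mul_nonneg (by linarith) (G₁0 _ (hF0 w t)))
      _ = _ := by ring
  have bF₂ : ∀ w t, |F₂ w t| ≤ D * η ^ 2 * G₂ (F w t) := fun w t => by
    rw [hF₂, abs_mul, abs_pow]
    calc _ ≤ (D * G₂ (F w t)) * η ^ 2 := mul_le_mul (hf₂ _)
          (pow_le_pow_left₀ (abs_nonneg _) (hy w) 2) (by positivity)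
          (mul_nonneg (by linarith) (G₂0 _ (hF0 w t)))
      _ = _ := by ring
  have bF₃ : ∀ w t, |F₃ w t| ≤ D * η ^ 3 * Ψ (F w t) := fun w t => by
    have h0 : |f₃ (r w + t * y w)| ≤ D * Ψ (F w t) :=
      (hf₃ _).trans (mul_le_mul_of_nonneg_left (hΨ₃ _ (hF0 w t)) (by linarith))
    rw [hF₃, abs_mul, abs_pow]
    calc _ ≤ (D * Ψ (F w t)) * η ^ 3 := mul_le_mul h0
          (pow_le_pow_left₀ (abs_nonneg _) (hy w) 3) (by positivity) ((abs_nonneg _).trans h0)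
      _ = _ := by ring
  have main : ∀ t ∈ Icc (0 : ℝ) 1, |g₃ (φ t) * (X₁ t / N) ^ 3
        + 3 * g₂ (φ t) * (X₁ t / N) * ((X₂ t - b * (X₁₁ t - X₁ t * X₁ t)) / N)
        + g₁ (φ t) * ((X₃ t - 3 * b * X₁₂ t + 3 * b * (X₁ t * X₂ t) + b ^ 2 * X₁₁₁ t
          - 3 * b ^ 2 * (X₁₁ t * X₁ t) + 2 * b ^ 2 * X₁ t ^ 3) / N)|
      ≤ 23 * K * b ^ 2 * (D ^ 3 * η ^ 3 * Ξ) / N := by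
    intro t ht
    set Q : ℝ := wavg (m t) (fun w => Ψ (F w t)) with hQ
    have hΨ0 : ∀ w, 0 ≤ Ψ (F w t) := fun w =>
      (pow_nonneg (G₁0 _ (hF0 w t)) 3).trans (hΨ₁ _ (hF0 w t))
    have hQ0 : 0 ≤ Q := wavg_nonneg (hmpos t) hΨ0
    have hQΞ : Q ≤ Ξ := by
      refine le_trans ?_ (hΞ t ht)
      refine wavg_tilt_le hc (fun w => Real.exp_pos _) fun w w' => ?_
      rcases le_total (F w t) (F w' t) with h | h
      · refine mul_nonpos_of_nonpos_of_nonneg (sub_nonpos.2 (mΨ (hF0 w t) (hF0 w' t) h))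
          (sub_nonneg.2 (Real.exp_le_exp.2 ?_))
        nlinarith
      · refine mul_nonpos_of_nonneg_of_nonpos (sub_nonneg.2 (mΨ (hF0 w' t) (hF0 w t) h))
          (sub_nonpos.2 (Real.exp_le_exp.2 ?_))
        nlinarith
    set e₁ : ℝ := wavg (m t) (fun w => G₁ (F w t)) with he₁
    set e₂ : ℝ := wavg (m t) (fun w => G₂ (F w t)) with he₂
    set e₁₁ : ℝ := wavg (m t) (fun w => G₁ (F w t) * G₁ (F w t)) with he₁₁
    have mG₁₁ : MonotoneOn (fun u => G₁ u * G₁ u) (Ici 0) := fun u hu v hv huv =>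
      mul_le_mul (mG₁ hu hv huv) (mG₁ hu hv huv) (G₁0 u hu) (G₁0 v hv)
    have e₁0 : 0 ≤ e₁ := wavg_nonneg (hmpos t) fun w => G₁0 _ (hF0 w t)
    have e₂0 : 0 ≤ e₂ := wavg_nonneg (hmpos t) fun w => G₂0 _ (hF0 w t)
    have e₁₁0 : 0 ≤ e₁₁ := wavg_nonneg (hmpos t) fun w =>
      mul_nonneg (G₁0 _ (hF0 w t)) (G₁0 _ (hF0 w t))
    have c₁₂ : e₁ * e₂ ≤ Q :=
      (wavg_mul_wavg_le (hmpos t) fun w w' => mul_sub_nonneg_of_monotoneOn mG₁ mG₂ (hF0 w t)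
        (hF0 w' t)).trans (wavg_mono (hmpos t) fun w => hΨ₂ _ (hF0 w t))
    have c₁₁ : e₁ * e₁ ≤ e₁₁ := wavg_mul_wavg_le (hmpos t) fun w w' =>
      mul_sub_nonneg_of_monotoneOn mG₁ mG₁ (hF0 w t) (hF0 w' t)
    have c₁₁₁ : e₁₁ * e₁ ≤ Q :=
      (wavg_mul_wavg_le (hmpos t) fun w w' => mul_sub_nonneg_of_monotoneOn mG₁₁ mG₁ (hF0 w t)
        (hF0 w' t)).trans (wavg_mono (hmpos t) fun w => by
          have := hΨ₁ _ (hF0 w t)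
          nlinarith [this])
    have c₁c : e₁ ^ 3 ≤ Q := by nlinarith [mul_le_mul_of_nonneg_right c₁₁ e₁0]
    have avg_le : ∀ {a a' : W → ℝ} {k : ℝ}, (∀ w, |a w| ≤ k * a' w) →
        |wavg (m t) a| ≤ k * wavg (m t) a' := fun {a a' k} h =>
      (abs_wavg_le (hmpos t)).trans ((wavg_mono (hmpos t) h).trans_eq (wavg_const_mul _ _ _))
    have x₁ : |X₁ t| ≤ D * η * e₁ := avg_le fun w => bF₁ w t
    have x₂ : |X₂ t| ≤ D * η ^ 2 * e₂ := avg_le fun w => bF₂ w t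
    have x₃ : |X₃ t| ≤ D * η ^ 3 * Q := avg_le fun w => bF₃ w t
    have x₁₁ : |X₁₁ t| ≤ D ^ 2 * η ^ 2 * e₁₁ := avg_le fun w => by
      rw [abs_mul]
      refine (mul_le_mul (bF₁ w t) (bF₁ w t) (abs_nonneg _) ((abs_nonneg _).trans
        (bF₁ w t))).trans_eq (by ring)
    have x₁₂ : |X₁₂ t| ≤ D ^ 2 * η ^ 3 * Q := avg_le fun w => by
      rw [abs_mul]
      refine (mul_le_mul (bF₂ w t) (bF₁ w t) (abs_nonneg _) ((abs_nonneg _).trans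
        (bF₂ w t))).trans ?_
      calc _ = D ^ 2 * η ^ 3 * (G₁ (F w t) * G₂ (F w t)) := by ring
        _ ≤ _ := mul_le_mul_of_nonneg_left (hΨ₂ _ (hF0 w t)) (by positivity)
    have x₁₁₁ : |X₁₁₁ t| ≤ D ^ 3 * η ^ 3 * Q := avg_le fun w => by
      rw [abs_mul, abs_mul]
      have h := pow_le_pow_left₀ (abs_nonneg _) (bF₁ w t) 3
      calc _ = |F₁ w t| ^ 3 := by ring
        _ ≤ _ := h
        _ = D ^ 3 * η ^ 3 * G₁ (F w t) ^ 3 := by ring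
        _ ≤ _ := mul_le_mul_of_nonneg_left (hΨ₁ _ (hF0 w t)) (by positivity)
    have hD2 : D ^ 2 ≤ D ^ 3 := pow_le_pow_right₀ hD (by norm_num)
    have hD1 : D ≤ D ^ 3 := le_self_pow₀ hD (by norm_num)
    have hη3 : 0 ≤ η ^ 3 := by positivity
    have up : ∀ k, k ≤ D ^ 3 → k * η ^ 3 * Q ≤ D ^ 3 * η ^ 3 * Q := fun k hk =>
      mul_le_mul_of_nonneg_right (mul_le_mul_of_nonneg_right hk hη3) hQ0
    have x₁x₂ : |X₁ t * X₂ t| ≤ D ^ 3 * η ^ 3 * Q := by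
      rw [abs_mul]
      calc _ ≤ (D * η * e₁) * (D * η ^ 2 * e₂) :=
            mul_le_mul x₁ x₂ (abs_nonneg _) (by positivity)
        _ = D ^ 2 * η ^ 3 * (e₁ * e₂) := by ring
        _ ≤ D ^ 2 * η ^ 3 * Q := mul_le_mul_of_nonneg_left c₁₂ (by positivity)
        _ ≤ _ := up _ hD2
    have x₁₁x₁ : |X₁₁ t * X₁ t| ≤ D ^ 3 * η ^ 3 * Q := by
      rw [abs_mul]
      calc _ ≤ (D ^ 2 * η ^ 2 * e₁₁) * (D * η * e₁) :=
            mul_le_mul x₁₁ x₁ (abs_nonneg _) (by positivity)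
        _ = D ^ 3 * η ^ 3 * (e₁₁ * e₁) := by ring
        _ ≤ _ := mul_le_mul_of_nonneg_left c₁₁₁ (by positivity)
    have x₁c : |X₁ t ^ 3| ≤ D ^ 3 * η ^ 3 * Q := by
      rw [abs_pow]
      calc _ ≤ (D * η * e₁) ^ 3 := pow_le_pow_left₀ (abs_nonneg _) x₁ 3
        _ = D ^ 3 * η ^ 3 * e₁ ^ 3 := by ring
        _ ≤ _ := mul_le_mul_of_nonneg_left c₁c (by positivity)
    have hK : 0 ≤ K := (abs_nonneg _).trans (hg₁ 0)
    refine (abs_third_deriv_comp_softmin_le hN hb (hg₁ _) (hg₂ _) (hg₃ _)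
      (x₃.trans (up _ hD1)) (x₁₂.trans (up _ hD2)) x₁x₂ x₁₁₁ x₁₁x₁ x₁c).trans ?_
    gcongr
  have key := abs_taylor_two_le d₁ d₂ d₃ main
  have eφ1 : φ 1 = -(1 / (N * b)) * Real.log (∑ w, c w * Real.exp (-b * f (r w + y w))) := by
    simp only [hφ, hm, hF, one_mul]
  have em0 : m 0 = m₀ := by
    simp only [hm, hF, hm₀, zero_mul, add_zero]
  have eφ0 : φ 0 = φ₀ := by simp only [hφ, em0, hφ₀, hZ]
  have eX₁ : X₁ 0 = ∑ w, (m₀ w * f₁ (r w) / Z) * y w := by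
    simp only [hX₁, wavg, em0, hF₁, zero_mul, add_zero, Finset.sum_div, ← hZ]
    exact Finset.sum_congr rfl fun w _ => by ring
  have eX₂ : X₂ 0 - b * X₁₁ 0
      = ∑ w, (m₀ w * (f₂ (r w) - b * f₁ (r w) ^ 2) / Z) * (y w * y w) := by
    simp only [hX₂, hX₁₁, wavg, em0, hF₁, hF₂, zero_mul, add_zero, Finset.sum_div, ← hZ,
      Finset.mul_sum, ← Finset.sum_sub_distrib]
    exact Finset.sum_congr rfl fun w _ => by ring
  rw [← eφ1]
  convert key using 2
  have q₁ : ∑ w, g₁ φ₀ / N * (m₀ w * f₁ (r w) / Z) * y w = g₁ φ₀ * (X₁ 0 / N) := by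
    rw [eX₁, Finset.sum_div, Finset.mul_sum]
    exact Finset.sum_congr rfl fun w _ => by ring
  have q₂ : ∑ w, ∑ w', ((g₂ φ₀ / N ^ 2 + g₁ φ₀ / N * b) / 2 * (m₀ w * f₁ (r w) / Z)
      * (m₀ w' * f₁ (r w') / Z) + if w = w' then g₁ φ₀ / N / 2
        * (m₀ w * (f₂ (r w) - b * f₁ (r w) ^ 2) / Z) else 0) * (y w * y w')
      = (g₂ φ₀ / N ^ 2 + g₁ φ₀ / N * b) / 2 * (X₁ 0 * X₁ 0)
        + g₁ φ₀ / N / 2 * (X₂ 0 - b * X₁₁ 0) := by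
    rw [eX₁, eX₂, Finset.sum_mul_sum, Finset.mul_sum, Finset.mul_sum, ← Finset.sum_add_distrib]
    refine Finset.sum_congr rfl fun w _ => ?_
    simp only [add_mul, Finset.sum_add_distrib, ite_mul, zero_mul, Finset.sum_ite_eq,
      Finset.mem_univ, if_true]
    congr 1
    · rw [Finset.mul_sum]
      exact Finset.sum_congr rfl fun w' _ => by ring
    · ring
  rw [q₁, q₂, eφ0]
  ring

end SoftminLine

section Lindeberg

variable {ι E : Type*} [Fintype ι] [DecidableEq ι] [MeasurableSpace E]

/-- Resampling one coordinate of a product measure. -/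
theorem map_update_prod_pi (m : ι → Measure E) [∀ i, IsProbabilityMeasure (m i)] (Q : Measure E)
    [IsProbabilityMeasure Q] (j : ι) :
    ((Measure.pi m).prod Q).map (fun z : (ι → E) × E => Function.update z.1 j z.2)
      = Measure.pi (Function.update m j Q) := by
  have hp : ∀ i, IsProbabilityMeasure (Function.update m j Q i) := fun i => by
    by_cases h : i = j
    · subst h; simpa
    · simpa [h] using ‹∀ i, IsProbabilityMeasure (m i)› i
  have hmeas : Measurable (fun z : (ι → E) × E => Function.update z.1 j z.2) := by
    refine measurable_pi_iff.2 fun i => ?_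
    by_cases h : i = j
    · subst h; simpa using measurable_snd
    · simpa [h, Function.comp_def] using (measurable_pi_apply (X := fun _ : ι => E) i).comp measurable_fst
  refine (Measure.pi_eq fun s hs => ?_).symm
  rw [Measure.map_apply hmeas (MeasurableSet.univ_pi hs)]
  have e : (fun z : (ι → E) × E => Function.update z.1 j z.2) ⁻¹' (univ.pi s)
      = (univ.pi (Function.update s j univ)) ×ˢ s j := by
    ext ⟨x, y⟩
    simp only [mem_preimage, mem_univ_pi, mem_prod]
    constructor
    · intro h
      refine ⟨fun i => ?_, by simpa using h j⟩
      by_cases hi : i = j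
      · subst hi; simp
      · simpa [hi] using h i
    · rintro ⟨h, hy⟩ i
      by_cases hi : i = j
      · subst hi; simpa using hy
      · simpa [hi] using h i
  rw [e, Measure.prod_prod, Measure.pi_pi, ← Finset.mul_prod_erase _ _ (Finset.mem_univ j),
    ← Finset.mul_prod_erase _ _ (Finset.mem_univ j)]
  simp only [Function.update_self, measure_univ, one_mul]
  rw [mul_comm]
  congr 1
  refine Finset.prod_congr rfl fun i hi => ?_
  simp [Finset.ne_of_mem_erase hi]

/-- The telescoping sum of the Lindeberg replacement method. -/
theorem abs_integral_pi_sub_le_sum (P Q : ι → Measure E) (F : (ι → E) → ℝ) (ε : ι → ℝ)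
    (h : ∀ m : ι → Measure E, (∀ i, m i = P i ∨ m i = Q i) → ∀ j,
      |∫ x, F x ∂(Measure.pi (Function.update m j (P j)))
        - ∫ x, F x ∂(Measure.pi (Function.update m j (Q j)))| ≤ ε j) :
    |∫ x, F x ∂(Measure.pi P) - ∫ x, F x ∂(Measure.pi Q)| ≤ ∑ j, ε j := by
  classical
  have key : ∀ s : Finset ι, |∫ x, F x ∂(Measure.pi P)
      - ∫ x, F x ∂(Measure.pi (fun i => if i ∈ s then Q i else P i))| ≤ ∑ j ∈ s, ε j := by
    intro s
    induction s using Finset.induction_on with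
    | empty => simp
    | insert j s hj ih =>
      have e₁ : Function.update (fun i => if i ∈ s then Q i else P i) j (P j)
          = fun i => if i ∈ s then Q i else P i := by
        ext1 i
        by_cases hi : i = j
        · subst hi; simp [hj]
        · simp [hi]
      have e₂ : Function.update (fun i => if i ∈ s then Q i else P i) j (Q j)
          = fun i => if i ∈ insert j s then Q i else P i := by
        ext1 i
        by_cases hi : i = j
        · subst hi; simp
        · simp [hi]
      have hs := h (fun i => if i ∈ s then Q i else P i)
        (fun i => by by_cases hi : i ∈ s <;> simp [hi]) j
      rw [e₁, e₂] at hs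
      rw [Finset.sum_insert hj, add_comm]
      exact (abs_sub_le _ _ _).trans (add_le_add ih hs)
  simpa using key Finset.univ

/-- Functions of disjoint sets of coordinates are independent under a product measure. -/
theorem indepFun_pi_of_dependsOn [Inhabited E] (m : ι → Measure E)
    [∀ i, IsProbabilityMeasure (m i)]
    {f h : (ι → E) → ℝ} (hf : Measurable f) (hh : Measurable h) {S T : Finset ι}
    (hST : Disjoint S T) (hfS : ∀ x x', (∀ i ∈ S, x i = x' i) → f x = f x')
    (hhT : ∀ x x', (∀ i ∈ T, x i = x' i) → h x = h x') : IndepFun f h (Measure.pi m) := by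
  have hi : iIndepFun (fun (i : ι) (x : ι → E) => x i) (Measure.pi m) :=
    iIndepFun_pi (X := fun i (y : E) => y) (fun i => aemeasurable_id)
  have h2 := hi.indepFun_finset S T hST (fun i => measurable_pi_apply i)
  have ext_meas : ∀ A : Finset ι,
      Measurable (fun (u : A → E) (i : ι) => if hi : i ∈ A then u ⟨i, hi⟩ else default) := by
    intro A
    refine measurable_pi_iff.2 fun i => ?_
    by_cases hi : i ∈ A
    · simpa [hi] using measurable_pi_apply _
    · simp [hi]
  have h3 := h2.comp (hf.comp (ext_meas S)) (hh.comp (ext_meas T))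
  have e1 : (f ∘ (fun (u : S → E) (i : ι) => if hi : i ∈ S then u ⟨i, hi⟩ else default))
      ∘ (fun (x : ι → E) (i : S) => x i) = f := by
    ext x
    exact hfS _ _ fun i hi => by simp [hi]
  have e2 : (h ∘ (fun (u : T → E) (i : ι) => if hi : i ∈ T then u ⟨i, hi⟩ else default))
      ∘ (fun (x : ι → E) (i : T) => x i) = h := by
    ext x
    exact hhT _ _ fun i hi => by simp [hi]
  rwa [e1, e2] at h3

end Lindeberg

section Moments

theorem exists_add_pow_remainder (s y : ℝ) (k : ℕ) :
    ∃ R : ℝ, (s + y) ^ (k + 2) = s ^ (k + 2) + (k + 2) * s ^ (k + 1) * y + y ^ 2 * R ∧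
      |R| ≤ (2 ^ (k + 2) - k - 3) * max |s| |y| ^ k := by
  induction k with
  | zero => exact ⟨1, by push_cast; ring, by norm_num⟩
  | succ k ih =>
    obtain ⟨R, hR, hb⟩ := ih
    refine ⟨(s + y) * R + (k + 2) * s ^ (k + 1), ?_, ?_⟩
    · rw [show k + 1 + 2 = (k + 2) + 1 by ring, pow_succ, hR]
      push_cast
      ring
    · set M := max |s| |y| with hM
      have hs : |s| ≤ M := le_max_left _ _
      have hy : |y| ≤ M := le_max_right _ _
      have hM0 : 0 ≤ M := (abs_nonneg s).trans hs
      have h1 : |(s + y) * R| ≤ (2 * M) * ((2 ^ (k + 2) - k - 3) * M ^ k) := by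
        rw [abs_mul]
        refine mul_le_mul ((abs_add_le _ _).trans (by linarith)) hb (abs_nonneg _) (by linarith)
      have h2 : |((k : ℝ) + 2) * s ^ (k + 1)| ≤ (k + 2) * M ^ (k + 1) := by
        rw [abs_mul, abs_pow, abs_of_nonneg (by positivity : (0 : ℝ) ≤ (k : ℝ) + 2)]
        gcongr
      refine (abs_add_le _ _).trans ((add_le_add h1 h2).trans (le_of_eq ?_))
      push_cast
      ring

theorem add_pow_even_le (s y : ℝ) (j : ℕ) :
    (s + y) ^ (2 * (j + 1)) ≤ s ^ (2 * (j + 1)) + (2 * j + 2) * (s ^ (2 * j + 1) * y)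
      + 4 ^ (j + 1) * (s ^ (2 * j) * y ^ 2 + y ^ (2 * (j + 1))) := by
  obtain ⟨R, hR, hb⟩ := exists_add_pow_remainder s y (2 * j)
  have e : 2 * (j + 1) = 2 * j + 2 := by ring
  have hmax : max |s| |y| ^ (2 * j) ≤ s ^ (2 * j) + y ^ (2 * j) := by
    have h1 : 0 ≤ s ^ (2 * j) := (even_two_mul j).pow_nonneg s
    have h2 : 0 ≤ y ^ (2 * j) := (even_two_mul j).pow_nonneg y
    rcases le_total |s| |y| with h | h
    · rw [max_eq_right h, (even_two_mul j).pow_abs]; linarith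
    · rw [max_eq_left h, (even_two_mul j).pow_abs]; linarith
  have h4 : (4 : ℝ) ^ (j + 1) = 2 ^ (2 * j + 2) := by
    rw [← e, pow_mul]; norm_num
  have hR' : R ≤ 4 ^ (j + 1) * (s ^ (2 * j) + y ^ (2 * j)) := by
    refine (le_abs_self R).trans (hb.trans ?_)
    rw [h4]
    push_cast
    refine mul_le_mul ?_ hmax (by positivity) (by positivity)
    have : (0 : ℝ) ≤ j := Nat.cast_nonneg j
    linarith
  rw [e, hR]
  have := mul_le_mul_of_nonneg_left hR' (sq_nonneg y)
  push_cast
  have e2 : y ^ (2 * j + 2) = y ^ 2 * y ^ (2 * j) := by ring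
  rw [e2]
  nlinarith [this]

/-- The constants in the moment inequality `integral_sum_pow_even_le`. -/
noncomputable def momentConst : ℕ → ℝ
  | 0 => 1
  | j + 1 => 4 ^ (j + 1) * (momentConst j + 1)

theorem one_le_momentConst : ∀ j, 1 ≤ momentConst j
  | 0 => le_rfl
  | j + 1 => by
    have h := one_le_momentConst j
    have h4 : (1 : ℝ) ≤ 4 ^ (j + 1) := one_le_pow₀ (by norm_num)
    simp only [momentConst]
    nlinarith

variable {Ω κ : Type*} [MeasurableSpace Ω] {μ : Measure Ω} [IsProbabilityMeasure μ]

theorem MeasureTheory.MemLp.integrable_pow_of_le {f : Ω → ℝ} {J k : ℕ} (hf : MemLp f J μ)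
    (hk : k ≤ J) : Integrable (fun ω => f ω ^ k) μ := by
  have h : MemLp f k μ := hf.mono_exponent (by exact_mod_cast hk)
  have h2 : Integrable (fun ω => ‖f ω‖ ^ k) μ := h.integrable_norm_pow'
  refine h2.mono (hf.1.pow k) ?_
  filter_upwards with ω
  simp

/-- Even moments of sums of independent centred random variables. -/
theorem integral_sum_pow_even_le {ξ : κ → Ω → ℝ} (hind : iIndepFun ξ μ)
    (hm : ∀ α, Measurable (ξ α)) {J : ℕ} {s : Finset κ}
    (hL : ∀ α ∈ s, MemLp (ξ α) (2 * J : ℕ) μ) (h0 : ∀ α ∈ s, ∫ ω, ξ α ω ∂μ = 0) {V : ℝ}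
    (hV0 : 0 ≤ V)
    (hV : ∀ j, 1 ≤ j → j ≤ J → ∑ α ∈ s, ∫ ω, ξ α ω ^ (2 * j) ∂μ ≤ V ^ j) :
    ∀ j ≤ J, ∀ t ⊆ s, ∫ ω, (∑ α ∈ t, ξ α ω) ^ (2 * j) ∂μ ≤ momentConst j * V ^ j := by
  classical
  intro j
  induction j with
  | zero => intro _ t _; simp [momentConst]
  | succ j ih =>
    intro hj
    have ih' := ih (by omega)
    have hint : ∀ t ⊆ s, MemLp (fun ω => ∑ α ∈ t, ξ α ω) (2 * J : ℕ) μ := fun t ht =>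
      memLp_finsetSum t fun α hα => hL α (ht hα)
    have hb : ∀ t ⊆ s, ∫ ω, (∑ α ∈ t, ξ α ω) ^ (2 * (j + 1)) ∂μ
        ≤ ∑ α ∈ t, 4 ^ (j + 1) * (momentConst j * V ^ j * ∫ ω, ξ α ω ^ 2 ∂μ
          + ∫ ω, ξ α ω ^ (2 * (j + 1)) ∂μ) := by
      intro t
      induction t using Finset.induction_on with
      | empty => intro _; simp
      | insert a t ha iht =>
        intro hat
        have hts : t ⊆ s := (Finset.subset_insert a t).trans hat
        have has : a ∈ s := hat (Finset.mem_insert_self a t)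
        have hI : IndepFun (fun ω => ∑ α ∈ t, ξ α ω) (ξ a) μ := by
          have := hind.indepFun_finsetSum_of_notMem hm ha
          convert this using 1
          ext ω
          simp
        have iS : ∀ k ≤ 2 * J, Integrable (fun ω => (∑ α ∈ t, ξ α ω) ^ k) μ := fun k hk =>
          (hint t hts).integrable_pow_of_le hk
        have ia : ∀ k ≤ 2 * J, Integrable (fun ω => ξ a ω ^ k) μ := fun k hk =>
          (hL a has).integrable_pow_of_le hk
        have hIk : ∀ k l, IndepFun (fun ω => (∑ α ∈ t, ξ α ω) ^ k) (fun ω => ξ a ω ^ l) μ :=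
          fun k l => hI.comp (measurable_id.pow_const k) (measurable_id.pow_const l)
        have im : ∀ k l, k ≤ 2 * J → l ≤ 2 * J →
            Integrable (fun ω => (∑ α ∈ t, ξ α ω) ^ k * ξ a ω ^ l) μ := fun k l hk hl =>
          (hIk k l).integrable_mul (iS k hk) (ia l hl)
        have em : ∀ k l, k ≤ 2 * J → l ≤ 2 * J →
            ∫ ω, (∑ α ∈ t, ξ α ω) ^ k * ξ a ω ^ l ∂μ
              = (∫ ω, (∑ α ∈ t, ξ α ω) ^ k ∂μ) * ∫ ω, ξ a ω ^ l ∂μ := fun k l hk hl =>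
          (hIk k l).integral_fun_mul_eq_mul_integral (iS k hk).1 (ia l hl).1
        rw [Finset.sum_insert ha]
        have ptw : ∀ ω, (∑ α ∈ insert a t, ξ α ω) ^ (2 * (j + 1))
            ≤ (∑ α ∈ t, ξ α ω) ^ (2 * (j + 1))
              + (2 * j + 2) * ((∑ α ∈ t, ξ α ω) ^ (2 * j + 1) * ξ a ω ^ 1)
              + 4 ^ (j + 1) * ((∑ α ∈ t, ξ α ω) ^ (2 * j) * ξ a ω ^ 2
                + ξ a ω ^ (2 * (j + 1))) := fun ω => by
          rw [Finset.sum_insert ha, add_comm (ξ a ω), pow_one]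
          exact add_pow_even_le _ _ j
        have i1 := iS (2 * (j + 1)) (by omega)
        have i2 := (im (2 * j + 1) 1 (by omega) (by omega)).const_mul (2 * (j : ℝ) + 2)
        have i3 := im (2 * j) 2 (by omega) (by omega)
        have i4 := ia (2 * (j + 1)) (by omega)
        have i5 := (i3.add i4).const_mul ((4 : ℝ) ^ (j + 1))
        have hle := integral_mono ((hint _ hat).integrable_pow_of_le (k := 2 * (j + 1)) (by omega))
          ((i1.add i2).add i5) ptw
        refine hle.trans ?_
        have e := integral_add (i1.add i2) i5
        have e' := integral_add i1 i2
        simp only [Pi.add_apply] at e e' ⊢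
        rw [e, e', integral_const_mul, integral_const_mul, integral_add i3 i4,
          em _ _ (by omega) (by omega), em _ _ (by omega) (by omega)]
        have z : ∫ ω, ξ a ω ^ 1 ∂μ = 0 := by simpa using h0 a has
        rw [z, mul_zero, mul_zero, add_zero, add_comm]
        refine add_le_add ?_ (iht hts)
        have hsq : 0 ≤ ∫ ω, ξ a ω ^ 2 ∂μ := integral_nonneg fun ω => sq_nonneg _
        have := mul_le_mul_of_nonneg_right (ih' t hts) hsq
        gcongr
    intro t ht
    refine (hb t ht).trans ?_
    have hnn : ∀ k, ∀ α, 0 ≤ ∫ ω, ξ α ω ^ (2 * k) ∂μ := fun k α =>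
      integral_nonneg fun ω => (even_two_mul k).pow_nonneg _
    have s1 : ∑ α ∈ t, ∫ ω, ξ α ω ^ 2 ∂μ ≤ V := by
      have := hV 1 le_rfl (by omega)
      simp only [mul_one, pow_one] at this
      exact (Finset.sum_le_sum_of_subset_of_nonneg ht fun α _ _ => hnn 1 α).trans this
    have s2 : ∑ α ∈ t, ∫ ω, ξ α ω ^ (2 * (j + 1)) ∂μ ≤ V ^ (j + 1) :=
      (Finset.sum_le_sum_of_subset_of_nonneg ht fun α _ _ => hnn _ α).trans
        (hV (j + 1) (by omega) hj)
    rw [← Finset.mul_sum, Finset.sum_add_distrib, ← Finset.mul_sum]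
    have hC : 0 ≤ momentConst j := zero_le_one.trans (one_le_momentConst j)
    calc _ ≤ 4 ^ (j + 1) * (momentConst j * V ^ j * V + V ^ (j + 1)) := by gcongr
      _ = _ := by simp only [momentConst]; ring

end Moments

section SoftRisk

variable {W ι I : Type*} [Fintype W] [Fintype ι] [Fintype I] [DecidableEq I]

/-- The soft minimum over `w` of the risk `N⁻¹ ∑ i, f i (row i at w) + R w`, at inverse
temperature `N b`; the `i`-th row is the sum of the blocks `z α` with `row α = i`. -/
noncomputable def softRisk (N b : ℝ) (f : I → ℝ → ℝ) (row : ι → I) (R : W → ℝ)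
    (z : ι → W → ℝ) : ℝ :=
  -(1 / (N * b)) * Real.log (∑ w, Real.exp
    (-b * (∑ i, f i (∑ α with row α = i, z α w)) - N * b * R w))

theorem measurable_softRisk {N b : ℝ} {f : I → ℝ → ℝ} (hf : ∀ i, Measurable (f i)) (row : ι → I)
    (R : W → ℝ) : Measurable (softRisk N b f row R) := by
  unfold softRisk
  have hz : ∀ α w, Measurable (fun z : ι → W → ℝ => z α w) := fun α w =>
    (measurable_pi_apply w).comp (measurable_pi_apply α)
  have hs : ∀ i w, Measurable (fun z : ι → W → ℝ => ∑ α with row α = i, z α w) := fun i w =>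
    Finset.measurable_fun_sum _ fun α _ => hz α w
  refine measurable_const.mul (Real.measurable_log.comp (Finset.measurable_fun_sum _ fun w _ =>
    Real.measurable_exp.comp ?_))
  refine (measurable_const.mul (Finset.measurable_fun_sum _ fun i _ => ?_)).sub measurable_const
  exact (hf i).comp (hs i w)

theorem wavg_const_add [Nonempty W] {c : W → ℝ} (hc : ∀ w, 0 < c w) (a : W → ℝ) (k : ℝ) :
    wavg c (fun w => k + a w) = k + wavg c a := by
  unfold wavg
  have := (sum_weights_pos hc).ne'
  simp only [mul_add, Finset.sum_add_distrib, ← Finset.sum_mul]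
  field_simp

/-- Integrating a second order expansion against two laws with the same first two moments. -/
theorem abs_integral_sub_integral_le_of_expansion {P Q : Measure (W → ℝ)}
    [IsProbabilityMeasure P] [IsProbabilityMeasure Q]
    (iP : ∀ w, Integrable (fun y => y w) P) (iQ : ∀ w, Integrable (fun y => y w) Q)
    (iP2 : ∀ w w', Integrable (fun y => y w * y w') P)
    (iQ2 : ∀ w w', Integrable (fun y => y w * y w') Q)
    (h1 : ∀ w, ∫ y, y w ∂P = ∫ y, y w ∂Q)
    (h2 : ∀ w w', ∫ y, y w * y w' ∂P = ∫ y, y w * y w' ∂Q)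
    {Φ ρ : (W → ℝ) → ℝ} (iΦP : Integrable Φ P) (iΦQ : Integrable Φ Q) (iρP : Integrable ρ P)
    (iρQ : Integrable ρ Q) {Φ₀ : ℝ} {α : W → ℝ} {γ : W → W → ℝ}
    (h : ∀ y, |Φ y - (Φ₀ + ∑ w, α w * y w + ∑ w, ∑ w', γ w w' * (y w * y w'))| ≤ ρ y) :
    |∫ y, Φ y ∂P - ∫ y, Φ y ∂Q| ≤ ∫ y, ρ y ∂P + ∫ y, ρ y ∂Q := by
  set T : (W → ℝ) → ℝ := fun y => Φ₀ + ∑ w, α w * y w + ∑ w, ∑ w', γ w w' * (y w * y w') with hT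
  have hTi : ∀ (μ : Measure (W → ℝ)) [IsProbabilityMeasure μ],
      (∀ w, Integrable (fun y => y w) μ) → (∀ w w', Integrable (fun y => y w * y w') μ) →
      Integrable T μ ∧ ∫ y, T y ∂μ = Φ₀ + ∑ w, α w * ∫ y, y w ∂μ
        + ∑ w, ∑ w', γ w w' * ∫ y, y w * y w' ∂μ := by
    intro μ _ i1 i2
    have a1 : ∀ w, Integrable (fun y : W → ℝ => α w * y w) μ := fun w => (i1 w).const_mul _
    have a2 : ∀ w w', Integrable (fun y : W → ℝ => γ w w' * (y w * y w')) μ := fun w w' =>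
      (i2 w w').const_mul _
    have b1 : Integrable (fun y : W → ℝ => ∑ w, α w * y w) μ :=
      integrable_finsetSum _ fun w _ => a1 w
    have b2' : ∀ w, Integrable (fun y : W → ℝ => ∑ w', γ w w' * (y w * y w')) μ := fun w =>
      integrable_finsetSum _ fun w' _ => a2 w w'
    have b2 : Integrable (fun y : W → ℝ => ∑ w, ∑ w', γ w w' * (y w * y w')) μ :=
      integrable_finsetSum _ fun w _ => b2' w
    have c0 : Integrable (fun _ : W → ℝ => Φ₀) μ := integrable_const _
    refine ⟨(c0.add b1).add b2, ?_⟩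
    have e1 := integral_add (c0.add b1) b2
    have e2 := integral_add c0 b1
    simp only [Pi.add_apply] at e1 e2
    rw [hT, e1, e2, integral_const, integral_finsetSum _ fun w _ => a1 w,
      integral_finsetSum _ fun w _ => b2' w]
    simp only [integral_finsetSum _ fun w' _ => a2 _ w', integral_const_mul]
    simp
  obtain ⟨tP, eP⟩ := hTi P iP iP2
  obtain ⟨tQ, eQ⟩ := hTi Q iQ iQ2
  have eT : ∫ y, T y ∂P = ∫ y, T y ∂Q := by
    rw [eP, eQ]; simp only [h1, h2]
  have bP : |∫ y, Φ y ∂P - ∫ y, T y ∂P| ≤ ∫ y, ρ y ∂P := by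
    rw [← integral_sub iΦP tP]
    exact (abs_integral_le_integral_abs).trans (integral_mono (iΦP.sub tP).abs iρP h)
  have bQ : |∫ y, Φ y ∂Q - ∫ y, T y ∂Q| ≤ ∫ y, ρ y ∂Q := by
    rw [← integral_sub iΦQ tQ]
    exact (abs_integral_le_integral_abs).trans (integral_mono (iΦQ.sub tQ).abs iρQ h)
  rw [← eT] at bQ
  rw [abs_le] at *
  constructor <;> linarith [bP.1, bP.2, bQ.1, bQ.2]

theorem integrable_coord_of_pow_norm {P : Measure (W → ℝ)} [IsProbabilityMeasure P] {k : ℕ}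
    (hk : 2 ≤ k) (hP : Integrable (fun y : W → ℝ => ‖y‖ ^ k) P) :
    (∀ w, Integrable (fun y => y w) P) ∧ (∀ w w', Integrable (fun y => y w * y w') P) ∧
      ∀ l ≤ k, Integrable (fun y : W → ℝ => ‖y‖ ^ l) P := by
  have hl : ∀ l ≤ k, Integrable (fun y : W → ℝ => ‖y‖ ^ l) P := fun l hl =>
    integrable_norm_pow_of_le (f := fun y : W → ℝ => y) (by fun_prop) hl hP
  refine ⟨fun w => ?_, fun w w' => ?_, hl⟩
  · refine (hl 1 (by omega)).mono' (measurable_pi_apply w).aestronglyMeasurable (Filter.Eventually.of_forall fun y => ?_)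
    simpa using norm_le_pi_norm y w
  · refine (hl 2 hk).mono' (by fun_prop) (Filter.Eventually.of_forall fun y => ?_)
    rw [norm_mul, pow_two]
    exact mul_le_mul (norm_le_pi_norm y w) (norm_le_pi_norm y w') (norm_nonneg _) (norm_nonneg _)

/-- A loss `f` with three derivatives that are bounded in terms of `f` itself. -/
structure SelfBounded (f : ℝ → ℝ) (D : ℝ) (G₁ G₂ G₃ : ℝ → ℝ) : Prop where
  nonneg : ∀ x, 0 ≤ f x
  exists_derivs : ∃ f₁ f₂ f₃ : ℝ → ℝ, (∀ x, HasDerivAt f (f₁ x) x) ∧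
    (∀ x, HasDerivAt f₁ (f₂ x) x) ∧ (∀ x, HasDerivAt f₂ (f₃ x) x) ∧
    (∀ x, |f₁ x| ≤ D * G₁ (f x)) ∧ (∀ x, |f₂ x| ≤ D * G₂ (f x)) ∧ (∀ x, |f₃ x| ≤ D * G₃ (f x))

/-- A test function whose values and first three derivatives are bounded by `K`. -/
structure BoundedDerivs (g : ℝ → ℝ) (K : ℝ) : Prop where
  bound : ∀ x, |g x| ≤ K
  exists_derivs : ∃ g₁ g₂ g₃ : ℝ → ℝ, (∀ x, HasDerivAt g (g₁ x) x) ∧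
    (∀ x, HasDerivAt g₁ (g₂ x) x) ∧ (∀ x, HasDerivAt g₂ (g₃ x) x) ∧
    (∀ x, |g₁ x| ≤ K) ∧ (∀ x, |g₂ x| ≤ K) ∧ (∀ x, |g₃ x| ≤ K)

/-- Monotone weight functions `G₁, G₂, G₃` whose relevant products are dominated by `Ψ`. -/
structure DominatedWeights (G₁ G₂ G₃ Ψ : ℝ → ℝ) : Prop where
  mono₁ : MonotoneOn G₁ (Ici 0)
  mono₂ : MonotoneOn G₂ (Ici 0)
  mono : MonotoneOn Ψ (Ici 0)
  nonneg₁ : ∀ u, 0 ≤ u → 0 ≤ G₁ u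
  nonneg₂ : ∀ u, 0 ≤ u → 0 ≤ G₂ u
  cube_le : ∀ u, 0 ≤ u → G₁ u ^ 3 ≤ Ψ u
  mul_le : ∀ u, 0 ≤ u → G₁ u * G₂ u ≤ Ψ u
  le : ∀ u, 0 ≤ u → G₃ u ≤ Ψ u

theorem BoundedDerivs.continuous {g : ℝ → ℝ} {K : ℝ} (hg : BoundedDerivs g K) : Continuous g := by
  obtain ⟨g₁, _, _, d, _⟩ := hg.exists_derivs
  exact continuous_iff_continuousAt.2 fun x => (d x).continuousAt

theorem SelfBounded.continuous {f : ℝ → ℝ} {D : ℝ} {G₁ G₂ G₃ : ℝ → ℝ}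
    (hf : SelfBounded f D G₁ G₂ G₃) : Continuous f := by
  obtain ⟨f₁, _, _, d, _⟩ := hf.exists_derivs
  exact continuous_iff_continuousAt.2 fun x => (d x).continuousAt

variable [DecidableEq ι]

theorem softRisk_update (N b : ℝ) (f : I → ℝ → ℝ) (row : ι → I) (R : W → ℝ) (j : ι)
    (z : ι → W → ℝ) (y : W → ℝ) :
    softRisk N b f row R (Function.update z j y)
      = -(1 / (N * b)) * Real.log (∑ w,
        Real.exp (-b * (∑ i ∈ Finset.univ.erase (row j), f i (∑ α with row α = i, z α w))
          - N * b * R w)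
        * Real.exp (-b * f (row j)
          ((∑ α ∈ (Finset.univ.filter (fun α => row α = row j)).erase j, z α w) + y w))) := by
  unfold softRisk
  congr 2
  refine Finset.sum_congr rfl fun w _ => ?_
  rw [← Real.exp_add, ← Finset.add_sum_erase _ _ (Finset.mem_univ (row j))]
  have e1 : ∑ α with row α = row j, Function.update z j y α w
      = (∑ α ∈ (Finset.univ.filter (fun α => row α = row j)).erase j, z α w) + y w := by
    rw [← Finset.add_sum_erase _ _ (by simp : j ∈ Finset.univ.filter (fun α => row α = row j)),
      add_comm, Function.update_self]
    congr 1
    exact Finset.sum_congr rfl fun α hα => by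
      rw [Function.update_of_ne (Finset.ne_of_mem_erase hα)]
  have e2 : ∑ i ∈ Finset.univ.erase (row j), f i (∑ α with row α = i, Function.update z j y α w)
      = ∑ i ∈ Finset.univ.erase (row j), f i (∑ α with row α = i, z α w) := by
    refine Finset.sum_congr rfl fun i hi => ?_
    congr 1
    refine Finset.sum_congr rfl fun α hα => ?_
    have : α ≠ j := fun h => Finset.ne_of_mem_erase hi (by rw [← (Finset.mem_filter.1 hα).2, h])
    rw [Function.update_of_ne this]
  rw [e1, e2]
  congr 1
  ring

theorem integral_pi_update {E : Type*} [MeasurableSpace E] (m : ι → Measure E)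
    [∀ i, IsProbabilityMeasure (m i)] (Q : Measure E) [IsProbabilityMeasure Q] (j : ι)
    {F : (ι → E) → ℝ} (hF : Measurable F) {K : ℝ} (hK : ∀ x, |F x| ≤ K) :
    Integrable (fun x => ∫ y, F (Function.update x j y) ∂Q) (Measure.pi m) ∧
    ∫ x, F x ∂(Measure.pi (Function.update m j Q))
      = ∫ x, ∫ y, F (Function.update x j y) ∂Q ∂(Measure.pi m) := by
  have hmeas : Measurable (fun z : (ι → E) × E => Function.update z.1 j z.2) := by
    refine measurable_pi_iff.2 fun i => ?_
    by_cases h : i = j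
    · subst h; simpa using measurable_snd
    · simpa [h, Function.comp_def] using
        (measurable_pi_apply (X := fun _ : ι => E) i).comp measurable_fst
  have hi : Integrable (fun z : (ι → E) × E => F (Function.update z.1 j z.2))
      ((Measure.pi m).prod Q) :=
    Integrable.of_bound (hF.comp hmeas).aestronglyMeasurable K
      (Filter.Eventually.of_forall fun z => hK _)
  refine ⟨hi.integral_prod_left, ?_⟩
  rw [← map_update_prod_pi m Q j, integral_map hmeas.aemeasurable hF.aestronglyMeasurable,
    integral_prod _ hi]

variable [Nonempty W]

/-- Replacing the law of one block in the expectation of a smooth function of the soft risk. -/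
theorem abs_integral_softRisk_swap_le {N b K D : ℝ} (hN : 1 ≤ N) (hb : 1 ≤ b) (hD : 1 ≤ D)
    {g : ℝ → ℝ} (hg : BoundedDerivs g K) {G₁ G₂ G₃ Ψ : ℝ → ℝ}
    (hG : DominatedWeights G₁ G₂ G₃ Ψ) {f : I → ℝ → ℝ} (hf : ∀ i, SelfBounded (f i) D G₁ G₂ G₃)
    (row : ι → I) (R : W → ℝ) (m : ι → Measure (W → ℝ)) [∀ i, IsProbabilityMeasure (m i)] (j : ι)
    {P Q : Measure (W → ℝ)} [IsProbabilityMeasure P] [IsProbabilityMeasure Q] {k : ℕ}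
    (iP : Integrable (fun y : W → ℝ => ‖y‖ ^ (k + 3)) P)
    (iQ : Integrable (fun y : W → ℝ => ‖y‖ ^ (k + 3)) Q)
    (h1 : ∀ w, ∫ y, y w ∂P = ∫ y, y w ∂Q)
    (h2 : ∀ w w', ∫ y, y w * y w' ∂P = ∫ y, y w * y w' ∂Q) {Λ ϱ : ℝ} (hΛ0 : 0 ≤ Λ)
    (hΛ : ∀ r y t : ℝ, t ∈ Icc (0 : ℝ) 1 → Ψ (f (row j) (r + t * y)) ≤ Λ * (1 + |r| ^ k + |y| ^ k))
    (iϱ : ∀ w, Integrable (fun x : ι → W → ℝ =>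
      |∑ α ∈ (Finset.univ.filter (fun α => row α = row j)).erase j, x α w| ^ k) (Measure.pi m))
    (hϱ : ∀ w, ∫ x, |∑ α ∈ (Finset.univ.filter (fun α => row α = row j)).erase j, x α w| ^ k
      ∂(Measure.pi m) ≤ ϱ) :
    |∫ x, g (softRisk N b f row R x) ∂(Measure.pi (Function.update m j P))
      - ∫ x, g (softRisk N b f row R x) ∂(Measure.pi (Function.update m j Q))|
    ≤ 23 * K * b ^ 2 * D ^ 3 / N * Λ * ((1 + ϱ) * (∫ y, ‖y‖ ^ 3 ∂P + ∫ y, ‖y‖ ^ 3 ∂Q)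
      + (∫ y, ‖y‖ ^ (k + 3) ∂P + ∫ y, ‖y‖ ^ (k + 3) ∂Q)) := by
  have hK : 0 ≤ K := (abs_nonneg _).trans (hg.bound 0)
  have hN0 : 0 < N := by linarith
  have hgm : Measurable g := hg.continuous.measurable
  have hFm : Measurable (fun x => g (softRisk N b f row R x)) :=
    hgm.comp (measurable_softRisk (fun i => (hf i).continuous.measurable) row R)
  obtain ⟨i1, e1⟩ := integral_pi_update m P j hFm (fun x => hg.bound _)
  obtain ⟨i2, e2⟩ := integral_pi_update m Q j hFm (fun x => hg.bound _)
  rw [e1, e2, ← integral_sub i1 i2]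
  set S := (Finset.univ.filter (fun α => row α = row j)).erase j with hS
  set c : (ι → W → ℝ) → W → ℝ := fun x w =>
    Real.exp (-b * (∑ i ∈ Finset.univ.erase (row j), f i (∑ α with row α = i, x α w))
      - N * b * R w) with hc
  set r : (ι → W → ℝ) → W → ℝ := fun x w => ∑ α ∈ S, x α w with hr
  have cpos : ∀ x w, 0 < c x w := fun x w => Real.exp_pos _
  obtain ⟨aP, aP2, aPl⟩ := integrable_coord_of_pow_norm (by omega) iP
  obtain ⟨aQ, aQ2, aQl⟩ := integrable_coord_of_pow_norm (by omega) iQ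
  set A : ℝ := ∫ y, ‖y‖ ^ 3 ∂P + ∫ y, ‖y‖ ^ 3 ∂Q with hA
  set B : ℝ := ∫ y, ‖y‖ ^ (k + 3) ∂P + ∫ y, ‖y‖ ^ (k + 3) ∂Q with hB
  have hA0 : 0 ≤ A := add_nonneg (integral_nonneg fun y => by positivity)
    (integral_nonneg fun y => by positivity)
  set C : ℝ := 23 * K * b ^ 2 * D ^ 3 / N * Λ with hC
  have hC0 : 0 ≤ C := by positivity
  have ptw : ∀ x, |∫ y, g (softRisk N b f row R (Function.update x j y)) ∂P
      - ∫ y, g (softRisk N b f row R (Function.update x j y)) ∂Q|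
      ≤ C * ((1 + wavg (c x) (fun w => |r x w| ^ k)) * A + B) := by
    intro x
    obtain ⟨g₁, g₂, g₃, dg, dg₁, dg₂, bg₁, bg₂, bg₃⟩ := hg.exists_derivs
    obtain ⟨f₁, f₂, f₃, df, df₁, df₂, bf₁, bf₂, bf₃⟩ := (hf (row j)).exists_derivs
    obtain ⟨Φ₀, α, γ, h⟩ := exists_softmin_expansion hN hb hD dg dg₁ dg₂ bg₁ bg₂ bg₃
      (hf (row j)).nonneg df df₁ df₂ hG.mono₁ hG.mono₂ hG.mono hG.nonneg₁ hG.nonneg₂ hG.cube_le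
      hG.mul_le hG.le bf₁ bf₂ bf₃ (cpos x) (r x)
    set v := wavg (c x) (fun w => |r x w| ^ k) with hv
    have hup : Measurable (fun y : W → ℝ => Function.update x j y) := measurable_update x
    have iΦ : ∀ (μ : Measure (W → ℝ)) [IsProbabilityMeasure μ],
        Integrable (fun y => g (softRisk N b f row R (Function.update x j y))) μ := fun μ _ =>
      Integrable.of_bound (hFm.comp hup).aestronglyMeasurable K
        (Filter.Eventually.of_forall fun z => hg.bound _)
    have hρ : ∀ (μ : Measure (W → ℝ)) [IsProbabilityMeasure μ],
        (∀ l ≤ k + 3, Integrable (fun y : W → ℝ => ‖y‖ ^ l) μ) →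
        Integrable (fun y : W → ℝ => C * ((1 + v) * ‖y‖ ^ 3 + ‖y‖ ^ (k + 3))) μ ∧
        ∫ y, C * ((1 + v) * ‖y‖ ^ 3 + ‖y‖ ^ (k + 3)) ∂μ
          = C * ((1 + v) * ∫ y, ‖y‖ ^ 3 ∂μ + ∫ y, ‖y‖ ^ (k + 3) ∂μ) := fun μ _ hl => by
      have j1 := (hl 3 (by omega)).const_mul (1 + v)
      have j2 := hl (k + 3) le_rfl
      exact ⟨(j1.add j2).const_mul C, by
        rw [integral_const_mul, integral_add j1 j2, integral_const_mul]⟩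
    obtain ⟨p1, p2⟩ := hρ P aPl
    obtain ⟨q1, q2⟩ := hρ Q aQl
    refine (abs_integral_sub_integral_le_of_expansion aP aQ aP2 aQ2 h1 h2 (iΦ P) (iΦ Q) p1 q1
      (Φ₀ := Φ₀) (α := α) (γ := γ) fun y => ?_).trans_eq ?_
    · have hy := h y ‖y‖ (Λ * ((1 + ‖y‖ ^ k) + v)) (fun w => norm_le_pi_norm y w) ?_
      · rw [softRisk_update]
        refine hy.trans_eq ?_
        rw [hC]
        ring
      · intro t ht
        rw [hv, ← wavg_const_add (cpos x), ← wavg_const_mul]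
        refine wavg_mono (cpos x) fun w => (hΛ _ _ t ht).trans ?_
        have : |y w| ^ k ≤ ‖y‖ ^ k := pow_le_pow_left₀ (abs_nonneg _) (norm_le_pi_norm y w) k
        exact mul_le_mul_of_nonneg_left (by linarith) hΛ0
    · rw [p2, q2, hA, hB]
      ring
  have rmeas : ∀ w, Measurable (fun x => r x w) := fun w =>
    Finset.measurable_fun_sum _ fun α _ => (measurable_pi_apply w).comp (measurable_pi_apply α)
  have cmeas : ∀ w, Measurable (fun x => c x w) := fun w => by
    refine Real.measurable_exp.comp ((measurable_const.mul
      (Finset.measurable_fun_sum _ fun i _ => (hf i).continuous.measurable.comp ?_)).sub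
        measurable_const)
    exact Finset.measurable_fun_sum _ fun α _ =>
      (measurable_pi_apply w).comp (measurable_pi_apply α)
  set π : W → (ι → W → ℝ) → ℝ := fun w x => c x w / ∑ w', c x w' with hπ
  have πmeas : ∀ w, Measurable (π w) := fun w =>
    (cmeas w).div (Finset.measurable_fun_sum _ fun w' _ => cmeas w')
  have π0 : ∀ w x, 0 ≤ π w x := fun w x => div_nonneg (cpos x w).le
    (Finset.sum_nonneg fun w' _ => (cpos x w').le)
  have πsum : ∀ x, ∑ w, π w x = 1 := fun x => by
    simp only [hπ, ← Finset.sum_div]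
    exact div_self (sum_weights_pos (cpos x)).ne'
  have π1 : ∀ w x, π w x ≤ 1 := fun w x => by
    rw [← πsum x]
    exact Finset.single_le_sum (f := fun w => π w x) (fun w' _ => π0 w' x) (Finset.mem_univ w)
  have πi : ∀ w, Integrable (π w) (Measure.pi m) := fun w =>
    Integrable.of_bound (πmeas w).aestronglyMeasurable 1
      (Filter.Eventually.of_forall fun x => by
        rw [Real.norm_eq_abs, abs_of_nonneg (π0 w x)]; exact π1 w x)
  have rkmeas : ∀ w, Measurable (fun x => |r x w| ^ k) := fun w =>
    ((_root_.continuous_abs.measurable).comp (rmeas w)).pow_const k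
  have hind : ∀ w, IndepFun (π w) (fun x => |r x w| ^ k) (Measure.pi m) := fun w => by
    refine indepFun_pi_of_dependsOn m (πmeas w) (rkmeas w)
      (S := Finset.univ.filter (fun α => row α ≠ row j)) (T := S) ?_ ?_ ?_
    · rw [Finset.disjoint_left]
      intro α h1 h2
      exact (Finset.mem_filter.1 h1).2 (Finset.mem_filter.1 (Finset.mem_of_mem_erase h2)).2
    · intro x x' hx
      have : c x = c x' := by
        ext w'
        simp only [hc]
        congr 3
        refine Finset.sum_congr rfl fun i hi => ?_
        congr 1
        refine Finset.sum_congr rfl fun α hα => ?_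
        rw [hx α]
        simp only [Finset.mem_filter, Finset.mem_univ, true_and] at hα ⊢
        rw [hα]
        exact Finset.ne_of_mem_erase hi
      simp only [hπ, this]
    · intro x x' hx
      have : r x w = r x' w := Finset.sum_congr rfl fun α hα => by rw [hx α hα]
      simp only [this]
  have ewavg : ∀ x, wavg (c x) (fun w => |r x w| ^ k) = ∑ w, π w x * |r x w| ^ k := fun x => by
    simp only [wavg, hπ, Finset.sum_div]
    exact Finset.sum_congr rfl fun w _ => by ring
  have iprod : ∀ w, Integrable (fun x => π w x * |r x w| ^ k) (Measure.pi m) := fun w =>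
    (hind w).integrable_mul (πi w) (iϱ w)
  have iw : Integrable (fun x => wavg (c x) (fun w => |r x w| ^ k)) (Measure.pi m) := by
    simp only [ewavg]
    exact integrable_finsetSum _ fun w _ => iprod w
  have hw : ∫ x, wavg (c x) (fun w => |r x w| ^ k) ∂(Measure.pi m) ≤ ϱ := by
    simp only [ewavg]
    rw [integral_finsetSum _ fun w _ => iprod w]
    calc ∑ w, ∫ x, π w x * |r x w| ^ k ∂(Measure.pi m)
        = ∑ w, (∫ x, π w x ∂(Measure.pi m)) * ∫ x, |r x w| ^ k ∂(Measure.pi m) :=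
          Finset.sum_congr rfl fun w _ => (hind w).integral_fun_mul_eq_mul_integral
            (πmeas w).aestronglyMeasurable (rkmeas w).aestronglyMeasurable
      _ ≤ ∑ w, (∫ x, π w x ∂(Measure.pi m)) * ϱ := Finset.sum_le_sum fun w _ =>
          mul_le_mul_of_nonneg_left (hϱ w) (integral_nonneg (π0 w))
      _ = ϱ := by
          rw [← Finset.sum_mul, ← integral_finsetSum _ fun w _ => πi w]
          simp [πsum]
  have iX : Integrable (fun x => C * ((A + B) + A * wavg (c x) (fun w => |r x w| ^ k)))
      (Measure.pi m) := ((integrable_const (A + B)).add (iw.const_mul A)).const_mul C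
  refine (abs_integral_le_integral_abs).trans ((integral_mono (i1.sub i2).abs iX
    (fun x => (ptw x).trans_eq ?_)).trans ?_)
  · ring
  · rw [integral_const_mul, integral_add (integrable_const _) (iw.const_mul A), integral_const_mul]
    simp only [integral_const, probReal_univ, smul_eq_mul, one_mul]
    refine mul_le_mul_of_nonneg_left ?_ hC0
    nlinarith [mul_le_mul_of_nonneg_left hw hA0]

end SoftRisk

section SoftRiskUniversality

variable {W ι I : Type*} [Fintype W] [Fintype ι] [Fintype I] [DecidableEq I]

/-- A centred law on `W → ℝ` of scale `s`, with coordinate variances at most `v`. -/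
structure BlockLaw (μ : Measure (W → ℝ)) (k : ℕ) (s v : ℝ) : Prop where
  memLp : MemLp (fun y : W → ℝ => y) (k + 3 : ℕ) μ
  mean : ∀ w, ∫ y, y w ∂μ = 0
  moment : ∀ l ≤ k + 3, ∫ y, ‖y‖ ^ l ∂μ ≤ s ^ l
  var : ∀ w, ∫ y, y w ^ 2 ∂μ ≤ v

theorem BlockLaw.integrable {μ : Measure (W → ℝ)} [IsProbabilityMeasure μ] {k : ℕ} {s v : ℝ}
    (h : BlockLaw μ k s v) : Integrable (fun y : W → ℝ => ‖y‖ ^ (k + 3)) μ :=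
  h.memLp.integrable_norm_pow'

theorem BlockLaw.integral_coord_pow_le {μ : Measure (W → ℝ)} [IsProbabilityMeasure μ] {k : ℕ}
    {s v : ℝ} (h : BlockLaw μ k s v) (w : W) {j : ℕ} (hj : 2 * j ≤ k + 3) :
    ∫ y, y w ^ (2 * j) ∂μ ≤ s ^ (2 * j) := by
  refine le_trans ?_ (h.moment (2 * j) hj)
  have hi : Integrable (fun y : W → ℝ => ‖y‖ ^ (2 * j)) μ :=
    integrable_norm_pow_of_le (f := fun y : W → ℝ => y) (by fun_prop) hj h.integrable
  refine integral_mono_of_nonneg (Filter.Eventually.of_forall fun y =>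
    (even_two_mul j).pow_nonneg _) hi (Filter.Eventually.of_forall fun y => ?_)
  simp only
  rw [← (even_two_mul j).pow_abs]
  exact pow_le_pow_left₀ (abs_nonneg _) (norm_le_pi_norm y w) _

theorem integral_row_pow_le (m : ι → Measure (W → ℝ)) [∀ i, IsProbabilityMeasure (m i)] {J : ℕ}
    {s v : ι → ℝ} (h : ∀ α, BlockLaw (m α) (2 * J) (s α) (v α)) {V : ℝ} (hV0 : 0 ≤ V)
    (T : Finset ι) (hv : ∑ α ∈ T, v α ≤ V)
    (hs : ∀ j, 2 ≤ j → j ≤ J → ∑ α ∈ T, s α ^ (2 * j) ≤ V ^ j) (w : W) {T' : Finset ι}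
    (hT' : T' ⊆ T) :
    Integrable (fun x : ι → W → ℝ => |∑ α ∈ T', x α w| ^ (2 * J)) (Measure.pi m) ∧
    ∫ x, |∑ α ∈ T', x α w| ^ (2 * J) ∂(Measure.pi m) ≤ momentConst J * V ^ J := by
  have hind : iIndepFun (fun α (x : ι → W → ℝ) => x α w) (Measure.pi m) :=
    iIndepFun_pi (X := fun _ (y : W → ℝ) => y w) (fun _ => (measurable_pi_apply w).aemeasurable)
  have hmp : ∀ α, MeasurePreserving (fun x : ι → W → ℝ => x α) (Measure.pi m) (m α) := fun α =>
    measurePreserving_eval m α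
  have hcoord : ∀ α, MemLp (fun y : W → ℝ => y w) (2 * J : ℕ) (m α) := fun α => by
    have h1 : MemLp (fun y : W → ℝ => y w) (2 * J + 3 : ℕ) (m α) :=
      (h α).memLp.mono (measurable_pi_apply w).aestronglyMeasurable
        (Filter.Eventually.of_forall fun y => norm_le_pi_norm y w)
    exact h1.mono_exponent (by exact_mod_cast (by omega : 2 * J ≤ 2 * J + 3))
  have hL : ∀ α, MemLp (fun x : ι → W → ℝ => x α w) (2 * J : ℕ) (Measure.pi m) := fun α =>
    (hcoord α).comp_measurePreserving (hmp α)
  have hint : ∀ α (φ : (W → ℝ) → ℝ), Measurable φ →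
      ∫ x, φ (x α) ∂(Measure.pi m) = ∫ y, φ y ∂(m α) := fun α φ hφ => by
    rw [← (hmp α).map_eq, integral_map (hmp α).measurable.aemeasurable hφ.aestronglyMeasurable]
  have key := integral_sum_pow_even_le hind
    (fun α => (measurable_pi_apply w).comp (measurable_pi_apply α)) (J := J) (s := T)
    (fun α _ => hL α)
    (fun α _ => (hint α (fun y => y w) (measurable_pi_apply w)).trans ((h α).mean w)) hV0
    (fun j hj1 hj => by
      have e : ∀ α, ∫ x, (x α w) ^ (2 * j) ∂(Measure.pi m) = ∫ y, y w ^ (2 * j) ∂(m α) := fun α =>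
        hint α (fun y => y w ^ (2 * j)) ((measurable_pi_apply w).pow_const _)
      simp only [e]
      rcases Nat.lt_or_ge 1 j with h2 | h2
      · exact (Finset.sum_le_sum fun α _ => (h α).integral_coord_pow_le w (by omega)).trans
          (hs j h2 hj)
      · obtain rfl : j = 1 := le_antisymm h2 hj1
        simp only [mul_one, pow_one]
        exact (Finset.sum_le_sum fun α _ => (h α).var w).trans hv)
    J le_rfl T' hT'
  simp only [(even_two_mul J).pow_abs]
  exact ⟨(memLp_finsetSum T' fun α _ => hL α).integrable_pow_of_le le_rfl, key⟩

/-- **Universality of the soft risk**: replacing all the blocks. -/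
theorem abs_integral_softRisk_pi_sub_le [Nonempty W] {N b K D : ℝ} (hN : 1 ≤ N)
    (hb : 1 ≤ b) (hD : 1 ≤ D) {g : ℝ → ℝ} (hg : BoundedDerivs g K) {G₁ G₂ G₃ Ψ : ℝ → ℝ}
    (hG : DominatedWeights G₁ G₂ G₃ Ψ) {f : I → ℝ → ℝ} (hf : ∀ i, SelfBounded (f i) D G₁ G₂ G₃)
    (row : ι → I) (R : W → ℝ) (P Q : ι → Measure (W → ℝ)) [∀ i, IsProbabilityMeasure (P i)]
    [∀ i, IsProbabilityMeasure (Q i)] {J : ℕ} {s v : ι → ℝ}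
    (hP : ∀ α, BlockLaw (P α) (2 * J) (s α) (v α)) (hQ : ∀ α, BlockLaw (Q α) (2 * J) (s α) (v α))
    (h2 : ∀ α w w', ∫ y, y w * y w' ∂(P α) = ∫ y, y w * y w' ∂(Q α)) {Λ : I → ℝ}
    (hΛ0 : ∀ i, 0 ≤ Λ i)
    (hΛ : ∀ i, ∀ r y t : ℝ, t ∈ Icc (0 : ℝ) 1 →
      Ψ (f i (r + t * y)) ≤ Λ i * (1 + |r| ^ (2 * J) + |y| ^ (2 * J)))
    {V : ℝ} (hV0 : 0 ≤ V) (hv : ∀ i, ∑ α with row α = i, v α ≤ V)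
    (hs : ∀ i j, 2 ≤ j → j ≤ J → ∑ α with row α = i, s α ^ (2 * j) ≤ V ^ j) :
    |∫ x, g (softRisk N b f row R x) ∂(Measure.pi P)
      - ∫ x, g (softRisk N b f row R x) ∂(Measure.pi Q)|
    ≤ ∑ α, 23 * K * b ^ 2 * D ^ 3 / N * Λ (row α) *
      ((1 + momentConst J * V ^ J) * (2 * s α ^ 3) + 2 * s α ^ (2 * J + 3)) := by
  classical
  have hK : 0 ≤ K := (abs_nonneg _).trans (hg.bound 0)
  have hC : 0 ≤ momentConst J := zero_le_one.trans (one_le_momentConst J)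
  refine abs_integral_pi_sub_le_sum P Q _ _ fun m hm j => ?_
  have hprob : ∀ i, IsProbabilityMeasure (m i) := fun i => by
    rcases hm i with h | h <;> rw [h] <;> infer_instance
  have hB : ∀ α, BlockLaw (m α) (2 * J) (s α) (v α) := fun α => by
    rcases hm α with h | h <;> rw [h]
    exacts [hP α, hQ α]
  have hr := fun w => integral_row_pow_le m hB hV0 (Finset.univ.filter (fun α => row α = row j))
    (hv (row j)) (hs (row j)) w (Finset.erase_subset j _)
  refine (abs_integral_softRisk_swap_le hN hb hD hg hG hf row R m j (hP j).integrable
    (hQ j).integrable (fun w => ((hP j).mean w).trans ((hQ j).mean w).symm) (h2 j) (hΛ0 (row j))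
    (hΛ (row j)) (fun w => (hr w).1) (fun w => (hr w).2)).trans ?_
  have a1 := (hP j).moment 3 (by omega)
  have a2 := (hQ j).moment 3 (by omega)
  have a3 := (hP j).moment (2 * J + 3) le_rfl
  have a4 := (hQ j).moment (2 * J + 3) le_rfl
  have hΛj := hΛ0 (row j)
  refine mul_le_mul_of_nonneg_left ?_ (by positivity)
  refine add_le_add (mul_le_mul_of_nonneg_left ?_ (by positivity)) ?_ <;> linarith

end SoftRiskUniversality

section Losses

theorem rpow_le_one_add_rpow {u a b : ℝ} (hu : 0 ≤ u) (ha : 0 ≤ a) (hab : a ≤ b) :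
    u ^ a ≤ 1 + u ^ b := by
  rcases le_total u 1 with h | h
  · linarith [Real.rpow_le_one hu h ha, Real.rpow_nonneg hu b]
  · linarith [Real.rpow_le_rpow_of_exponent_le h hab]

theorem bq_nonneg {q : Fin 4 → ℝ} (hq : ∀ k, 0 ≤ q k) : 0 ≤ bq q :=
  le_max_of_le_left (by linarith [hq 1])

theorem le_bq_one {q : Fin 4 → ℝ} (hq : ∀ k, 0 ≤ q k) : q 1 ≤ bq q :=
  le_max_of_le_left (by linarith [hq 1])

theorem mul_bq_le_bq0 (q : Fin 4 → ℝ) : q 0 * bq q ≤ bq0 q := by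
  have := Nat.le_ceil (q 0 * bq q / 2)
  unfold bq0
  push_cast
  linarith

theorem dominatedWeights_rpow {q : Fin 4 → ℝ} (hq : ∀ k, 0 ≤ q k) :
    DominatedWeights (fun u => 1 + u ^ q 1) (fun u => 1 + u ^ q 2) (fun u => 1 + u ^ q 3)
      (fun u => 8 * (1 + u ^ bq q)) := by
  have mono : ∀ a : ℝ, 0 ≤ a → MonotoneOn (fun u : ℝ => 1 + u ^ a) (Ici 0) := fun a ha u hu v _ h =>
    add_le_add_right (Real.rpow_le_rpow hu h ha) 1
  have h3 : 3 * q 1 ≤ bq q := le_max_left _ _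
  have h12 : q 1 + q 2 ≤ bq q := (le_max_left _ _).trans (le_max_right _ _)
  have hq3 : q 3 ≤ bq q := (le_max_right _ _).trans (le_max_right _ _)
  refine ⟨mono _ (hq 1), mono _ (hq 2), fun u hu v hv h => ?_, fun u hu => ?_, fun u hu => ?_,
    fun u hu => ?_, fun u hu => ?_, fun u hu => ?_⟩
  · exact mul_le_mul_of_nonneg_left (mono _ (bq_nonneg hq) hu hv h) (by norm_num)
  · have := Real.rpow_nonneg hu (q 1); linarith
  · have := Real.rpow_nonneg hu (q 2); linarith
  · have hx := Real.rpow_nonneg hu (q 1)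
    have e : (u ^ q 1) ^ 3 = u ^ (3 * q 1) := by
      rw [mul_comm, Real.rpow_mul hu]; norm_cast
    have := rpow_le_one_add_rpow hu (by linarith [hq 1]) h3
    have h0 := Real.rpow_nonneg hu (bq q)
    rw [← e] at this
    nlinarith [mul_nonneg (sq_nonneg (u ^ q 1 - 1)) (by linarith : 0 ≤ u ^ q 1 + 1)]
  · have e : u ^ q 1 * u ^ q 2 = u ^ (q 1 + q 2) := by
      rw [Real.rpow_add_of_nonneg hu (hq 1) (hq 2)]
    have a1 := rpow_le_one_add_rpow hu (hq 1) (le_bq_one hq)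
    have a2 := rpow_le_one_add_rpow hu (hq 2) (by linarith [hq 1] : q 2 ≤ bq q)
    have a3 := rpow_le_one_add_rpow hu (by linarith [hq 1, hq 2]) h12
    have h0 := Real.rpow_nonneg hu (bq q)
    rw [← e] at a3
    nlinarith
  · have := rpow_le_one_add_rpow hu (hq 3) hq3
    have h0 := Real.rpow_nonneg hu (bq q)
    linarith

theorem selfBounded_of_contDiff {f : ℝ → ℝ} {q : Fin 4 → ℝ} {D : ℝ} (h0 : ∀ x, 0 ≤ f x)
    (hf : ContDiff ℝ 3 f)
    (hb : ∀ k : Fin 4, k ≠ 0 → ∀ x, |iteratedDeriv k f x| / (1 + |f x| ^ q k) ≤ D) :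
    SelfBounded f D (fun u => 1 + u ^ q 1) (fun u => 1 + u ^ q 2) (fun u => 1 + u ^ q 3) := by
  have hd : ∀ k : ℕ, k < 3 → ∀ x,
      HasDerivAt (iteratedDeriv k f) (iteratedDeriv (k + 1) f x) x := fun k hk x => by
    rw [iteratedDeriv_succ]
    exact ((hf.differentiable_iteratedDeriv k (by exact_mod_cast hk)) x).hasDerivAt
  have hb' : ∀ k : Fin 4, k ≠ 0 → ∀ x, |iteratedDeriv k f x| ≤ D * (1 + f x ^ q k) :=
    fun k hk x => by
      have h := hb k hk x
      rw [abs_of_nonneg (h0 x)] at h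
      rwa [div_le_iff₀ (by have := Real.rpow_nonneg (h0 x) (q k); linarith)] at h
  refine ⟨h0, iteratedDeriv 1 f, iteratedDeriv 2 f, iteratedDeriv 3 f, fun x => ?_,
    hd 1 (by norm_num), hd 2 (by norm_num), hb' 1 (by decide), hb' 2 (by decide),
    hb' 3 (by decide)⟩
  simpa using hd 0 (by norm_num) x

theorem abs_iteratedDeriv_le_Kg {g : ℝ → ℝ} (hK : Kg g ≠ ⊤) (k : Fin 4) (x : ℝ) :
    |iteratedDeriv k g x| ≤ (Kg g).toReal := by
  rw [← ENNReal.ofReal_le_iff_le_toReal hK]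
  refine le_trans ?_ (le_add_self : _ ≤ Kg g)
  exact le_iSup₂_of_le (f := fun (k : Fin 4) (x : ℝ) => ENNReal.ofReal |iteratedDeriv k g x|) k x
    le_rfl

theorem boundedDerivs_of_Kg {g : ℝ → ℝ} (hg : ContDiff ℝ 3 g) (hK : Kg g ≠ ⊤) :
    BoundedDerivs g (Kg g).toReal := by
  have hd : ∀ k : ℕ, k < 3 → ∀ x,
      HasDerivAt (iteratedDeriv k g) (iteratedDeriv (k + 1) g x) x := fun k hk x => by
    rw [iteratedDeriv_succ]
    exact ((hg.differentiable_iteratedDeriv k (by exact_mod_cast hk)) x).hasDerivAt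
  refine ⟨fun x => by simpa using abs_iteratedDeriv_le_Kg hK 0 x, iteratedDeriv 1 g,
    iteratedDeriv 2 g, iteratedDeriv 3 g, fun x => ?_, hd 1 (by norm_num), hd 2 (by norm_num),
    abs_iteratedDeriv_le_Kg hK 1, abs_iteratedDeriv_le_Kg hK 2, abs_iteratedDeriv_le_Kg hK 3⟩
  simpa using hd 0 (by norm_num) x

/-- Polynomial growth of a uniform approximation `f` of `ℓ`. -/
theorem le_of_growth {f ℓ : ℝ → ℝ} {q₀ Lf ε : ℝ} (hq : 0 ≤ q₀) (hL : 1 ≤ Lf) (hε : ε ≤ 1)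
    (hg : ∀ x, |ℓ x| / (1 + |x| ^ q₀) ≤ Lf) (ha : ∀ x, |f x - ℓ x| ≤ ε) {x T : ℝ} (hT : 1 ≤ T)
    (hx : |x| ≤ T) : f x ≤ 4 * Lf * T ^ q₀ := by
  have h1 := hg x
  have hxq := Real.rpow_nonneg (abs_nonneg x) q₀
  rw [div_le_iff₀ (by linarith)] at h1
  have h2 := (abs_le.1 (ha x)).2
  have h3 := le_abs_self (ℓ x)
  have h4 : |x| ^ q₀ ≤ T ^ q₀ := Real.rpow_le_rpow (abs_nonneg _) hx hq
  have h5 : 1 ≤ T ^ q₀ := Real.one_le_rpow hT hq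
  have h6 : Lf * (1 + |x| ^ q₀) ≤ Lf * (2 * T ^ q₀) :=
    mul_le_mul_of_nonneg_left (by linarith) (by linarith)
  nlinarith

theorem rpow_le_of_growth {f ℓ : ℝ → ℝ} {q₀ Lf ε : ℝ} (hq : 0 ≤ q₀) (hL : 1 ≤ Lf) (hε : ε ≤ 1)
    (hg : ∀ x, |ℓ x| / (1 + |x| ^ q₀) ≤ Lf) (ha : ∀ x, |f x - ℓ x| ≤ ε) (hf : ∀ x, 0 ≤ f x)
    {x T a : ℝ} (ha0 : 0 ≤ a) (hT : 1 ≤ T) (hx : |x| ≤ T) :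
    f x ^ a ≤ 4 ^ a * Lf ^ a * T ^ (q₀ * a) := by
  have h := Real.rpow_le_rpow (hf x) (le_of_growth hq hL hε hg ha hT hx) ha0
  rwa [Real.mul_rpow (by positivity) (by positivity), Real.mul_rpow (by norm_num) (by linarith),
    ← Real.rpow_mul (by linarith)] at h

theorem add_pow_le_two_pow {a b : ℝ} (ha : 0 ≤ a) (hb : 0 ≤ b) (k : ℕ) :
    (a + b) ^ k ≤ 2 ^ k * (a ^ k + b ^ k) := by
  have h1 : 0 ≤ a ^ k := by positivity
  have h2 : 0 ≤ b ^ k := by positivity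
  have h : (a + b) ^ k ≤ 2 ^ k * (max a b) ^ k := by
    rw [← mul_pow]
    exact pow_le_pow_left₀ (by positivity)
      (by linarith [le_max_left a b, le_max_right a b]) k
  refine h.trans (mul_le_mul_of_nonneg_left ?_ (by positivity))
  rcases le_total a b with h | h
  · rw [max_eq_right h]; linarith
  · rw [max_eq_left h]; linarith

theorem max_one_abs_pow_le {x r y : ℝ} (h : |x| ≤ |r| + |y|) (k : ℕ) :
    max 1 |x| ^ k ≤ 2 ^ k * (1 + |r| ^ k + |y| ^ k) := by
  have h2 : (1 : ℝ) ≤ 2 ^ k := one_le_pow₀ (by norm_num)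
  have hr : 0 ≤ |r| ^ k := by positivity
  have hy : 0 ≤ |y| ^ k := by positivity
  rcases le_total 1 |x| with hx | hx
  · rw [max_eq_right hx]
    refine (pow_le_pow_left₀ (abs_nonneg _) h k).trans ((add_pow_le_two_pow (abs_nonneg _)
      (abs_nonneg _) k).trans (mul_le_mul_of_nonneg_left (by linarith) (by positivity)))
  · rw [max_eq_left hx, one_pow]
    nlinarith

theorem weight_growth_le {f ℓ : ℝ → ℝ} {q : Fin 4 → ℝ} {Lf ε : ℝ} (hq : ∀ k, 0 ≤ q k)
    (hL : 1 ≤ Lf) (hε : ε ≤ 1) (hg : ∀ x, |ℓ x| / (1 + |x| ^ q 0) ≤ Lf)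
    (ha : ∀ x, |f x - ℓ x| ≤ ε) (hf : ∀ x, 0 ≤ f x) {r y t : ℝ} (ht : t ∈ Icc (0 : ℝ) 1) :
    8 * (1 + f (r + t * y) ^ bq q)
      ≤ 16 * 4 ^ bq q * 2 ^ bq0 q * Lf ^ bq q * (1 + |r| ^ bq0 q + |y| ^ bq0 q) := by
  have hx : |r + t * y| ≤ |r| + |y| := by
    refine (abs_add_le _ _).trans (add_le_add_right ?_ _)
    rw [abs_mul, abs_of_nonneg ht.1]
    nlinarith [ht.2, abs_nonneg y]
  have hT : (1 : ℝ) ≤ max 1 |r + t * y| := le_max_left _ _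
  have hb := bq_nonneg hq
  have h1 := rpow_le_of_growth (hq 0) hL hε hg ha hf hb hT (le_max_right 1 |r + t * y|)
  have h2 : max 1 |r + t * y| ^ (q 0 * bq q) ≤ max 1 |r + t * y| ^ bq0 q := by
    rw [← Real.rpow_natCast]
    exact Real.rpow_le_rpow_of_exponent_le hT (mul_bq_le_bq0 q)
  have h3 := h2.trans (max_one_abs_pow_le hx (bq0 q))
  have h4 : (1 : ℝ) ≤ 4 ^ bq q := Real.one_le_rpow (by norm_num) hb
  have h5 : 1 ≤ Lf ^ bq q := Real.one_le_rpow hL hb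
  have h6 : (1 : ℝ) ≤ 2 ^ bq0 q := one_le_pow₀ (by norm_num)
  have hA : 1 ≤ 4 ^ bq q * Lf ^ bq q := by nlinarith
  have hB : 1 ≤ 2 ^ bq0 q * (1 + |r| ^ bq0 q + |y| ^ bq0 q) := by
    have hr : 0 ≤ |r| ^ bq0 q := by positivity
    have hy : 0 ≤ |y| ^ bq0 q := by positivity
    nlinarith
  have h7 := h1.trans (mul_le_mul_of_nonneg_left h3 (by linarith))
  nlinarith

/-- Local Lipschitz bound for a self-bounded loss of polynomial growth. -/
theorem abs_sub_le_of_growth {f ℓ : ℝ → ℝ} {q : Fin 4 → ℝ} {Lf ε D : ℝ} {G₂ G₃ : ℝ → ℝ}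
    (hq : ∀ k, 0 ≤ q k) (hL : 1 ≤ Lf) (hε : ε ≤ 1) (hD : 0 ≤ D)
    (hg : ∀ x, |ℓ x| / (1 + |x| ^ q 0) ≤ Lf) (ha : ∀ x, |f x - ℓ x| ≤ ε)
    (hf : SelfBounded f D (fun u => 1 + u ^ q 1) G₂ G₃)
    {x x' T : ℝ} (hT : 1 ≤ T) (hx : |x| ≤ T) (hx' : |x'| ≤ T) :
    |f x - f x'| ≤ D * (2 * 4 ^ q 1 * Lf ^ q 1 * T ^ (q 0 * q 1)) * |x - x'| := by
  obtain ⟨f₁, _, _, df, _, _, bf, _⟩ := hf.exists_derivs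
  have h := (convex_Icc (-T) T).norm_image_sub_le_of_norm_hasDerivWithin_le
    (f := f) (f' := f₁) (C := D * (2 * 4 ^ q 1 * Lf ^ q 1 * T ^ (q 0 * q 1)))
    (fun s _ => (df s).hasDerivWithinAt) (fun s hs => ?_) (abs_le.1 hx') (abs_le.1 hx)
  · simpa using h
  · refine (bf s).trans (mul_le_mul_of_nonneg_left ?_ hD)
    have h1 := rpow_le_of_growth (hq 0) hL hε hg ha hf.nonneg (hq 1) hT (abs_le.2 hs)
    have h4 : (1 : ℝ) ≤ 4 ^ q 1 := Real.one_le_rpow (by norm_num) (hq 1)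
    have h5 : 1 ≤ Lf ^ q 1 := Real.one_le_rpow hL (hq 1)
    have h6 : 1 ≤ T ^ (q 0 * q 1) := Real.one_le_rpow hT (mul_nonneg (hq 0) (hq 1))
    have : 1 ≤ 4 ^ q 1 * Lf ^ q 1 * T ^ (q 0 * q 1) := by
      have := one_le_mul_of_one_le_of_one_le h4 h5
      exact one_le_mul_of_one_le_of_one_le this h6
    linarith

end Losses

section RowLaws

open scoped MatrixOrder in
/-- The quadratic form of a Hermitian matrix is bounded by its largest eigenvalue. -/
theorem Matrix.IsHermitian.quadForm_le {p : ℕ} {A : Matrix (Fin p) (Fin p) ℝ} (hA : A.IsHermitian)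
    {M : ℝ} (h : ∀ k, hA.eigenvalues k ≤ M) (x : Fin p → ℝ) :
    ∑ j, ∑ k, x j * x k * A j k ≤ M * ∑ j, x j ^ 2 := by
  have h1 : A ≤ algebraMap ℝ _ M := by
    rw [le_algebraMap_iff_spectrum_le (ha := hA.isSelfAdjoint)]
    intro y hy
    rw [hA.spectrum_real_eq_range_eigenvalues] at hy
    obtain ⟨k, rfl⟩ := hy
    exact h k
  have h2 := (Matrix.le_iff.1 h1).dotProduct_mulVec_nonneg x
  rw [Matrix.sub_mulVec, dotProduct_sub, sub_nonneg] at h2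
  calc ∑ j, ∑ k, x j * x k * A j k = star x ⬝ᵥ A.mulVec x := by
        simp only [dotProduct, Matrix.mulVec, Finset.mul_sum]
        exact Finset.sum_congr rfl fun j _ => Finset.sum_congr rfl fun k _ => by
          simp only [Pi.star_apply, star_trivial]; ring
    _ ≤ _ := h2
    _ = M * ∑ j, x j ^ 2 := by
        rw [Algebra.algebraMap_eq_smul_one, Matrix.smul_mulVec, Matrix.one_mulVec, dotProduct_smul,
          smul_eq_mul]
        congr 1
        exact Finset.sum_congr rfl fun j _ => by simp [pow_two]

/-- A centred law on `ℝ^p` with covariance `Cov / n` and scaled moments of order `Q` at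
most `M`. -/
structure RowLaw {p : ℕ} (n Q : ℕ) (M : ℝ) (Cov : Matrix (Fin p) (Fin p) ℝ)
    (P : Measure (EuclideanSpace ℝ (Fin p))) : Prop where
  mean : ∀ j, ∫ x, x j ∂P = 0
  cov : ∀ j k, ∫ x, x j * x k ∂P = Cov j k / n
  moment : ∀ j, eLpNorm (fun x => √(n : ℝ) * x j) Q P ≤ ENNReal.ofReal M

variable {p n Q : ℕ} {M : ℝ} {Cov : Matrix (Fin p) (Fin p) ℝ}
  {P : Measure (EuclideanSpace ℝ (Fin p))}

theorem measurable_euclidean_apply (j : Fin p) :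
    Measurable (fun x : EuclideanSpace ℝ (Fin p) => x j) := by fun_prop

theorem RowLaw.memLp_scaled (h : RowLaw n Q M Cov P) (j : Fin p) :
    MemLp (fun x : EuclideanSpace ℝ (Fin p) => √(n : ℝ) * x j) Q P :=
  ⟨((measurable_euclidean_apply j).const_mul _).aestronglyMeasurable,
    (h.moment j).trans_lt ENNReal.ofReal_lt_top⟩

theorem RowLaw.memLp (h : RowLaw n Q M Cov P) (hn : 0 < n) (j : Fin p) :
    MemLp (fun x : EuclideanSpace ℝ (Fin p) => x j) Q P := by
  have h1 := (h.memLp_scaled j).const_mul (√(n : ℝ))⁻¹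
  refine h1.ae_eq (Filter.Eventually.of_forall fun x => ?_)
  have : √(n : ℝ) ≠ 0 := by positivity
  simp only
  field_simp

theorem integral_abs_pow_le_of_eLpNorm_le {Ω : Type*} [MeasurableSpace Ω] {μ : Measure Ω}
    [IsProbabilityMeasure μ] {f : Ω → ℝ} {M : ℝ} (hM : 0 ≤ M) {l Q : ℕ} (hl : l ≤ Q)
    (hf : AEStronglyMeasurable f μ) (h : eLpNorm f Q μ ≤ ENNReal.ofReal M) :
    ∫ ω, |f ω| ^ l ∂μ ≤ M ^ l := by
  rcases Nat.eq_zero_or_pos l with rfl | hl0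
  · simp
  have h1 : eLpNorm f l μ ≤ ENNReal.ofReal M :=
    (eLpNorm_le_eLpNorm_of_exponent_le (by exact_mod_cast hl) hf).trans h
  have hL : MemLp f l μ := ⟨hf, h1.trans_lt ENNReal.ofReal_lt_top⟩
  rw [hL.eLpNorm_eq_integral_rpow_norm (by exact_mod_cast hl0.ne') (ENNReal.natCast_ne_top l),
    ENNReal.ofReal_le_ofReal_iff hM] at h1
  simp only [ENNReal.toReal_natCast, Real.rpow_natCast, Real.norm_eq_abs] at h1
  have hI : 0 ≤ ∫ ω, |f ω| ^ l ∂μ := integral_nonneg fun ω => by positivity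
  have h2 := pow_le_pow_left₀ (Real.rpow_nonneg hI _) h1 l
  rwa [← Real.rpow_natCast, ← Real.rpow_mul hI, inv_mul_cancel₀ (by exact_mod_cast hl0.ne'),
    Real.rpow_one] at h2

variable [IsProbabilityMeasure P]

theorem RowLaw.integral_abs_pow_le (h : RowLaw n Q M Cov P) (hn : 0 < n) (hM : 0 ≤ M) {l : ℕ}
    (hl : l ≤ Q) (j : Fin p) : ∫ x, |x j| ^ l ∂P ≤ (M / √(n : ℝ)) ^ l := by
  have h1 := integral_abs_pow_le_of_eLpNorm_le hM hl (h.memLp_scaled j).1 (h.moment j)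
  have hs : 0 < √(n : ℝ) := by positivity
  simp only [abs_mul, mul_pow, abs_of_pos hs] at h1
  rw [integral_const_mul] at h1
  rw [div_pow, le_div_iff₀ (by positivity)]
  linarith

theorem pow_sum_le_card_mul {κ : Type*} (s : Finset κ) {a : κ → ℝ} (ha : ∀ i ∈ s, 0 ≤ a i)
    (l : ℕ) : (∑ i ∈ s, a i) ^ (l + 1) ≤ (s.card : ℝ) ^ l * ∑ i ∈ s, a i ^ (l + 1) := by
  rcases s.eq_empty_or_nonempty with rfl | hs
  · simp
  have hc : (0 : ℝ) < (s.card : ℝ) ^ l := by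
    have := hs.card_pos
    positivity
  have := pow_sum_div_card_le_sum_pow ha l
  rw [div_le_iff₀ hc] at this
  linarith

/-- Moments of the `ℓ¹` norm of a subvector. -/
theorem RowLaw.integral_sum_abs_pow_le (h : RowLaw n Q M Cov P) (hn : 0 < n) (hM : 0 ≤ M) {l : ℕ}
    (hl : l ≤ Q) (B : Finset (Fin p)) :
    Integrable (fun x : EuclideanSpace ℝ (Fin p) => (∑ j ∈ B, |x j|) ^ l) P ∧
    ∫ x, (∑ j ∈ B, |x j|) ^ l ∂P ≤ (B.card * (M / √(n : ℝ))) ^ l := by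
  have hL : MemLp (fun x : EuclideanSpace ℝ (Fin p) => ∑ j ∈ B, |x j|) Q P :=
    memLp_finsetSum B fun j _ => (h.memLp hn j).abs
  refine ⟨hL.integrable_pow_of_le hl, ?_⟩
  rcases l with _ | l
  · simp
  have hi : ∀ j, Integrable (fun x : EuclideanSpace ℝ (Fin p) => |x j| ^ (l + 1)) P := fun j =>
    (h.memLp hn j).abs.integrable_pow_of_le hl
  calc ∫ x, (∑ j ∈ B, |x j|) ^ (l + 1) ∂P
      ≤ ∫ x, (B.card : ℝ) ^ l * ∑ j ∈ B, |x j| ^ (l + 1) ∂P :=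
        integral_mono (hL.integrable_pow_of_le hl)
          ((integrable_finsetSum _ fun j _ => hi j).const_mul _)
          (fun x => pow_sum_le_card_mul B (fun j _ => abs_nonneg _) l)
    _ = (B.card : ℝ) ^ l * ∑ j ∈ B, ∫ x, |x j| ^ (l + 1) ∂P := by
        rw [integral_const_mul, integral_finsetSum _ fun j _ => hi j]
    _ ≤ (B.card : ℝ) ^ l * ∑ j ∈ B, (M / √(n : ℝ)) ^ (l + 1) := by
        gcongr with j _
        exact h.integral_abs_pow_le hn hM hl j
    _ = _ := by
        rw [Finset.sum_const, nsmul_eq_mul]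
        ring

variable {W : Type*}

/-- The contribution of the coordinates in `B` to the inner products with the points `pts w`. -/
noncomputable def blockMap (pts : W → EuclideanSpace ℝ (Fin p)) (B : Finset (Fin p))
    (x : EuclideanSpace ℝ (Fin p)) (w : W) : ℝ :=
  ∑ j ∈ B, x j * pts w j

theorem measurable_blockMap (pts : W → EuclideanSpace ℝ (Fin p)) (B : Finset (Fin p)) :
    Measurable (blockMap pts B) :=
  measurable_pi_iff.2 fun _ => Finset.measurable_fun_sum _ fun j _ =>
    (measurable_euclidean_apply j).mul_const _

theorem norm_blockMap_le [Fintype W] {pts : W → EuclideanSpace ℝ (Fin p)} {L : ℝ} (hL : 0 ≤ L)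
    (hpts : ∀ w, pts w ∈ cube p L) (B : Finset (Fin p)) (x : EuclideanSpace ℝ (Fin p)) :
    ‖blockMap pts B x‖ ≤ L * ∑ j ∈ B, |x j| := by
  rw [pi_norm_le_iff_of_nonneg (mul_nonneg hL (Finset.sum_nonneg fun j _ => abs_nonneg _))]
  intro w
  rw [Real.norm_eq_abs, blockMap, Finset.mul_sum]
  refine (Finset.abs_sum_le_sum_abs _ _).trans (Finset.sum_le_sum fun j _ => ?_)
  rw [abs_mul, mul_comm]
  exact mul_le_mul_of_nonneg_right (hpts w j) (abs_nonneg _)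

theorem RowLaw.integral_blockMap_mul (h : RowLaw n Q M Cov P) (hn : 0 < n) (hQ : 2 ≤ Q)
    (pts : W → EuclideanSpace ℝ (Fin p)) (B : Finset (Fin p)) (w w' : W) :
    ∫ y, y w * y w' ∂(P.map (blockMap pts B))
      = ∑ j ∈ B, ∑ k ∈ B, pts w j * pts w' k * (Cov j k / n) := by
  have h2 : ∀ j, MemLp (fun x : EuclideanSpace ℝ (Fin p) => x j) 2 P := fun j =>
    (h.memLp hn j).mono_exponent (by exact_mod_cast hQ)
  have hi : ∀ j k, Integrable (fun x : EuclideanSpace ℝ (Fin p) => x j * x k) P := fun j k =>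
    (h2 j).integrable_mul (h2 k)
  have hm : Measurable (fun y : W → ℝ => y w * y w') :=
    (measurable_pi_apply w).mul (measurable_pi_apply w')
  rw [integral_map (measurable_blockMap pts B).aemeasurable hm.aestronglyMeasurable]
  have e : ∀ x : EuclideanSpace ℝ (Fin p), blockMap pts B x w * blockMap pts B x w'
      = ∑ j ∈ B, ∑ k ∈ B, pts w j * pts w' k * (x j * x k) := fun x => by
    rw [blockMap, blockMap, Finset.sum_mul_sum]
    exact Finset.sum_congr rfl fun j _ => Finset.sum_congr rfl fun k _ => by ring
  simp only [e]
  rw [integral_finsetSum _ fun j _ => integrable_finsetSum _ fun k _ => (hi j k).const_mul _]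
  refine Finset.sum_congr rfl fun j _ => ?_
  rw [integral_finsetSum _ fun k _ => (hi j k).const_mul _]
  refine Finset.sum_congr rfl fun k _ => ?_
  rw [integral_const_mul, h.cov]

theorem RowLaw.blockLaw [Fintype W] (h : RowLaw n Q M Cov P) (hn : 0 < n) (hM : 0 ≤ M) {k : ℕ}
    (hk : k + 3 ≤ Q) {M₀ : ℝ} (hM₀ : 0 ≤ M₀)
    (hCov : ∀ x : Fin p → ℝ, ∑ j, ∑ k, x j * x k * Cov j k ≤ M₀ * ∑ j, x j ^ 2)
    {pts : W → EuclideanSpace ℝ (Fin p)} {L : ℝ} (hL : 0 ≤ L) (hpts : ∀ w, pts w ∈ cube p L)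
    (B : Finset (Fin p)) :
    BlockLaw (P.map (blockMap pts B)) k (L * (B.card * (M / √(n : ℝ))))
      (M₀ * L ^ 2 * B.card / n) := by
  have hm := measurable_blockMap pts B
  have hS : ∀ l, l ≤ k + 3 → _ := fun l hl =>
    h.integral_sum_abs_pow_le hn hM (hl.trans hk) B
  refine ⟨?_, fun w => ?_, fun l hl => ?_, fun w => ?_⟩
  · rw [memLp_map_measure_iff (by fun_prop) hm.aemeasurable]
    have h1 : MemLp (fun x : EuclideanSpace ℝ (Fin p) => L * ∑ j ∈ B, |x j|) (k + 3 : ℕ) P :=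
      (memLp_finsetSum B fun j _ =>
        ((h.memLp hn j).mono_exponent (by exact_mod_cast hk)).abs).const_mul L
    refine h1.mono hm.aestronglyMeasurable (Filter.Eventually.of_forall fun x => ?_)
    exact (norm_blockMap_le hL hpts B x).trans (le_abs_self _)
  · rw [integral_map hm.aemeasurable (measurable_pi_apply w).aestronglyMeasurable]
    have hi : ∀ j, Integrable (fun x : EuclideanSpace ℝ (Fin p) => x j) P := fun j =>
      (h.memLp hn j).integrable (by exact_mod_cast (by omega : 1 ≤ Q))
    simp only [blockMap]
    rw [integral_finsetSum _ fun j _ => (hi j).mul_const _]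
    refine Finset.sum_eq_zero fun j _ => ?_
    rw [integral_mul_const, h.mean, zero_mul]
  · rw [integral_map hm.aemeasurable (by fun_prop)]
    calc ∫ x, ‖blockMap pts B x‖ ^ l ∂P ≤ ∫ x, L ^ l * (∑ j ∈ B, |x j|) ^ l ∂P :=
          integral_mono_of_nonneg (Filter.Eventually.of_forall fun x => by positivity)
            ((hS l hl).1.const_mul _) (Filter.Eventually.of_forall fun x => by
              simp only
              rw [← mul_pow]
              exact pow_le_pow_left₀ (norm_nonneg _) (norm_blockMap_le hL hpts B x) l)
      _ ≤ L ^ l * (B.card * (M / √(n : ℝ))) ^ l := by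
          rw [integral_const_mul]
          exact mul_le_mul_of_nonneg_left (hS l hl).2 (by positivity)
      _ = _ := by rw [mul_pow L]
  · simp only [pow_two (_ : ℝ)]
    rw [h.integral_blockMap_mul hn (by omega) pts B w w]
    set u : Fin p → ℝ := fun j => if j ∈ B then pts w j else 0 with hu
    have e : ∑ j ∈ B, ∑ k ∈ B, pts w j * pts w k * (Cov j k / n)
        = (∑ j, ∑ k, u j * u k * Cov j k) / n := by
      rw [Finset.sum_div, ← Finset.sum_subset (Finset.subset_univ B)
        (fun j _ hj => by simp [hu, hj])]
      refine Finset.sum_congr rfl fun j hj => ?_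
      rw [Finset.sum_div, ← Finset.sum_subset (Finset.subset_univ B)
        (fun k _ hk => by simp [hu, hk])]
      refine Finset.sum_congr rfl fun k hk => ?_
      simp only [hu, hj, hk, if_true, mul_div_assoc]
    rw [e]
    refine div_le_div_of_nonneg_right ((hCov u).trans ?_) (Nat.cast_nonneg n)
    have e2 : ∑ j, u j ^ 2 ≤ ∑ j ∈ B, L ^ 2 := by
      rw [← Finset.univ_inter B, ← Finset.sum_ite_mem]
      refine Finset.sum_le_sum fun j _ => ?_
      by_cases hj : j ∈ B
      · simp only [hu, hj, if_true]
        exact sq_le_sq' (by linarith [(abs_le.1 (hpts w j)).1]) (abs_le.1 (hpts w j)).2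
      · simp [hu, hj]
    rw [Finset.sum_const, nsmul_eq_mul] at e2
    have := mul_le_mul_of_nonneg_left e2 hM₀
    simp only [pow_two] at this ⊢
    linarith

/-- The blocks of independent rows with independent blocks are jointly independent. -/
theorem map_blocks_pi {I : Type*} [Fintype I] (P : I → Measure (EuclideanSpace ℝ (Fin p)))
    [∀ i, IsProbabilityMeasure (P i)] {κ : I → ℕ} (B : (i : I) → Fin (κ i) → Finset (Fin p))
    (hB : ∀ i, iIndepFun (fun (a : Fin (κ i)) (x : EuclideanSpace ℝ (Fin p)) (j : B i a) => x j)
      (P i)) (pts : W → EuclideanSpace ℝ (Fin p)) :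
    (Measure.pi P).map (fun x (α : (i : I) × Fin (κ i)) => blockMap pts (B α.1 α.2) (x α.1))
      = Measure.pi (fun α : (i : I) × Fin (κ i) => (P α.1).map (blockMap pts (B α.1 α.2))) := by
  have hmp : ∀ i, MeasurePreserving (fun x : I → EuclideanSpace ℝ (Fin p) => x i) (Measure.pi P)
      (P i) := fun i => measurePreserving_eval P i
  have mX : ∀ i a, Measurable (fun x : I → EuclideanSpace ℝ (Fin p) =>
      blockMap pts (B i a) (x i)) := fun i a =>
    (measurable_blockMap pts (B i a)).comp (measurable_pi_apply i)
  have hb : ∀ i, iIndepFun (fun (a : Fin (κ i)) => blockMap pts (B i a)) (P i) := fun i => by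
    have := (hB i).comp (fun a (u : B i a → ℝ) (w : W) => ∑ j : B i a, u j * pts w j)
      (fun a => measurable_pi_iff.2 fun w => Finset.measurable_fun_sum _ fun j _ =>
        (measurable_pi_apply j).mul_const _)
    convert this using 2 with a
    ext x w
    simp only [blockMap, Function.comp]
    exact (Finset.sum_coe_sort (B i a) (fun j => x j * pts w j)).symm
  have hind : iIndepFun (fun (α : (i : I) × Fin (κ i)) (x : I → EuclideanSpace ℝ (Fin p)) =>
      blockMap pts (B α.1 α.2) (x α.1)) (Measure.pi P) := by
    refine iIndepFun_uncurry (X := fun i a (x : I → EuclideanSpace ℝ (Fin p)) => blockMap pts (B i a) (x i)) mX ?_ fun i => ?_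
    · exact iIndepFun_pi (X := fun i (y : EuclideanSpace ℝ (Fin p)) (a : Fin (κ i)) =>
        blockMap pts (B i a) y) fun i =>
          (measurable_pi_iff.2 fun a => measurable_blockMap pts (B i a)).aemeasurable
    · have h1 := (iIndepFun_iff_map_fun_eq_pi_map
        (fun a => (measurable_blockMap pts (B i a)).aemeasurable)).1 (hb i)
      refine (iIndepFun_iff_map_fun_eq_pi_map (fun a => (mX i a).aemeasurable)).2 ?_
      have e1 : ∀ a, (Measure.pi P).map (fun x => blockMap pts (B i a) (x i))
          = (P i).map (blockMap pts (B i a)) := fun a => by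
        rw [← (hmp i).map_eq, Measure.map_map (measurable_blockMap pts (B i a)) (hmp i).measurable]
        rfl
      simp only [e1]
      rw [← h1, ← (hmp i).map_eq, Measure.map_map
        (measurable_pi_iff.2 fun a => measurable_blockMap pts (B i a)) (hmp i).measurable]
      rfl
  refine ((iIndepFun_iff_map_fun_eq_pi_map
    (fun α : (i : I) × Fin (κ i) => (mX α.1 α.2).aemeasurable)).1 hind).trans ?_
  congr 1
  ext1 α
  rw [← (hmp α.1).map_eq, Measure.map_map (measurable_blockMap pts _) (hmp α.1).measurable]
  rfl

end RowLaws

section GaussianRows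

variable {p n Q : ℕ} {M : ℝ} {Cov : Matrix (Fin p) (Fin p) ℝ}

/-- The `L^Q` norm of a standard Gaussian variable. -/
noncomputable def gaussianNorm (Q : ℕ) : ℝ := (eLpNorm id Q (gaussianReal 0 1)).toReal

theorem eLpNorm_id_gaussianReal (Q : ℕ) (v : NNReal) :
    eLpNorm id Q (gaussianReal 0 v) = ENNReal.ofReal (√v * gaussianNorm Q) := by
  have hmap : (gaussianReal 0 1).map (fun x => √(v : ℝ) * x) = gaussianReal 0 v := by
    rw [gaussianReal_map_const_mul]
    congr 1
    · simp
    · ext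
      simp
  have hfin : eLpNorm id Q (gaussianReal 0 1) ≠ ⊤ := by
    have := (memLp_id_gaussianReal (μ := 0) (v := 1) (Q : NNReal)).2.ne
    simpa using this
  rw [← hmap, eLpNorm_map_measure (by fun_prop) (by fun_prop)]
  have : (id ∘ fun x : ℝ => √(v : ℝ) * x) = √(v : ℝ) • (id : ℝ → ℝ) := by
    ext x; simp
  rw [this, eLpNorm_const_smul, ENNReal.ofReal_mul (Real.sqrt_nonneg _), gaussianNorm,
    ENNReal.ofReal_toReal hfin]
  congr 1
  rw [Real.enorm_eq_ofReal (Real.sqrt_nonneg _)]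

theorem rowLaw_multivariateGaussian (hCov : Cov.PosDef) (hn : 0 < n) {M₀ : ℝ}
    (hM : ∀ x : Fin p → ℝ, ∑ j, ∑ k, x j * x k * Cov j k ≤ M₀ * ∑ j, x j ^ 2) (Q : ℕ) :
    RowLaw n Q (√M₀ * gaussianNorm Q) Cov (multivariateGaussian 0 ((1 / (n : ℝ)) • Cov)) := by
  have hS : ((1 / (n : ℝ)) • Cov).PosSemidef := hCov.posSemidef.smul (by positivity)
  have hmp := fun j => measurePreserving_eval_multivariateGaussian (μ := 0) hS (i := j)
  have mean : ∀ j, ∫ x, x j ∂(multivariateGaussian 0 ((1 / (n : ℝ)) • Cov)) = 0 := fun j => by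
    have := integral_map (φ := fun x : EuclideanSpace ℝ (Fin p) => x j)
      (μ := multivariateGaussian 0 ((1 / (n : ℝ)) • Cov))
      (hmp j).measurable.aemeasurable (f := fun y : ℝ => y) (by fun_prop)
    rw [← this, (hmp j).map_eq, integral_id_gaussianReal]
    simp
  refine ⟨mean, fun j k => ?_, fun j => ?_⟩
  · have h := covariance_eval_multivariateGaussian (μ := 0) hS j k
    rw [covariance, mean, mean] at h
    simp only [sub_zero] at h
    rw [h]
    simp only [Matrix.smul_apply, smul_eq_mul]
    ring
  · have e : eLpNorm (fun x : EuclideanSpace ℝ (Fin p) => √(n : ℝ) * x j) Q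
        (multivariateGaussian 0 ((1 / (n : ℝ)) • Cov))
        = ENNReal.ofReal √(n : ℝ) * eLpNorm id Q
          (gaussianReal 0 (((1 / (n : ℝ)) • Cov) j j).toNNReal) := by
      have e1 : (fun x : EuclideanSpace ℝ (Fin p) => √(n : ℝ) * x j)
          = √(n : ℝ) • ((id : ℝ → ℝ) ∘ fun x : EuclideanSpace ℝ (Fin p) => x j) := by
        ext x; simp
      rw [e1, eLpNorm_const_smul, eLpNorm_comp_measurePreserving (by fun_prop) (hmp j),
        Real.enorm_eq_ofReal (Real.sqrt_nonneg _)]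
      simp
    rw [e, eLpNorm_id_gaussianReal, ← ENNReal.ofReal_mul (Real.sqrt_nonneg _)]
    refine ENNReal.ofReal_le_ofReal ?_
    rw [← mul_assoc]
    refine mul_le_mul_of_nonneg_right ?_ ENNReal.toReal_nonneg
    rw [← Real.sqrt_mul (Nat.cast_nonneg n)]
    refine Real.sqrt_le_sqrt ?_
    have hjj : Cov j j ≤ M₀ := by
      have := hM (Pi.single j 1)
      simpa [Pi.single_apply] using this
    have h0 : 0 ≤ Cov j j := (hCov.diag_pos (i := j)).le
    simp only [Matrix.smul_apply, smul_eq_mul]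
    rw [Real.coe_toNNReal _ (by positivity)]
    have : (n : ℝ) ≠ 0 := by positivity
    field_simp
    exact hjj

theorem RowLaw.cov_eq_zero {P : Measure (EuclideanSpace ℝ (Fin p))} [IsProbabilityMeasure P]
    (h : RowLaw n Q M Cov P) (hn : 0 < n) {κ : ℕ} {B : Fin κ → Finset (Fin p)}
    (hB : iIndepFun (fun (a : Fin κ) (x : EuclideanSpace ℝ (Fin p)) (j : B a) => x j) P)
    {a b : Fin κ} (hab : a ≠ b) {j k : Fin p} (hj : j ∈ B a) (hk : k ∈ B b) : Cov j k = 0 := by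
  have hi : IndepFun (fun x : EuclideanSpace ℝ (Fin p) => x j)
      (fun x : EuclideanSpace ℝ (Fin p) => x k) P :=
    (hB.indepFun hab).comp (φ := fun u : B a → ℝ => u ⟨j, hj⟩) (ψ := fun u : B b → ℝ => u ⟨k, hk⟩)
      (measurable_pi_apply _) (measurable_pi_apply _)
  have h1 := hi.integral_fun_mul_eq_mul_integral
    (measurable_euclidean_apply j).aestronglyMeasurable
    (measurable_euclidean_apply k).aestronglyMeasurable
  rw [h.cov, h.mean, zero_mul, div_eq_zero_iff] at h1
  exact h1.resolve_right (by positivity)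

theorem iIndepFun_blocks_multivariateGaussian (hCov : Cov.PosDef) {κ : ℕ}
    {B : Fin κ → Finset (Fin p)}
    (h : ∀ a b, a ≠ b → ∀ j ∈ B a, ∀ k ∈ B b, Cov j k = 0) :
    iIndepFun (fun (a : Fin κ) (x : EuclideanSpace ℝ (Fin p)) (j : B a) => x j)
      (multivariateGaussian 0 ((1 / (n : ℝ)) • Cov)) := by
  have hS : ((1 / (n : ℝ)) • Cov).PosSemidef := hCov.posSemidef.smul (by positivity)
  refine HasGaussianLaw.iIndepFun_of_covariance_eval
    (X := fun (a : Fin κ) (j : B a) (x : EuclideanSpace ℝ (Fin p)) => x j) ?_ ?_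
  · have hid : HasGaussianLaw (id : EuclideanSpace ℝ (Fin p) → EuclideanSpace ℝ (Fin p))
        (multivariateGaussian 0 ((1 / (n : ℝ)) • Cov)) :=
      ⟨by rw [Measure.map_id]; infer_instance⟩
    exact hid.map (ContinuousLinearMap.pi fun a : Fin κ => ContinuousLinearMap.pi
      fun j : B a => (EuclideanSpace.proj (j : Fin p) : EuclideanSpace ℝ (Fin p) →L[ℝ] ℝ))
  · intro a b hab j k
    rw [covariance_eval_multivariateGaussian hS]
    simp [h a b hab j j.2 k k.2]

end GaussianRows

section Discretization

/-- A finite `δ`-net, in the uniform norm, of a subset of the cube. -/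
theorem exists_finset_net {p : ℕ} {S : Set (EuclideanSpace ℝ (Fin p))} {L δ : ℝ} (hδ : 0 < δ)
    (hδL : δ ≤ L) (hS : S ⊆ cube p L) (hne : S.Nonempty) :
    ∃ W : Finset (EuclideanSpace ℝ (Fin p)), (∀ w ∈ W, w ∈ S) ∧ W.Nonempty ∧
      (W.card : ℝ) ≤ (3 * L / δ) ^ p ∧ ∀ w ∈ S, ∃ w' ∈ W, ∀ j, |w j - w' j| ≤ δ := by
  classical
  set code : EuclideanSpace ℝ (Fin p) → Fin p → ℕ := fun w j => ⌊(w j + L) / δ⌋₊ with hcode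
  set T : Finset (Fin p → ℕ) := Fintype.piFinset fun _ => Finset.range (⌊2 * L / δ⌋₊ + 1) with hT
  have hcT : ∀ w ∈ S, code w ∈ T := fun w hw => by
    rw [hT, Fintype.mem_piFinset]
    intro j
    rw [Finset.mem_range, Nat.lt_succ_iff]
    refine Nat.floor_le_floor (div_le_div_of_nonneg_right ?_ hδ.le)
    linarith [(abs_le.1 (hS hw j)).2]
  choose! rep hrep using fun (c : Fin p → ℕ) (h : ∃ w ∈ S, code w = c) => h
  set T' := T.filter (fun c => ∃ w ∈ S, code w = c) with hT'
  have hmem : ∀ w ∈ S, code w ∈ T' := fun w hw => by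
    rw [hT', Finset.mem_filter]
    exact ⟨hcT w hw, w, hw, rfl⟩
  refine ⟨T'.image rep, fun w hw => ?_, ?_, ?_, fun w hw => ?_⟩
  · obtain ⟨c, hc, rfl⟩ := Finset.mem_image.1 hw
    exact (hrep c (Finset.mem_filter.1 hc).2).1
  · obtain ⟨w, hw⟩ := hne
    exact ⟨rep (code w), Finset.mem_image_of_mem rep (hmem w hw)⟩
  · have h1 : ((T'.image rep).card : ℝ) ≤ T.card := by
      exact_mod_cast Finset.card_image_le.trans (Finset.card_filter_le _ _)
    refine h1.trans ?_
    rw [hT, Fintype.card_piFinset]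
    simp only [Finset.card_range, Finset.prod_const, Finset.card_univ, Fintype.card_fin]
    push_cast
    refine pow_le_pow_left₀ (by positivity) ?_ p
    have h2 : (⌊2 * L / δ⌋₊ : ℝ) ≤ 2 * L / δ :=
      Nat.floor_le (div_nonneg (by linarith) hδ.le)
    have h3 : 1 ≤ L / δ := (one_le_div hδ).2 hδL
    calc (⌊2 * L / δ⌋₊ : ℝ) + 1 ≤ 2 * L / δ + L / δ := add_le_add h2 h3
      _ = 3 * L / δ := by ring
  · refine ⟨rep (code w), Finset.mem_image_of_mem rep (hmem w hw), fun j => ?_⟩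
    obtain ⟨hr, hc⟩ := hrep (code w) ⟨w, hw, rfl⟩
    have hcj : ⌊(rep (code w) j + L) / δ⌋₊ = ⌊(w j + L) / δ⌋₊ := congrFun hc j
    have a0 : 0 ≤ (w j + L) / δ := div_nonneg (by linarith [(abs_le.1 (hS hw j)).1]) hδ.le
    have b0 : 0 ≤ (rep (code w) j + L) / δ :=
      div_nonneg (by linarith [(abs_le.1 (hS hr j)).1]) hδ.le
    have a1 := Nat.floor_le a0
    have a2 := Nat.lt_floor_add_one ((w j + L) / δ)
    have b1 := Nat.floor_le b0
    have b2 := Nat.lt_floor_add_one ((rep (code w) j + L) / δ)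
    rw [hcj] at b1 b2
    have hd : |(w j + L) / δ - (rep (code w) j + L) / δ| ≤ 1 := by
      rw [abs_le]; constructor <;> linarith
    have e : (w j + L) / δ - (rep (code w) j + L) / δ = (w j - rep (code w) j) / δ := by ring
    rwa [e, abs_div, abs_of_pos hδ, div_le_one hδ] at hd

theorem log_card_net_le {m p : ℕ} {L δ : ℝ} (hδ : 0 < δ) (hδL : δ ≤ L) (hm : 0 < m)
    (h : (m : ℝ) ≤ (3 * L / δ) ^ p) : Real.log m ≤ p * (3 * logPlus (L / δ)) := by
  have hL : 0 < L := hδ.trans_le hδL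
  have h1 := Real.log_le_log (by exact_mod_cast hm) h
  rw [Real.log_pow, show 3 * L / δ = 3 * (L / δ) by ring,
    Real.log_mul (by norm_num) (by positivity)] at h1
  refine h1.trans (mul_le_mul_of_nonneg_left ?_ (Nat.cast_nonneg p))
  have h3 : Real.log 3 ≤ 2 := by
    have := Real.log_le_sub_one_of_pos (by norm_num : (0 : ℝ) < 3)
    linarith
  have a : 1 ≤ logPlus (L / δ) := le_max_left _ _
  have b : Real.log (L / δ) ≤ logPlus (L / δ) := le_max_right _ _
  linarith

theorem softmin_bounds {W : Type*} [Fintype W] [Nonempty W] {β : ℝ} (hβ : 0 < β) (h : W → ℝ) :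
    (∀ w, -(1 / β) * Real.log (∑ w, Real.exp (-β * h w)) ≤ h w) ∧
    ∃ w, h w ≤ -(1 / β) * Real.log (∑ w, Real.exp (-β * h w))
      + Real.log (Fintype.card W) / β := by
  have hpos : 0 < ∑ w, Real.exp (-β * h w) :=
    Finset.sum_pos (fun w _ => Real.exp_pos _) Finset.univ_nonempty
  constructor
  · intro w
    have h1 : Real.exp (-β * h w) ≤ ∑ w, Real.exp (-β * h w) :=
      Finset.single_le_sum (f := fun w => Real.exp (-β * h w))
        (fun w _ => (Real.exp_pos _).le) (Finset.mem_univ w)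
    have h2 := Real.log_le_log (Real.exp_pos _) h1
    rw [Real.log_exp] at h2
    have e : -(1 / β) * Real.log (∑ w, Real.exp (-β * h w))
        = -Real.log (∑ w, Real.exp (-β * h w)) / β := by ring
    rw [e, div_le_iff₀ hβ]
    linarith
  · obtain ⟨w, hw⟩ := Finite.exists_min h
    refine ⟨w, ?_⟩
    have h1 : ∑ w, Real.exp (-β * h w) ≤ Fintype.card W * Real.exp (-β * h w) := by
      rw [← nsmul_eq_mul, ← Finset.card_univ]
      refine Finset.sum_le_card_nsmul _ _ _ fun v _ => Real.exp_le_exp.2 ?_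
      nlinarith [hw v]
    have h2 := Real.log_le_log hpos h1
    rw [Real.log_mul (by exact_mod_cast Fintype.card_ne_zero) (Real.exp_pos _).ne',
      Real.log_exp] at h2
    have e : -(1 / β) * Real.log (∑ w, Real.exp (-β * h w)) + Real.log (Fintype.card W) / β
        = (Real.log (Fintype.card W) - Real.log (∑ w, Real.exp (-β * h w))) / β := by ring
    rw [e, le_div_iff₀ hβ]
    linarith

variable {n p : ℕ}

theorem continuous_dot (w : EuclideanSpace ℝ (Fin p)) (i : Fin n) :
    Continuous fun A : Fin n → EuclideanSpace ℝ (Fin p) => ∑ j, A i j * w j := by fun_prop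

theorem continuous_empRisk {ℓ : Fin n → ℝ → ℝ} (hℓ : ∀ i, Continuous (ℓ i))
    (R : EuclideanSpace ℝ (Fin p) → ℝ) (w : EuclideanSpace ℝ (Fin p)) :
    Continuous (empRisk ℓ R w) := by
  unfold empRisk
  exact (continuous_const.mul (continuous_finsetSum _ fun i _ =>
    (hℓ i).comp (continuous_dot w i))).add continuous_const

theorem isCompact_cube (p : ℕ) (L : ℝ) : IsCompact (cube p L) := by
  have : cube p L = (EuclideanSpace.equiv (Fin p) ℝ) ⁻¹' (Set.univ.pi fun _ => Icc (-L) L) := by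
    ext w
    simp only [cube, mem_ofPred_eq, mem_preimage, mem_univ_pi, mem_Icc, abs_le]
    rfl
  rw [this]
  exact (EuclideanSpace.equiv (Fin p) ℝ).toHomeomorph.isCompact_preimage.2
    (isCompact_univ_pi fun _ => isCompact_Icc)

theorem exists_abs_loss_le {ℓ : Fin n → ℝ → ℝ} (hℓ : ∀ i, Continuous (ℓ i)) (L : ℝ)
    (A : Fin n → EuclideanSpace ℝ (Fin p)) :
    ∃ C, ∀ w ∈ cube p L, |(1 / (n : ℝ)) * ∑ i, ℓ i (∑ j, A i j * w j)| ≤ C := by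
  have hc : Continuous fun w : EuclideanSpace ℝ (Fin p) =>
      (1 / (n : ℝ)) * ∑ i, ℓ i (∑ j, A i j * w j) :=
    continuous_const.mul (continuous_finsetSum _ fun i _ => (hℓ i).comp (by fun_prop))
  obtain ⟨C, hC⟩ := (isCompact_cube p L).exists_bound_of_continuousOn hc.continuousOn
  exact ⟨C, fun w hw => hC w hw⟩

theorem measurable_minRisk {ℓ : Fin n → ℝ → ℝ} (hℓ : ∀ i, Continuous (ℓ i))
    (R : EuclideanSpace ℝ (Fin p) → ℝ) {S : Set (EuclideanSpace ℝ (Fin p))} {L : ℝ}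
    (hS : S ⊆ cube p L) : Measurable (minRisk ℓ R S) := by
  have key : ∀ A, BddBelow (range fun w : S => empRisk ℓ R w A)
      ↔ BddBelow (range fun w : S => R w) := fun A => by
    obtain ⟨C, hC⟩ := exists_abs_loss_le hℓ L A
    constructor
    · rintro ⟨m, hm⟩
      refine ⟨m - C, ?_⟩
      rintro _ ⟨w, rfl⟩
      have h1 : m ≤ empRisk ℓ R w A := hm ⟨w, rfl⟩
      have h2 := (abs_le.1 (hC w (hS w.2))).2
      simp only [empRisk] at h1
      simp only
      linarith
    · rintro ⟨m, hm⟩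
      refine ⟨m - C, ?_⟩
      rintro _ ⟨w, rfl⟩
      have h1 : m ≤ R w := hm ⟨w, rfl⟩
      have h2 := (abs_le.1 (hC w (hS w.2))).1
      simp only [empRisk]
      linarith
  by_cases hR : BddBelow (range fun w : S => R w)
  · refine UpperSemicontinuous.measurable (upperSemicontinuous_ciInf (fun A => (key A).2 hR)
      fun w => (continuous_empRisk hℓ R w).upperSemicontinuous)
  · have : minRisk ℓ R S = fun _ => 0 := by
      ext A
      exact Real.iInf_of_not_bddBelow fun h => hR ((key A).1 h)
    rw [this]
    exact measurable_const

/-- Comparison of the minimized risk with the soft risk on a net. -/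
theorem abs_minRisk_sub_softRisk_le {ι : Type*} [Fintype ι] {row : ι → Fin n} (hn : 0 < n) {b : ℝ}
    (hb : 0 < b) {ℓ f : Fin n → ℝ → ℝ} {ε : ℝ} (ha : ∀ i x, |f i x - ℓ i x| ≤ ε)
    {R : EuclideanSpace ℝ (Fin p) → ℝ} {S : Set (EuclideanSpace ℝ (Fin p))} {L δ : ℝ}
    (hS : S ⊆ cube p L) {W : Finset (EuclideanSpace ℝ (Fin p))} (hWS : ∀ w ∈ W, w ∈ S)
    (hW : W.Nonempty) (hnet : ∀ w ∈ S, ∃ w' ∈ W, ∀ j, |w j - w' j| ≤ δ) {r : ℝ}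
    (hR : ∀ w ∈ cube p L, ∀ w' ∈ cube p L, (∀ j, |w j - w' j| ≤ δ) → |R w - R w'| ≤ r)
    {A : Fin n → EuclideanSpace ℝ (Fin p)} {z : ι → W → ℝ}
    (hz : ∀ i (w : W), ∑ α with row α = i, z α w = ∑ j, A i j * w.1 j) {Δ : Fin n → ℝ}
    (hΔ : ∀ i, ∀ w ∈ cube p L, ∀ w' ∈ cube p L, (∀ j, |w j - w' j| ≤ δ) →
      |f i (∑ j, A i j * w j) - f i (∑ j, A i j * w' j)| ≤ Δ i) :
    |minRisk ℓ R S A - softRisk n b f row (fun w : W => R w) z|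
      ≤ ε + r + (1 / (n : ℝ)) * ∑ i, Δ i + Real.log W.card / (n * b) := by
  have hn0 : (0 : ℝ) < n := by exact_mod_cast hn
  have : Nonempty W := hW.to_subtype
  set h : W → ℝ := fun w => (1 / (n : ℝ)) * ∑ i, f i (∑ j, A i j * w.1 j) + R w with hh
  have es : softRisk n b f row (fun w : W => R w) z
      = -(1 / (n * b)) * Real.log (∑ w, Real.exp (-(n * b) * h w)) := by
    unfold softRisk
    congr 2
    refine Finset.sum_congr rfl fun w _ => ?_
    congr 1
    simp only [hz, hh]
    field_simp
    ring
  have hβ : 0 < (n : ℝ) * b := by positivity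
  obtain ⟨s1, w₀, s2⟩ := softmin_bounds hβ h
  rw [← es] at s1 s2
  rw [Fintype.card_coe] at s2
  set σ := softRisk n b f row (fun w : W => R w) z with hσ
  have hε : 0 ≤ ε := (abs_nonneg _).trans (ha ⟨0, hn⟩ 0)
  have hcube0 : w₀.1 ∈ cube p L := hS (hWS _ w₀.2)
  obtain ⟨w', _, hw'⟩ := hnet w₀.1 (hWS _ w₀.2)
  have hδ : ∀ j : Fin p, |w₀.1 j - w₀.1 j| ≤ δ := fun j => by
    rw [sub_self, abs_zero]; exact (abs_nonneg _).trans (hw' j)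
  have hr0 : 0 ≤ r := (abs_nonneg _).trans (hR _ hcube0 _ hcube0 hδ)
  have hΔ0 : 0 ≤ (1 / (n : ℝ)) * ∑ i, Δ i := mul_nonneg (by positivity)
    (Finset.sum_nonneg fun i _ => (abs_nonneg _).trans (hΔ i _ hcube0 _ hcube0 hδ))
  have hlog : 0 ≤ Real.log W.card / (n * b) := div_nonneg
    (Real.log_nonneg (by exact_mod_cast hW.card_pos)) hβ.le
  have avg : ∀ {u v c : Fin n → ℝ}, (∀ i, u i ≤ v i + c i) →
      (1 / (n : ℝ)) * ∑ i, u i ≤ (1 / (n : ℝ)) * ∑ i, v i + (1 / (n : ℝ)) * ∑ i, c i :=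
    fun {u v c} huv => by
      rw [← mul_add, ← Finset.sum_add_distrib]
      exact mul_le_mul_of_nonneg_left (Finset.sum_le_sum fun i _ => huv i) (by positivity)
  have avgc : (1 / (n : ℝ)) * ∑ _i : Fin n, ε = ε := by
    simp [hn0.ne']
  have lower : ∀ w : S, σ - (ε + r + (1 / (n : ℝ)) * ∑ i, Δ i) ≤ empRisk ℓ R w A := fun w => by
    obtain ⟨w', hw'W, hclose⟩ := hnet w w.2
    have c1 := hS w.2
    have c2 := hS (hWS _ hw'W)
    have a1 := s1 ⟨w', hw'W⟩
    have a2 := (abs_le.1 (hR _ c1 _ c2 hclose)).1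
    have a3 := avg (u := fun i => f i (∑ j, A i j * w' j))
      (v := fun i => f i (∑ j, A i j * w.1 j)) (c := Δ) fun i => by
        have := (abs_le.1 (hΔ i _ c1 _ c2 hclose)).1
        linarith
    have a4 := avg (u := fun i => f i (∑ j, A i j * w.1 j))
      (v := fun i => ℓ i (∑ j, A i j * w.1 j)) (c := fun _ => ε) fun i => by
        have := (abs_le.1 (ha i (∑ j, A i j * w.1 j))).2
        linarith
    rw [avgc] at a4
    simp only [hh] at a1
    simp only [empRisk]
    linarith
  have : Nonempty S := ⟨⟨w₀.1, hWS _ w₀.2⟩⟩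
  have low : σ - (ε + r + (1 / (n : ℝ)) * ∑ i, Δ i) ≤ minRisk ℓ R S A := le_ciInf lower
  have up : minRisk ℓ R S A ≤ σ + Real.log W.card / (n * b) + ε := by
    have b1 : minRisk ℓ R S A ≤ empRisk ℓ R w₀ A :=
      ciInf_le ⟨_, by rintro _ ⟨w, rfl⟩; exact lower w⟩ (⟨w₀.1, hWS _ w₀.2⟩ : S)
    have b2 := avg (u := fun i => ℓ i (∑ j, A i j * w₀.1 j))
      (v := fun i => f i (∑ j, A i j * w₀.1 j)) (c := fun _ => ε) fun i => by
        have := (abs_le.1 (ha i (∑ j, A i j * w₀.1 j))).1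
        linarith
    rw [avgc] at b2
    simp only [empRisk] at b1
    simp only [hh] at s2
    linarith
  rw [abs_le]
  constructor <;> linarith

end Discretization

section BlockSums

/-- A partition of `Fin p` into cells of size at most `d`. -/
structure IsBlockPartition {p κ : ℕ} (d : ℕ) (B : Fin κ → Finset (Fin p)) : Prop where
  disjoint : Pairwise (fun a b => Disjoint (B a) (B b))
  cover : ∀ j, ∃ a, j ∈ B a
  card_le : ∀ a, (B a).card ≤ d

variable {p κ d : ℕ} {B : Fin κ → Finset (Fin p)}

theorem IsBlockPartition.sum_sum (h : IsBlockPartition d B) (F : Fin p → ℝ) :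
    ∑ a, ∑ j ∈ B a, F j = ∑ j, F j := by
  classical
  rw [← Finset.sum_biUnion fun a _ b _ hab => h.disjoint hab]
  congr 1
  ext j
  simpa using h.cover j

theorem IsBlockPartition.sum_card (h : IsBlockPartition d B) :
    ∑ a, ((B a).card : ℝ) = p := by
  have := h.sum_sum (fun _ => (1 : ℝ))
  simpa using this

theorem IsBlockPartition.sum_card_pow_le (h : IsBlockPartition d B) (l : ℕ) :
    ∑ a, ((B a).card : ℝ) ^ (l + 1) ≤ p * (d : ℝ) ^ l := by
  rw [← h.sum_card, Finset.sum_mul]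
  refine Finset.sum_le_sum fun a _ => ?_
  rw [pow_succ, mul_comm]
  have : ((B a).card : ℝ) ≤ d := by exact_mod_cast h.card_le a
  gcongr

theorem IsBlockPartition.one_le (h : IsBlockPartition d B) (hp : 0 < p) : 1 ≤ d := by
  obtain ⟨a, ha⟩ := h.cover ⟨0, hp⟩
  exact (Finset.card_pos.2 ⟨_, ha⟩).trans_le (h.card_le a)

theorem sum_filter_sigma_fst {I : Type*} [Fintype I] [DecidableEq I] {κ : I → ℕ}
    (F : ((i : I) × Fin (κ i)) → ℝ) (i : I) :
    ∑ α with Sigma.fst α = i, F α = ∑ a, F ⟨i, a⟩ := by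
  rw [Finset.sum_filter, Fintype.sum_sigma, Finset.sum_eq_single i]
  · simp
  · intro i' _ hi'
    simp [hi']
  · simp

end BlockSums

section Rates

variable {n p d : ℕ} {q : Fin 4 → ℝ}

theorem sqrt_pow_eq_rpow (n l : ℕ) : √(n : ℝ) ^ l = (n : ℝ) ^ ((l : ℝ) / 2) := by
  rw [Real.sqrt_eq_rpow, ← Real.rpow_natCast, ← Real.rpow_mul (Nat.cast_nonneg n)]
  congr 1
  ring

theorem le_sigmaN_cube (n p d : ℕ) (q : Fin 4 → ℝ) :
    (p : ℝ) * (d : ℝ) ^ 2 / √(n : ℝ) ^ 3 ≤ sigmaN n p d q := by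
  rw [sqrt_pow_eq_rpow]
  unfold sigmaN
  have h1 : 0 ≤ (p : ℝ) * (d : ℝ) ^ (3 + (bq0 q : ℝ) / 2) / (n : ℝ) ^ (5 / 2 : ℝ) := by positivity
  have h3 : 0 ≤ (p : ℝ) * (d : ℝ) ^ (bq0 q + 2) / (n : ℝ) ^ (((bq0 q : ℝ) + 3) / 2) := by
    positivity
  push_cast
  linarith

theorem le_sigmaN_pow (n p d : ℕ) (q : Fin 4 → ℝ) :
    (p : ℝ) * (d : ℝ) ^ (bq0 q + 2) / √(n : ℝ) ^ (bq0 q + 3) ≤ sigmaN n p d q := by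
  rw [sqrt_pow_eq_rpow]
  unfold sigmaN
  have h1 : 0 ≤ (p : ℝ) * (d : ℝ) ^ (3 + (bq0 q : ℝ) / 2) / (n : ℝ) ^ (5 / 2 : ℝ) := by positivity
  have h3 : 0 ≤ (p : ℝ) * (d : ℝ) ^ 2 / (n : ℝ) ^ (3 / 2 : ℝ) := by positivity
  push_cast
  linarith

theorem sigmaN_pos (hn : 0 < n) (hp : 0 < p) (hd : 1 ≤ d) : 0 < sigmaN n p d q := by
  refine lt_of_lt_of_le ?_ (le_sigmaN_cube n p d q)
  positivity

theorem pow_four_le_of_sigmaN_le_one (hn : 0 < n) {τ : ℝ} (hτ : 0 < τ) (hp : τ ≤ (p : ℝ) / n)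
    (h : sigmaN n p d q ≤ 1) : (d : ℝ) ^ 4 ≤ n / τ ^ 2 := by
  have hs : 0 < √(n : ℝ) := by positivity
  have hsq : √(n : ℝ) ^ 2 = n := Real.sq_sqrt (Nat.cast_nonneg n)
  have h1 := (le_sigmaN_cube n p d q).trans h
  rw [div_le_one (by positivity)] at h1
  rw [le_div_iff₀ (by exact_mod_cast hn)] at hp
  have h2 : τ * (d : ℝ) ^ 2 ≤ √(n : ℝ) := by
    have h3 : τ * n * (d : ℝ) ^ 2 ≤ √(n : ℝ) ^ 3 :=
      (mul_le_mul_of_nonneg_right hp (by positivity)).trans h1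
    have h4 : √(n : ℝ) ^ 2 * (τ * (d : ℝ) ^ 2) ≤ √(n : ℝ) ^ 2 * √(n : ℝ) := by
      calc √(n : ℝ) ^ 2 * (τ * (d : ℝ) ^ 2) = τ * n * (d : ℝ) ^ 2 := by rw [hsq]; ring
        _ ≤ √(n : ℝ) ^ 3 := h3
        _ = √(n : ℝ) ^ 2 * √(n : ℝ) := by ring
    exact le_of_mul_le_mul_left h4 (by positivity)
  rw [le_div_iff₀ (by positivity)]
  have h5 := pow_le_pow_left₀ (by positivity) h2 2
  rw [hsq] at h5
  nlinarith

theorem omegaN_le (hn : 0 < n) (hp : 0 < p) (hd : 1 ≤ d) (hq : ∀ k, 0 ≤ q k) :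
    omegaN n p d q ≤ sigmaN n p d q := by
  have h1 : (1 : ℝ) ≤ n := by exact_mod_cast hn
  unfold omegaN
  refine mul_le_of_le_one_left (sigmaN_pos hn hp hd).le (Real.rpow_le_one_of_one_le_of_nonpos h1 ?_)
  have := mul_nonneg (hq 0) (hq 1)
  linarith

theorem mul_rpow_le_of_lt_omegaN (hn : 0 < n) {δ : ℝ}
    (hδ : δ < omegaN n p d q) (hσ : 0 ≤ sigmaN n p d q) :
    δ * (n : ℝ) ^ ((q 0 * q 1 + 1) / 2) ≤ sigmaN n p d q := by
  have hn0 : (0 : ℝ) < n := by exact_mod_cast hn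
  have h1 : (1 : ℝ) ≤ n := by exact_mod_cast hn
  calc δ * (n : ℝ) ^ ((q 0 * q 1 + 1) / 2)
      ≤ omegaN n p d q * (n : ℝ) ^ ((q 0 * q 1 + 1) / 2) :=
        mul_le_mul_of_nonneg_right hδ.le (by positivity)
    _ = (n : ℝ) ^ (-1 : ℝ) * sigmaN n p d q := by
        rw [omegaN, mul_right_comm, ← Real.rpow_add hn0]
        congr 2
        ring
    _ ≤ _ := mul_le_of_le_one_left hσ (Real.rpow_le_one_of_one_le_of_nonpos h1 (by norm_num))

theorem one_le_avL {Lℓ : Fin n → ℝ} (hn : 0 < n) (hq : ∀ k, 0 ≤ q k) (hL : ∀ i, 1 ≤ Lℓ i) :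
    1 ≤ avL q Lℓ := by
  have hn0 : (0 : ℝ) < n := by exact_mod_cast hn
  have : (n : ℝ) ≤ ∑ i, Lℓ i ^ bq q := by
    have h := Finset.card_nsmul_le_sum Finset.univ (fun i => Lℓ i ^ bq q) 1
      (fun i _ => Real.one_le_rpow (hL i) (bq_nonneg hq))
    simpa using h
  unfold avL
  rw [one_div, ← div_eq_inv_mul, le_div_iff₀ hn0]
  linarith

end Rates

section Discretization

variable {n p Q : ℕ} {M : ℝ} {Cov : Matrix (Fin p) (Fin p) ℝ} {q : Fin 4 → ℝ}

theorem abs_dot_le {L : ℝ} {w : EuclideanSpace ℝ (Fin p)} (hw : ∀ j, |w j| ≤ L)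
    (x : EuclideanSpace ℝ (Fin p)) : |∑ j, x j * w j| ≤ L * ∑ j, |x j| := by
  rw [Finset.mul_sum]
  refine (Finset.abs_sum_le_sum_abs _ _).trans (Finset.sum_le_sum fun j _ => ?_)
  rw [abs_mul, mul_comm]
  exact mul_le_mul_of_nonneg_right (hw j) (abs_nonneg _)

/-- Oscillation of the loss along the net, in terms of the scaled `ℓ¹` norm of the row. -/
theorem abs_loss_sub_le {f ℓ : ℝ → ℝ} {Lf ε D : ℝ} {G₂ G₃ : ℝ → ℝ} (hn : 0 < n)
    (hq : ∀ k, 0 ≤ q k) (hL : 1 ≤ Lf) (hε : ε ≤ 1) (hD : 0 ≤ D)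
    (hg : ∀ x, |ℓ x| / (1 + |x| ^ q 0) ≤ Lf) (ha : ∀ x, |f x - ℓ x| ≤ ε)
    (hf : SelfBounded f D (fun u => 1 + u ^ q 1) G₂ G₃) {L δ : ℝ} (hL1 : 1 ≤ L)
    {w w' : EuclideanSpace ℝ (Fin p)} (hw : w ∈ cube p L) (hw' : w' ∈ cube p L)
    (hδ : ∀ j, |w j - w' j| ≤ δ) (x : EuclideanSpace ℝ (Fin p)) :
    |f (∑ j, x j * w j) - f (∑ j, x j * w' j)|
      ≤ D * (2 * 4 ^ q 1 * Lf ^ q 1) * L ^ (q 0 * q 1) * (δ * (n : ℝ) ^ ((q 0 * q 1 + 1) / 2))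
        * ((∑ j, |x j|) / √(n : ℝ) + ((∑ j, |x j|) / √(n : ℝ)) ^ (bq0 q + 1)) := by
  set a : ℝ := q 0 * q 1 with haa
  have ha0 : 0 ≤ a := mul_nonneg (hq 0) (hq 1)
  set s : ℝ := ∑ j, |x j| with hs
  have hs0 : 0 ≤ s := Finset.sum_nonneg fun j _ => abs_nonneg _
  have hn1 : (1 : ℝ) ≤ √(n : ℝ) := by
    rw [Real.one_le_sqrt]; exact_mod_cast hn
  have hsn : 0 < √(n : ℝ) := by linarith
  set U : ℝ := s / √(n : ℝ) with hU
  have hU0 : 0 ≤ U := by positivity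
  have hsU : s = √(n : ℝ) * U := by rw [hU]; field_simp
  set T : ℝ := L * √(n : ℝ) * max 1 U with hT
  have hmax : (1 : ℝ) ≤ max 1 U := le_max_left _ _
  have hLn : 1 ≤ L * √(n : ℝ) := one_le_mul_of_one_le_of_one_le hL1 hn1
  have hT1 : 1 ≤ T := one_le_mul_of_one_le_of_one_le hLn hmax
  have hLs : L * s ≤ T := by
    rw [hT, hsU, ← mul_assoc]
    exact mul_le_mul_of_nonneg_left (le_max_right _ _) (by linarith)
  have hd : |∑ j, x j * w j - ∑ j, x j * w' j| ≤ δ * s := by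
    have e : ∑ j, x j * w j - ∑ j, x j * w' j = ∑ j, x j * (w - w') j := by
      rw [← Finset.sum_sub_distrib]
      exact Finset.sum_congr rfl fun j _ => by simp; ring
    rw [e]
    exact abs_dot_le (by simpa using hδ) x
  have h := abs_sub_le_of_growth hq hL hε hD hg ha hf hT1 ((abs_dot_le hw x).trans hLs)
    ((abs_dot_le hw' x).trans hLs)
  have hTa : T ^ a ≤ L ^ a * (n : ℝ) ^ (a / 2) * (1 + U ^ bq0 q) := by
    rw [hT, Real.mul_rpow (by positivity) (by positivity), Real.mul_rpow (by positivity)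
      (by positivity), Real.sqrt_eq_rpow, ← Real.rpow_mul (Nat.cast_nonneg n)]
    have e : 1 / 2 * a = a / 2 := by ring
    rw [e]
    refine mul_le_mul_of_nonneg_left ?_ (by positivity)
    have hak : a ≤ bq0 q := (mul_le_mul_of_nonneg_left (le_bq_one hq) (hq 0)).trans
      (mul_bq_le_bq0 q)
    have h1 : max 1 U ^ a ≤ max 1 U ^ bq0 q := by
      rw [← Real.rpow_natCast]
      exact Real.rpow_le_rpow_of_exponent_le hmax hak
    refine h1.trans ?_
    rcases le_total 1 U with h | h
    · rw [max_eq_right h]; linarith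
    · rw [max_eq_left h, one_pow]
      have : 0 ≤ U ^ bq0 q := by positivity
      linarith
  have hnn : (n : ℝ) ^ (a / 2) * √(n : ℝ) = (n : ℝ) ^ ((a + 1) / 2) := by
    rw [Real.sqrt_eq_rpow, ← Real.rpow_add (by exact_mod_cast hn)]
    congr 1
    ring
  refine h.trans ?_
  have hC : 0 ≤ D * (2 * 4 ^ q 1 * Lf ^ q 1) := by positivity
  calc D * (2 * 4 ^ q 1 * Lf ^ q 1 * T ^ a) * |∑ j, x j * w j - ∑ j, x j * w' j|
      = D * (2 * 4 ^ q 1 * Lf ^ q 1) * (T ^ a * |∑ j, x j * w j - ∑ j, x j * w' j|) := by ring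
    _ ≤ D * (2 * 4 ^ q 1 * Lf ^ q 1)
        * ((L ^ a * (n : ℝ) ^ (a / 2) * (1 + U ^ bq0 q)) * (δ * s)) :=
        mul_le_mul_of_nonneg_left (mul_le_mul hTa hd (abs_nonneg _) (by positivity)) hC
    _ = D * (2 * 4 ^ q 1 * Lf ^ q 1) * L ^ a * (δ * ((n : ℝ) ^ (a / 2) * √(n : ℝ)))
        * (U + U ^ (bq0 q + 1)) := by
        rw [hsU]; ring
    _ = _ := by rw [hnn]

theorem RowLaw.integral_scaled_l1_le {P : Measure (EuclideanSpace ℝ (Fin p))}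
    [IsProbabilityMeasure P] (h : RowLaw n Q M Cov P) (hn : 0 < n) (hM : 0 ≤ M) {τ : ℝ}
    (hp : (p : ℝ) / n ≤ 1 / τ) {l : ℕ} (hl : l ≤ Q) :
    Integrable (fun x : EuclideanSpace ℝ (Fin p) => ((∑ j, |x j|) / √(n : ℝ)) ^ l) P ∧
    ∫ x, ((∑ j, |x j|) / √(n : ℝ)) ^ l ∂P ≤ (M / τ) ^ l := by
  obtain ⟨h1, h2⟩ := h.integral_sum_abs_pow_le hn hM hl Finset.univ
  have hs : 0 < √(n : ℝ) := by positivity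
  simp only [div_pow]
  refine ⟨h1.div_const _, ?_⟩
  rw [integral_div, ← div_pow]
  refine (div_le_div_of_nonneg_right h2 (by positivity)).trans ?_
  rw [← div_pow]
  refine pow_le_pow_left₀ (by positivity) ?_ l
  have hsq : √(n : ℝ) * √(n : ℝ) = n := Real.mul_self_sqrt (Nat.cast_nonneg n)
  rw [Finset.card_univ, Fintype.card_fin]
  calc (p : ℝ) * (M / √(n : ℝ)) / √(n : ℝ) = (p : ℝ) / (√(n : ℝ) * √(n : ℝ)) * M := by
        field_simp
    _ ≤ 1 / τ * M := by rw [hsq]; exact mul_le_mul_of_nonneg_right hp hM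
    _ = M / τ := by ring

end Discretization

section Comparison

theorem BoundedDerivs.abs_sub_le {g : ℝ → ℝ} {K : ℝ} (hg : BoundedDerivs g K) (x y : ℝ) :
    |g x - g y| ≤ K * |x - y| := by
  obtain ⟨g₁, _, _, d, _, _, b, _⟩ := hg.exists_derivs
  simpa using (convex_univ (𝕜 := ℝ) (E := ℝ)).norm_image_sub_le_of_norm_hasDerivWithin_le
    (fun s _ => (d s).hasDerivWithinAt) (fun s _ => b s) (mem_univ y) (mem_univ x)

variable {n p d Q : ℕ} {M : ℝ} {Cov : Matrix (Fin p) (Fin p) ℝ} {q : Fin 4 → ℝ}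

/-- A family of smooth nonnegative approximations of the losses, at accuracy `ε`. -/
structure SmoothApprox (q : Fin 4 → ℝ) (ε D : ℝ) (Lℓ : Fin n → ℝ) (ℓ f : Fin n → ℝ → ℝ) :
    Prop where
  q_nonneg : ∀ k, 0 ≤ q k
  one_le_Lℓ : ∀ i, 1 ≤ Lℓ i
  ε_nonneg : 0 ≤ ε
  ε_le : ε ≤ 1
  one_le_D : 1 ≤ D
  growth : ∀ i x, |ℓ i x| / (1 + |x| ^ q 0) ≤ Lℓ i
  close : ∀ i x, |f i x - ℓ i x| ≤ ε
  selfBounded : ∀ i, SelfBounded (f i) D (fun u => 1 + u ^ q 1) (fun u => 1 + u ^ q 2)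
    (fun u => 1 + u ^ q 3)

/-- The constant of `abs_integral_minRisk_sub_softRisk_le`. -/
noncomputable def discConst (q : Fin 4 → ℝ) (A : ℝ) : ℝ :=
  2 * 4 ^ q 1 * (A + A ^ (bq0 q + 1))

/-- Replacing the minimized risk by the soft risk on a net. -/
theorem abs_integral_minRisk_sub_softRisk_le (hn : 0 < n) {τ : ℝ} (hτ : 0 < τ)
    (hp : (p : ℝ) / n ≤ 1 / τ) {ε D : ℝ} {Lℓ : Fin n → ℝ} {ℓ f : Fin n → ℝ → ℝ}
    (hs : SmoothApprox q ε D Lℓ ℓ f) (hℓ : ∀ i, Continuous (ℓ i)) {K : ℝ} {g : ℝ → ℝ}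
    (hg : BoundedDerivs g K) (P : Fin n → Measure (EuclideanSpace ℝ (Fin p)))
    [∀ i, IsProbabilityMeasure (P i)] (hP : ∀ i, RowLaw n Q M Cov (P i)) (hM : 0 ≤ M)
    (hQ : bq0 q + 1 ≤ Q) {κ : Fin n → ℕ} {B : (i : Fin n) → Fin (κ i) → Finset (Fin p)}
    (hB : ∀ i, IsBlockPartition d (B i))
    (hind : ∀ i, iIndepFun
      (fun (a : Fin (κ i)) (x : EuclideanSpace ℝ (Fin p)) (j : B i a) => x j) (P i))
    {R : EuclideanSpace ℝ (Fin p) → ℝ} {S : Set (EuclideanSpace ℝ (Fin p))} {L δ : ℝ}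
    (hL : 1 ≤ L) (hδ0 : 0 < δ) (hδ : δ < omegaN n p d q) (hS : S ⊆ cube p L)
    {W : Finset (EuclideanSpace ℝ (Fin p))} (hWS : ∀ w ∈ W, w ∈ S)
    (hW : W.Nonempty) (hnet : ∀ w ∈ S, ∃ w' ∈ W, ∀ j, |w j - w' j| ≤ δ) {r : ℝ}
    (hR : ∀ w ∈ cube p L, ∀ w' ∈ cube p L, (∀ j, |w j - w' j| ≤ δ) → |R w - R w'| ≤ r)
    {b : ℝ} (hb : 0 < b) (hσ : 0 ≤ sigmaN n p d q) :
    |∫ x, g (minRisk ℓ R S x) ∂(Measure.pi P)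
      - ∫ z, g (softRisk n b f Sigma.fst (fun w : W => R w) z)
        ∂(Measure.pi (fun α : (i : Fin n) × Fin (κ i) =>
          (P α.1).map (blockMap (fun w : W => w.1) (B α.1 α.2))))|
    ≤ K * (ε + r + D * discConst q (M / τ) * (avL q Lℓ * L ^ (bq0 q + 3) * sigmaN n p d q)
      + Real.log W.card / (n * b)) := by
  have hq := hs.q_nonneg
  have hK : 0 ≤ K := (abs_nonneg _).trans (hg.bound 0)
  have hD : 0 ≤ D := zero_le_one.trans hs.one_le_D
  have hn0 : (0 : ℝ) < n := by exact_mod_cast hn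
  set pts : W → EuclideanSpace ℝ (Fin p) := fun w => w.1 with hpts
  set β : (Fin n → EuclideanSpace ℝ (Fin p)) → ((i : Fin n) × Fin (κ i)) → W → ℝ :=
    fun x α => blockMap pts (B α.1 α.2) (x α.1) with hβ
  have hβm : Measurable β := measurable_pi_iff.2 fun α =>
    (measurable_blockMap pts _).comp (measurable_pi_apply α.1)
  have hsoft : Measurable (softRisk n b f (Sigma.fst : ((i : Fin n) × Fin (κ i)) → Fin n)
      (fun w : W => R w)) :=
    measurable_softRisk (fun i => (hs.selfBounded i).continuous.measurable) _ _
  have hgm := hg.continuous.measurable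
  have hgs : Measurable (fun z => g (softRisk n b f
      (Sigma.fst : ((i : Fin n) × Fin (κ i)) → Fin n) (fun w : W => R w) z)) := hgm.comp hsoft
  rw [← map_blocks_pi P B hind pts, integral_map hβm.aemeasurable hgs.aestronglyMeasurable]
  have hbd : ∀ {F : (Fin n → EuclideanSpace ℝ (Fin p)) → ℝ}, Measurable F →
      Integrable (fun x => g (F x)) (Measure.pi P) := fun {F} hF =>
    Integrable.of_bound (hgm.comp hF).aestronglyMeasurable K
      (Filter.Eventually.of_forall fun x => hg.bound _)
  have i1 := hbd (measurable_minRisk hℓ R hS)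
  have i2 := hbd (hsoft.comp hβm)
  simp only [Function.comp_apply] at i2
  rw [← integral_sub i1 i2]
  set U : EuclideanSpace ℝ (Fin p) → ℝ := fun x => (∑ j, |x j|) / √(n : ℝ) with hU
  set C : Fin n → ℝ := fun i => D * (2 * 4 ^ q 1 * Lℓ i ^ q 1) * L ^ (q 0 * q 1)
    * (δ * (n : ℝ) ^ ((q 0 * q 1 + 1) / 2)) with hC
  set Δ : Fin n → EuclideanSpace ℝ (Fin p) → ℝ := fun i x =>
    C i * (U x + U x ^ (bq0 q + 1)) with hΔ
  have ptw : ∀ x, |g (minRisk ℓ R S x) - g (softRisk n b f Sigma.fst (fun w : W => R w) (β x))|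
      ≤ K * (ε + r + Real.log W.card / (n * b)) + ∑ i, K * (1 / (n : ℝ)) * Δ i (x i) := by
    intro x
    refine (hg.abs_sub_le _ _).trans ?_
    have h := abs_minRisk_sub_softRisk_le (row := Sigma.fst) hn hb hs.close hS hWS hW hnet hR
      (A := x) (z := β x) (fun i w => ?_) (Δ := fun i => Δ i (x i)) (fun i w hw w' hw' hc =>
        abs_loss_sub_le hn hq (hs.one_le_Lℓ i) hs.ε_le hD (hs.growth i) (hs.close i)
          (hs.selfBounded i) hL hw hw' hc (x i))
    · refine (mul_le_mul_of_nonneg_left h hK).trans_eq ?_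
      rw [← Finset.mul_sum]
      ring
    · rw [sum_filter_sigma_fst (fun α => β x α w) i]
      exact (hB i).sum_sum (fun j => x i j * w.1 j)
  have hmp : ∀ i, MeasurePreserving (fun x : Fin n → EuclideanSpace ℝ (Fin p) => x i)
      (Measure.pi P) (P i) := fun i => measurePreserving_eval P i
  have hU1 : ∀ i, Integrable U (P i) ∧ ∫ x, U x ∂(P i) ≤ M / τ := fun i => by
    have := (hP i).integral_scaled_l1_le hn hM hp (l := 1) (by omega)
    simpa only [pow_one] using this
  have hU2 := fun i => (hP i).integral_scaled_l1_le hn hM hp (l := bq0 q + 1) hQ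
  have iΔ : ∀ i, Integrable (Δ i) (P i) := fun i => ((hU1 i).1.add (hU2 i).1).const_mul (C i)
  have hC0 : ∀ i, 0 ≤ C i := fun i => by
    have := hs.one_le_Lℓ i
    positivity
  have bΔ : ∀ i, ∫ x, Δ i x ∂(P i) ≤ D * discConst q (M / τ) * (Lℓ i ^ bq q * L ^ (bq0 q + 3)
      * sigmaN n p d q) := fun i => by
    have e : ∫ x, Δ i x ∂(P i) = C i * (∫ x, U x ∂(P i) + ∫ x, U x ^ (bq0 q + 1) ∂(P i)) := by
      rw [← integral_add (hU1 i).1 (hU2 i).1, ← integral_const_mul]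
    rw [e]
    have h1 := mul_le_mul_of_nonneg_left (add_le_add (hU1 i).2 (hU2 i).2) (hC0 i)
    refine h1.trans ?_
    have hA : 0 ≤ M / τ + (M / τ) ^ (bq0 q + 1) := by positivity
    have c1 : Lℓ i ^ q 1 ≤ Lℓ i ^ bq q :=
      Real.rpow_le_rpow_of_exponent_le (hs.one_le_Lℓ i) (le_bq_one hq)
    have c2 : L ^ (q 0 * q 1) ≤ L ^ (bq0 q + 3) := by
      rw [← Real.rpow_natCast]
      refine Real.rpow_le_rpow_of_exponent_le hL ?_
      have := (mul_le_mul_of_nonneg_left (le_bq_one hq) (hq 0)).trans (mul_bq_le_bq0 q)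
      push_cast
      linarith
    have c3 := mul_rpow_le_of_lt_omegaN hn hδ hσ
    have hl := hs.one_le_Lℓ i
    calc C i * (M / τ + (M / τ) ^ (bq0 q + 1))
        ≤ D * (2 * 4 ^ q 1 * Lℓ i ^ bq q) * L ^ (bq0 q + 3) * sigmaN n p d q
          * (M / τ + (M / τ) ^ (bq0 q + 1)) := by
          simp only [hC]
          gcongr
      _ = _ := by unfold discConst; ring
  have iΔ' : ∀ i, Integrable (fun x : Fin n → EuclideanSpace ℝ (Fin p) =>
      K * (1 / (n : ℝ)) * Δ i (x i)) (Measure.pi P) := fun i =>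
    ((hmp i).integrable_comp_of_integrable (iΔ i)).const_mul _
  have eΔ : ∀ i, ∫ x, K * (1 / (n : ℝ)) * Δ i (x i) ∂(Measure.pi P)
      = K * (1 / (n : ℝ)) * ∫ x, Δ i x ∂(P i) := fun i => by
    rw [integral_const_mul, ← (hmp i).map_eq, integral_map (hmp i).measurable.aemeasurable
      ((hmp i).map_eq.symm ▸ (iΔ i).1)]
  have iS := integrable_finsetSum Finset.univ fun i _ => iΔ' i
  have ic : Integrable (fun _ : Fin n → EuclideanSpace ℝ (Fin p) =>
      K * (ε + r + Real.log W.card / (n * b))) (Measure.pi P) := integrable_const _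
  refine (abs_integral_le_integral_abs).trans
    ((integral_mono (i1.sub i2).abs (ic.add iS) ptw).trans ?_)
  have e := integral_add ic iS
  simp only [Pi.add_apply] at e ⊢
  rw [e, integral_finsetSum _ fun i _ => iΔ' i]
  simp only [eΔ, integral_const, probReal_univ, one_smul]
  have hsum : ∑ i, K * (1 / (n : ℝ)) * ∫ x, Δ i x ∂(P i)
      ≤ K * (D * discConst q (M / τ) * (avL q Lℓ * L ^ (bq0 q + 3) * sigmaN n p d q)) := by
    refine (Finset.sum_le_sum fun i _ => mul_le_mul_of_nonneg_left (bΔ i)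
      (by positivity : 0 ≤ K * (1 / (n : ℝ)))).trans_eq ?_
    rw [← Finset.mul_sum, ← Finset.mul_sum, ← Finset.sum_mul, ← Finset.sum_mul]
    unfold avL
    ring
  linarith

/-- The variance proxy, up to the factor `L²`. -/
noncomputable def varConst (τ M₀ M : ℝ) : ℝ := (M₀ + M ^ 2) / τ ^ 2

/-- The constant of `abs_integral_softRisk_blocks_sub_le`. -/
noncomputable def lindebergConst (q : Fin 4 → ℝ) (τ M₀ M : ℝ) : ℝ :=
  23 * (16 * 4 ^ bq q * 2 ^ bq0 q)
    * (2 * (1 + momentConst (bq0 q / 2) * varConst τ M₀ M ^ (bq0 q / 2)) * M ^ 3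
      + 2 * M ^ (bq0 q + 3))

/-- Universality of the soft risk for rows with independent blocks. -/
theorem abs_integral_softRisk_blocks_sub_le (hn : 0 < n) {τ : ℝ} (hτ : τ ∈ Ioo (0 : ℝ) 1)
    (hp : (p : ℝ) / n ≤ 1 / τ) (hd1 : 1 ≤ d) (hd : (d : ℝ) ^ 4 ≤ n / τ ^ 2) {ε D : ℝ}
    {Lℓ : Fin n → ℝ} {ℓ f : Fin n → ℝ → ℝ} (hs : SmoothApprox q ε D Lℓ ℓ f) {K : ℝ} {g : ℝ → ℝ}
    (hg : BoundedDerivs g K) (P P' : Fin n → Measure (EuclideanSpace ℝ (Fin p)))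
    [∀ i, IsProbabilityMeasure (P i)] [∀ i, IsProbabilityMeasure (P' i)]
    (hP : ∀ i, RowLaw n Q M Cov (P i)) (hP' : ∀ i, RowLaw n Q M Cov (P' i)) (hM : 0 ≤ M)
    (hQ : bq0 q + 3 ≤ Q) {M₀ : ℝ} (hM₀ : 0 ≤ M₀)
    (hCov : ∀ x : Fin p → ℝ, ∑ j, ∑ k, x j * x k * Cov j k ≤ M₀ * ∑ j, x j ^ 2)
    {κ : Fin n → ℕ} {B : (i : Fin n) → Fin (κ i) → Finset (Fin p)}
    (hB : ∀ i, IsBlockPartition d (B i)) {W : Type*} [Fintype W] [Nonempty W]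
    {pts : W → EuclideanSpace ℝ (Fin p)} {L : ℝ} (hL : 1 ≤ L) (hpts : ∀ w, pts w ∈ cube p L)
    (R : W → ℝ) {b : ℝ} (hb : 1 ≤ b) :
    |∫ z, g (softRisk n b f Sigma.fst R z) ∂(Measure.pi (fun α : (i : Fin n) × Fin (κ i) =>
          (P α.1).map (blockMap pts (B α.1 α.2))))
      - ∫ z, g (softRisk n b f Sigma.fst R z) ∂(Measure.pi (fun α : (i : Fin n) × Fin (κ i) =>
          (P' α.1).map (blockMap pts (B α.1 α.2))))|
    ≤ K * (lindebergConst q τ M₀ M * b ^ 2 * D ^ 3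
      * (avL q Lℓ * L ^ (bq0 q + 3) * sigmaN n p d q)) := by
  have hq := hs.q_nonneg
  have hK : 0 ≤ K := (abs_nonneg _).trans (hg.bound 0)
  have hD : 0 ≤ D := zero_le_one.trans hs.one_le_D
  have hn0 : (0 : ℝ) < n := by exact_mod_cast hn
  have hsn : 0 < √(n : ℝ) := by positivity
  have hsq : √(n : ℝ) ^ 2 = n := Real.sq_sqrt hn0.le
  have hL0 : 0 ≤ L := by linarith
  have hτ0 := hτ.1
  obtain ⟨J, hJ⟩ : ∃ J, bq0 q = 2 * J := ⟨_, rfl⟩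
  have hJ2 : bq0 q / 2 = J := by omega
  set s : ((i : Fin n) × Fin (κ i)) → ℝ := fun α =>
    L * ((B α.1 α.2).card * (M / √(n : ℝ))) with hsdef
  set v : ((i : Fin n) × Fin (κ i)) → ℝ := fun α => M₀ * L ^ 2 * (B α.1 α.2).card / n with hvdef
  set V : ℝ := L ^ 2 * varConst τ M₀ M with hV
  have hvc : 0 ≤ varConst τ M₀ M := by unfold varConst; positivity
  have hV0 : 0 ≤ V := by positivity
  have ssum : ∀ i l, ∑ a, s ⟨i, a⟩ ^ (l + 1) ≤ L ^ (l + 1) * M ^ (l + 1)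
      * ((p : ℝ) * (d : ℝ) ^ l / √(n : ℝ) ^ (l + 1)) := fun i l => by
    have e : ∀ a, s ⟨i, a⟩ ^ (l + 1) = L ^ (l + 1) * M ^ (l + 1) / √(n : ℝ) ^ (l + 1)
        * ((B i a).card : ℝ) ^ (l + 1) := fun a => by
      simp only [hsdef]
      rw [mul_pow, mul_pow, div_pow]
      ring
    simp only [e]
    rw [← Finset.mul_sum]
    refine (mul_le_mul_of_nonneg_left ((hB i).sum_card_pow_le l) (by positivity)).trans_eq ?_
    ring
  have hpm : ∀ (P : Fin n → Measure (EuclideanSpace ℝ (Fin p))) [∀ i, IsProbabilityMeasure (P i)]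
      (α : (i : Fin n) × Fin (κ i)),
      IsProbabilityMeasure ((P α.1).map (blockMap pts (B α.1 α.2))) := fun P _ α =>
    Measure.isProbabilityMeasure_map (measurable_blockMap pts _).aemeasurable
  have i1 := hpm P
  have i2 := hpm P'
  have hvV : ∀ i, ∑ α with Sigma.fst α = i, v α ≤ V := fun i => by
    rw [sum_filter_sigma_fst]
    simp only [hvdef]
    rw [← Finset.sum_div, ← Finset.mul_sum, (hB i).sum_card, hV, varConst]
    have h1 : M₀ * L ^ 2 * (p : ℝ) / n = M₀ * L ^ 2 * ((p : ℝ) / n) := by ring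
    rw [h1]
    have h2 : (1 : ℝ) / τ ≤ 1 / τ ^ 2 :=
      one_div_le_one_div_of_le (by positivity) (by nlinarith [hτ.2])
    calc M₀ * L ^ 2 * ((p : ℝ) / n) ≤ M₀ * L ^ 2 * (1 / τ ^ 2) :=
          mul_le_mul_of_nonneg_left (hp.trans h2) (by positivity)
      _ = L ^ 2 * (M₀ / τ ^ 2) := by ring
      _ ≤ _ := by gcongr; linarith [sq_nonneg M]
  have hsV : ∀ i j, 2 ≤ j → j ≤ J → ∑ α with Sigma.fst α = i, s α ^ (2 * j) ≤ V ^ j := by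
    intro i j hj _
    rw [sum_filter_sigma_fst (fun α => s α ^ (2 * j))]
    obtain ⟨l, rfl⟩ : ∃ l, j = l + 1 := ⟨j - 1, by omega⟩
    have h1 := ssum i (2 * l + 1)
    have e1 : 2 * l + 1 + 1 = 2 * (l + 1) := by ring
    rw [e1] at h1
    refine h1.trans ?_
    have hd1' : (1 : ℝ) ≤ d := by exact_mod_cast hd1
    have h2 : (d : ℝ) ^ (2 * l + 1) ≤ (n / τ ^ 2) ^ l := by
      refine (pow_le_pow_right₀ hd1' (by omega : 2 * l + 1 ≤ 4 * l)).trans ?_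
      rw [pow_mul]
      exact pow_le_pow_left₀ (by positivity) hd l
    have h3 : (p : ℝ) ≤ n / τ := by
      rw [div_le_iff₀ hn0] at hp
      refine hp.trans_eq (by ring)
    have h4 : (p : ℝ) * (d : ℝ) ^ (2 * l + 1) / √(n : ℝ) ^ (2 * (l + 1)) ≤ (1 / τ ^ 2) ^ (l + 1) := by
      rw [pow_mul, hsq, div_le_iff₀ (by positivity)]
      calc (p : ℝ) * (d : ℝ) ^ (2 * l + 1) ≤ n / τ * (n / τ ^ 2) ^ l :=
            mul_le_mul h3 h2 (by positivity) (by positivity)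
        _ ≤ n / τ ^ 2 * (n / τ ^ 2) ^ l := by
            gcongr
            nlinarith [hτ.2]
        _ = _ := by
            rw [← pow_succ', ← mul_pow]
            congr 1
            ring
    calc L ^ (2 * (l + 1)) * M ^ (2 * (l + 1))
          * ((p : ℝ) * (d : ℝ) ^ (2 * l + 1) / √(n : ℝ) ^ (2 * (l + 1)))
        ≤ L ^ (2 * (l + 1)) * M ^ (2 * (l + 1)) * (1 / τ ^ 2) ^ (l + 1) :=
          mul_le_mul_of_nonneg_left h4 (by positivity)
      _ = (L ^ 2 * (M ^ 2 / τ ^ 2)) ^ (l + 1) := by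
          rw [pow_mul, pow_mul, ← mul_pow, ← mul_pow]
          congr 1
          ring
      _ ≤ V ^ (l + 1) := by
          rw [hV, varConst]
          gcongr
          linarith
  have main := abs_integral_softRisk_pi_sub_le (N := n) (by exact_mod_cast hn) hb hs.one_le_D hg
    (dominatedWeights_rpow hq) hs.selfBounded (Sigma.fst : ((i : Fin n) × Fin (κ i)) → Fin n) R
    (fun α => (P α.1).map (blockMap pts (B α.1 α.2)))
    (fun α => (P' α.1).map (blockMap pts (B α.1 α.2))) (J := J) (s := s) (v := v)
    (fun α => (hP α.1).blockLaw hn hM (by omega) hM₀ hCov hL0 hpts _)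
    (fun α => (hP' α.1).blockLaw hn hM (by omega) hM₀ hCov hL0 hpts _)
    (fun α w w' => by
      rw [(hP α.1).integral_blockMap_mul hn (by omega), (hP' α.1).integral_blockMap_mul hn
        (by omega)])
    (Λ := fun i => 16 * 4 ^ bq q * 2 ^ bq0 q * Lℓ i ^ bq q)
    (fun i => by have := hs.one_le_Lℓ i; positivity)
    (fun i r y t ht => by
      rw [← hJ]
      exact weight_growth_le hq (hs.one_le_Lℓ i) hs.ε_le (hs.growth i) (hs.close i)
        (hs.selfBounded i).nonneg ht)
    hV0 hvV hsV
  refine main.trans ?_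
  rw [Fintype.sum_sigma]
  have hmc : 0 ≤ momentConst J := zero_le_one.trans (one_le_momentConst J)
  set E : ℝ := (2 * (1 + momentConst J * varConst τ M₀ M ^ J) * M ^ 3 + 2 * M ^ (bq0 q + 3))
    * (L ^ (bq0 q + 3) * sigmaN n p d q) with hE
  have hσ0 : 0 ≤ sigmaN n p d q := le_trans (by positivity) (le_sigmaN_cube n p d q)
  have inner : ∀ i, ∑ a, ((1 + momentConst J * V ^ J) * (2 * s ⟨i, a⟩ ^ 3)
      + 2 * s ⟨i, a⟩ ^ (2 * J + 3)) ≤ E := fun i => by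
    rw [Finset.sum_add_distrib, ← Finset.mul_sum, ← Finset.mul_sum, ← Finset.mul_sum]
    have s3 : ∑ a, s ⟨i, a⟩ ^ 3 ≤ L ^ 3 * M ^ 3 * sigmaN n p d q :=
      (ssum i 2).trans (mul_le_mul_of_nonneg_left (le_sigmaN_cube n p d q) (by positivity))
    have sk : ∑ a, s ⟨i, a⟩ ^ (2 * J + 3) ≤ L ^ (bq0 q + 3) * M ^ (bq0 q + 3) * sigmaN n p d q := by
      rw [← hJ]
      exact (ssum i (bq0 q + 2)).trans (mul_le_mul_of_nonneg_left (le_sigmaN_pow n p d q)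
        (by positivity))
    have hVJ : (1 + momentConst J * V ^ J) * L ^ 3
        ≤ (1 + momentConst J * varConst τ M₀ M ^ J) * L ^ (bq0 q + 3) := by
      have hk : (1 : ℝ) ≤ L ^ bq0 q := one_le_pow₀ hL
      have e : V ^ J = L ^ bq0 q * varConst τ M₀ M ^ J := by
        rw [hV, mul_pow, hJ, pow_mul]
      rw [e, pow_add]
      have h0 : 0 ≤ L ^ 3 := by positivity
      have : 1 + momentConst J * (L ^ bq0 q * varConst τ M₀ M ^ J)
          ≤ (1 + momentConst J * varConst τ M₀ M ^ J) * L ^ bq0 q := by nlinarith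
      nlinarith [mul_le_mul_of_nonneg_right this h0]
    calc (1 + momentConst J * V ^ J) * (2 * ∑ a, s ⟨i, a⟩ ^ 3) + 2 * ∑ a, s ⟨i, a⟩ ^ (2 * J + 3)
        ≤ (1 + momentConst J * V ^ J) * (2 * (L ^ 3 * M ^ 3 * sigmaN n p d q))
          + 2 * (L ^ (bq0 q + 3) * M ^ (bq0 q + 3) * sigmaN n p d q) := by gcongr
      _ = ((1 + momentConst J * V ^ J) * L ^ 3) * (2 * M ^ 3 * sigmaN n p d q)
          + 2 * (L ^ (bq0 q + 3) * M ^ (bq0 q + 3) * sigmaN n p d q) := by ring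
      _ ≤ ((1 + momentConst J * varConst τ M₀ M ^ J) * L ^ (bq0 q + 3))
          * (2 * M ^ 3 * sigmaN n p d q)
          + 2 * (L ^ (bq0 q + 3) * M ^ (bq0 q + 3) * sigmaN n p d q) := by gcongr
      _ = E := by rw [hE]; ring
  have hcoef : ∀ i, 0 ≤ 23 * K * b ^ 2 * D ^ 3 / n * (16 * 4 ^ bq q * 2 ^ bq0 q * Lℓ i ^ bq q) :=
    fun i => by have := hs.one_le_Lℓ i; positivity
  calc _ ≤ ∑ i, 23 * K * b ^ 2 * D ^ 3 / n * (16 * 4 ^ bq q * 2 ^ bq0 q * Lℓ i ^ bq q) * E :=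
        Finset.sum_le_sum fun i _ => by
          refine le_trans (le_of_eq ?_) (mul_le_mul_of_nonneg_left (inner i) (hcoef i))
          rw [Finset.mul_sum]
    _ = K * (lindebergConst q τ M₀ M * b ^ 2 * D ^ 3
      * (avL q Lℓ * L ^ (bq0 q + 3) * sigmaN n p d q)) := by
        rw [← Finset.sum_mul, ← Finset.mul_sum, ← Finset.mul_sum, hE, lindebergConst, avL, hJ2]
        ring

end Comparison

section MainEstimate

variable {n p d Q : ℕ} {M : ℝ} {Cov : Matrix (Fin p) (Fin p) ℝ} {q : Fin 4 → ℝ}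

theorem discConst_nonneg {A : ℝ} (hA : 0 ≤ A) : 0 ≤ discConst q A := by
  unfold discConst; positivity

theorem lindebergConst_nonneg {τ M₀ : ℝ} (hM₀ : 0 ≤ M₀) (hM : 0 ≤ M) :
    0 ≤ lindebergConst q τ M₀ M := by
  have h1 := one_le_momentConst (bq0 q / 2)
  have h2 : 0 ≤ varConst τ M₀ M := by unfold varConst; positivity
  unfold lindebergConst
  positivity

/-- The constant of the universality bound. -/
noncomputable def univConst (q : Fin 4 → ℝ) (τ M₀ M : ℝ) : ℝ :=
  2 + 2 * discConst q (M / τ) + 6 / τ + lindebergConst q τ M₀ M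

theorem univConst_pos {τ M₀ : ℝ} (hτ : 0 < τ) (hM₀ : 0 ≤ M₀) (hM : 0 ≤ M) :
    0 < univConst q τ M₀ M := by
  have h1 := discConst_nonneg (q := q) (div_nonneg hM hτ.le : 0 ≤ M / τ)
  have h2 := lindebergConst_nonneg (q := q) (τ := τ) hM₀ hM
  unfold univConst
  positivity

/-- The choice of the inverse temperature. -/
theorem exists_inverse_temperature {T l : ℝ} (hT0 : 0 < T) (hT : T ≤ 1) (hl : 1 ≤ l) :
    ∃ b : ℝ, 1 ≤ b ∧ l / b = T ^ (1 / 3 : ℝ) * l ^ (2 / 3 : ℝ) ∧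
      b ^ 2 * T = T ^ (1 / 3 : ℝ) * l ^ (2 / 3 : ℝ) ∧ T ≤ T ^ (1 / 3 : ℝ) * l ^ (2 / 3 : ℝ) := by
  have hl0 : 0 < l := by linarith
  have ht : T = T ^ (1 / 3 : ℝ) * T ^ (2 / 3 : ℝ) := by
    rw [← Real.rpow_add hT0]; norm_num
  have hll : l = l ^ (1 / 3 : ℝ) * l ^ (2 / 3 : ℝ) := by
    rw [← Real.rpow_add hl0]; norm_num
  have h1 : 0 < T ^ (1 / 3 : ℝ) := Real.rpow_pos_of_pos hT0 _
  have h2 : 0 < l ^ (1 / 3 : ℝ) := Real.rpow_pos_of_pos hl0 _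
  have e2T : T ^ (2 / 3 : ℝ) = (T ^ (1 / 3 : ℝ)) ^ 2 := by
    rw [← Real.rpow_natCast, ← Real.rpow_mul hT0.le]; norm_num
  have e2l : l ^ (2 / 3 : ℝ) = (l ^ (1 / 3 : ℝ)) ^ 2 := by
    rw [← Real.rpow_natCast, ← Real.rpow_mul hl0.le]; norm_num
  have hT1 : T ^ (1 / 3 : ℝ) ≤ 1 := Real.rpow_le_one hT0.le hT (by norm_num)
  have hl1 : 1 ≤ l ^ (1 / 3 : ℝ) := Real.one_le_rpow hl (by norm_num)
  refine ⟨l ^ (1 / 3 : ℝ) / T ^ (1 / 3 : ℝ), ?_, ?_, ?_, ?_⟩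
  · rw [one_le_div h1]; linarith
  · nth_rewrite 1 [hll]
    field_simp
  · nth_rewrite 2 [ht]
    rw [e2T, e2l]
    field_simp
  · nth_rewrite 1 [ht]
    refine mul_le_mul_of_nonneg_left ?_ h1.le
    rw [e2T, e2l]
    exact pow_le_pow_left₀ h1.le (hT1.trans hl1) 2

theorem rpow_rate_eq {A L σ : ℝ} (hA : 0 ≤ A) (hL : 0 ≤ L) (hσ : 0 ≤ σ) (k : ℕ) (x : ℝ) :
    A ^ (1 / 3 : ℝ) * L ^ (((k : ℝ) + 3) / 3) * x * σ ^ (1 / 3 : ℝ)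
      = (A * L ^ (k + 3) * σ) ^ (1 / 3 : ℝ) * x := by
  rw [Real.mul_rpow (by positivity) hσ, Real.mul_rpow hA (by positivity), ← Real.rpow_natCast L,
    ← Real.rpow_mul hL]
  push_cast
  rw [mul_one_div]
  ring

/-- **Universality of the minimized risk** for product laws with matching moments. -/
theorem abs_integral_minRisk_sub_le (hn : 0 < n) {τ : ℝ} (hτ : τ ∈ Ioo (0 : ℝ) 1)
    (hp' : τ ≤ (p : ℝ) / n) (hp : (p : ℝ) / n ≤ 1 / τ) {ε D : ℝ}
    {Lℓ : Fin n → ℝ} {ℓ f : Fin n → ℝ → ℝ} (hs : SmoothApprox q ε D Lℓ ℓ f)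
    (hℓ : ∀ i, Continuous (ℓ i)) {K : ℝ} {g : ℝ → ℝ}
    (hg : BoundedDerivs g K) (P P' : Fin n → Measure (EuclideanSpace ℝ (Fin p)))
    [∀ i, IsProbabilityMeasure (P i)] [∀ i, IsProbabilityMeasure (P' i)]
    (hP : ∀ i, RowLaw n Q M Cov (P i)) (hP' : ∀ i, RowLaw n Q M Cov (P' i)) (hM : 0 ≤ M)
    (hQ : bq0 q + 3 ≤ Q) {M₀ : ℝ} (hM₀ : 0 ≤ M₀)
    (hCov : ∀ x : Fin p → ℝ, ∑ j, ∑ k, x j * x k * Cov j k ≤ M₀ * ∑ j, x j ^ 2)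
    {κ : Fin n → ℕ} {B : (i : Fin n) → Fin (κ i) → Finset (Fin p)}
    (hB : ∀ i, IsBlockPartition d (B i))
    (hind : ∀ i, iIndepFun
      (fun (a : Fin (κ i)) (x : EuclideanSpace ℝ (Fin p)) (j : B i a) => x j) (P i))
    (hind' : ∀ i, iIndepFun
      (fun (a : Fin (κ i)) (x : EuclideanSpace ℝ (Fin p)) (j : B i a) => x j) (P' i))
    {R : EuclideanSpace ℝ (Fin p) → ℝ} {S : Set (EuclideanSpace ℝ (Fin p))} {L δ : ℝ}
    (hL : 1 ≤ L) (hδ : δ ∈ Ioo 0 (omegaN n p d q)) (hS : S ⊆ cube p L) (hne : S.Nonempty) {r : ℝ}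
    (hr : 0 ≤ r)
    (hR : ∀ w ∈ cube p L, ∀ w' ∈ cube p L, (∀ j, |w j - w' j| ≤ δ) → |R w - R w'| ≤ r) :
    |∫ x, g (minRisk ℓ R S x) ∂(Measure.pi P) - ∫ x, g (minRisk ℓ R S x) ∂(Measure.pi P')|
    ≤ univConst q τ M₀ M * K * (ε + D ^ 3 * (r + avL q Lℓ ^ (1 / 3 : ℝ)
      * L ^ (((bq0 q : ℝ) + 3) / 3) * logPlus (L / δ) ^ (2 / 3 : ℝ)
      * sigmaN n p d q ^ (1 / 3 : ℝ))) := by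
  have hq := hs.q_nonneg
  have hn0 : (0 : ℝ) < n := by exact_mod_cast hn
  have hτ0 := hτ.1
  have hp0 : 0 < p := by
    rcases Nat.eq_zero_or_pos p with h | h
    · rw [h] at hp'; simp at hp'; linarith
    · exact h
  have hd1 : 1 ≤ d := (hB ⟨0, hn⟩).one_le hp0
  have hσ := sigmaN_pos (q := q) hn hp0 hd1
  have hav := one_le_avL hn hq hs.one_le_Lℓ
  have hK : 0 ≤ K := (abs_nonneg _).trans (hg.bound 0)
  have hD1 := hs.one_le_D
  have hD3 : 1 ≤ D ^ 3 := one_le_pow₀ hD1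
  have hLk : 1 ≤ L ^ (bq0 q + 3) := one_le_pow₀ hL
  set l := logPlus (L / δ) with hl
  have hl1 : 1 ≤ l := le_max_left _ _
  have hl23 : 1 ≤ l ^ (2 / 3 : ℝ) := Real.one_le_rpow hl1 (by norm_num)
  rw [rpow_rate_eq (by linarith) (by linarith) hσ.le]
  set T := avL q Lℓ * L ^ (bq0 q + 3) * sigmaN n p d q with hT
  have hT0 : 0 < T := by positivity
  have hCd := discConst_nonneg (q := q) (div_nonneg hM hτ0.le : 0 ≤ M / τ)
  have hCl := lindebergConst_nonneg (q := q) (τ := τ) hM₀ hM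
  have h6 : 0 < 6 / τ := by positivity
  rcases le_or_gt 1 T with h1 | h1
  · have hT3 : 1 ≤ T ^ (1 / 3 : ℝ) * l ^ (2 / 3 : ℝ) :=
      one_le_mul_of_one_le_of_one_le (Real.one_le_rpow h1 (by norm_num)) hl23
    have hb : ∀ (P : Fin n → Measure (EuclideanSpace ℝ (Fin p)))
        [∀ i, IsProbabilityMeasure (P i)], |∫ x, g (minRisk ℓ R S x) ∂(Measure.pi P)| ≤ K :=
      fun P _ => by
        have := norm_integral_le_of_norm_le_const (μ := Measure.pi P) (C := K)
          (f := fun x => g (minRisk ℓ R S x))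
          (Filter.Eventually.of_forall fun x => (hg.bound (minRisk ℓ R S x)))
        simpa using this
    have e1 := hb P
    have e2 := hb P'
    have e3 : |∫ x, g (minRisk ℓ R S x) ∂(Measure.pi P) - ∫ x, g (minRisk ℓ R S x) ∂(Measure.pi P')|
        ≤ 2 * K := (abs_sub _ _).trans (by linarith)
    refine e3.trans ?_
    have hX : 1 ≤ ε + D ^ 3 * (r + T ^ (1 / 3 : ℝ) * l ^ (2 / 3 : ℝ)) := by
      have := hs.ε_nonneg
      nlinarith
    have hC : 2 ≤ univConst q τ M₀ M := by unfold univConst; linarith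
    calc 2 * K ≤ univConst q τ M₀ M * K := mul_le_mul_of_nonneg_right hC hK
      _ ≤ _ := le_mul_of_one_le_right (by positivity) hX
  · have hσ1 : sigmaN n p d q ≤ 1 := by
      have : 1 ≤ avL q Lℓ * L ^ (bq0 q + 3) := one_le_mul_of_one_le_of_one_le hav hLk
      nlinarith
    have hd4 := pow_four_le_of_sigmaN_le_one (d := d) (q := q) hn hτ0 hp' hσ1
    have hδL : δ ≤ L := hδ.2.le.trans ((omegaN_le hn hp0 hd1 hq).trans (hσ1.trans hL))
    obtain ⟨W, hWS, hW, hcard, hnet⟩ := exists_finset_net hδ.1 hδL hS hne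
    obtain ⟨b, hb1, b2, b3, b4⟩ := exists_inverse_temperature hT0 h1.le hl1
    have hb0 : 0 < b := by linarith
    have : Nonempty W := hW.to_subtype
    set Y := T ^ (1 / 3 : ℝ) * l ^ (2 / 3 : ℝ) with hY
    have hY0 : 0 ≤ Y := by positivity
    have k1 := abs_integral_minRisk_sub_softRisk_le hn hτ0 hp hs hℓ hg P hP hM (by omega) hB hind hL
      hδ.1 hδ.2 hS hWS hW hnet hR hb0 hσ.le
    have k2 := abs_integral_minRisk_sub_softRisk_le hn hτ0 hp hs hℓ hg P' hP' hM (by omega) hB hind'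
      hL hδ.1 hδ.2 hS hWS hW hnet hR hb0 hσ.le
    have k3 := abs_integral_softRisk_blocks_sub_le hn hτ hp hd1 hd4 hs hg P P' hP hP' hM hQ hM₀ hCov
      hB hL (pts := fun w : W => w.1) (fun w => hS (hWS _ w.2)) (fun w => R w) hb1
    have hlog : Real.log W.card / (n * b) ≤ 3 / τ * Y := by
      have h := log_card_net_le hδ.1 hδL hW.card_pos hcard
      calc Real.log W.card / (n * b) ≤ p * (3 * l) / (n * b) :=
            div_le_div_of_nonneg_right h (by positivity)
        _ = 3 * ((p : ℝ) / n) * (l / b) := by field_simp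
        _ ≤ 3 * (1 / τ) * (l / b) := by gcongr
        _ = 3 / τ * Y := by rw [b2]; ring
    have hA : |∫ x, g (minRisk ℓ R S x) ∂(Measure.pi P)
        - ∫ x, g (minRisk ℓ R S x) ∂(Measure.pi P')|
        ≤ 2 * (K * (ε + r + D * discConst q (M / τ) * T + Real.log W.card / (n * b)))
          + K * (lindebergConst q τ M₀ M * b ^ 2 * D ^ 3 * T) := by
      rw [abs_le] at k1 k2 k3 ⊢
      constructor <;> linarith [k1.1, k1.2, k2.1, k2.2, k3.1, k3.2]
    refine hA.trans ?_
    have t1 : D * discConst q (M / τ) * T ≤ D ^ 3 * (discConst q (M / τ) * Y) := by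
      have hDD : D ≤ D ^ 3 := le_self_pow₀ hD1 (by norm_num)
      calc D * discConst q (M / τ) * T ≤ D ^ 3 * discConst q (M / τ) * Y := by gcongr
        _ = _ := by ring
    have t2 : lindebergConst q τ M₀ M * b ^ 2 * D ^ 3 * T
        = D ^ 3 * (lindebergConst q τ M₀ M * Y) := by rw [← b3]; ring
    have t3 : 3 / τ * Y ≤ D ^ 3 * (3 / τ * Y) := le_mul_of_one_le_left (by positivity) hD3
    have t4 : r ≤ D ^ 3 * r := le_mul_of_one_le_left hr hD3
    rw [t2]
    have hε := hs.ε_nonneg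
    have hE : 2 * (ε + r + D * discConst q (M / τ) * T + Real.log W.card / (n * b))
        + D ^ 3 * (lindebergConst q τ M₀ M * Y)
        ≤ univConst q τ M₀ M * (ε + D ^ 3 * (r + Y)) := by
      have u1 : 0 ≤ (univConst q τ M₀ M - 2) * (ε + D ^ 3 * r) :=
        mul_nonneg (by unfold univConst; linarith) (by positivity)
      have u2 : 0 ≤ 2 * (D ^ 3 * Y) := by positivity
      have e : univConst q τ M₀ M * (ε + D ^ 3 * (r + Y))
          = (univConst q τ M₀ M - 2) * (ε + D ^ 3 * r) + 2 * (ε + D ^ 3 * r)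
            + univConst q τ M₀ M * (D ^ 3 * Y) := by ring
      have e' : univConst q τ M₀ M * (D ^ 3 * Y) = 2 * (D ^ 3 * Y)
          + 2 * (D ^ 3 * (discConst q (M / τ) * Y)) + 2 * (D ^ 3 * (3 / τ * Y))
            + D ^ 3 * (lindebergConst q τ M₀ M * Y) := by unfold univConst; ring
      rw [e, e']
      linarith
    calc _ = K * (2 * (ε + r + D * discConst q (M / τ) * T + Real.log W.card / (n * b))
        + D ^ 3 * (lindebergConst q τ M₀ M * Y)) := by ring
      _ ≤ K * (univConst q τ M₀ M * (ε + D ^ 3 * (r + Y))) := mul_le_mul_of_nonneg_left hE hK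
      _ = _ := by ring

end MainEstimate

section SmoothStep

theorem exists_abs_iteratedDeriv_smoothTransition_le :
    ∃ A : ℝ, 0 ≤ A ∧ ∀ (k : Fin 4) (x : ℝ), |iteratedDeriv k Real.smoothTransition x| ≤ A := by
  have hk : ∀ k : ℕ, ∃ A : ℝ, 0 ≤ A ∧ ∀ x, |iteratedDeriv k Real.smoothTransition x| ≤ A := by
    intro k
    have hc : Continuous (iteratedDeriv k Real.smoothTransition) :=
      (Real.smoothTransition.contDiff (n := k)).continuous_iteratedDeriv k le_rfl
    obtain ⟨A, hA⟩ := isCompact_Icc.exists_bound_of_continuousOn (s := Icc (0 : ℝ) 1)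
      hc.continuousOn
    have hconst : ∀ (c x : ℝ), |c| ≤ 1 → Real.smoothTransition =ᶠ[nhds x] (fun _ => c) →
        |iteratedDeriv k Real.smoothTransition x| ≤ max A 1 := fun c x hc h => by
      rw [(h.iteratedDeriv k).eq_of_nhds, iteratedDeriv_const]
      split_ifs
      · exact hc.trans (le_max_right _ _)
      · simp
    refine ⟨max A 1, by positivity, fun x => ?_⟩
    rcases lt_or_ge x 0 with h0 | h0
    · refine hconst 0 x (by simp) ?_
      filter_upwards [gt_mem_nhds h0] with y hy using Real.smoothTransition.zero_of_nonpos hy.le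
    · rcases lt_or_ge 1 x with h1 | h1
      · refine hconst 1 x (by simp) ?_
        filter_upwards [lt_mem_nhds h1] with y hy using Real.smoothTransition.one_of_one_le hy.le
      · exact (hA x ⟨h0, h1⟩).trans (le_max_left _ _)
  choose A hA0 hA using hk
  refine ⟨∑ k : Fin 4, A k, Finset.sum_nonneg fun k _ => hA0 k, fun k x => (hA k x).trans ?_⟩
  exact Finset.single_le_sum (f := fun k : Fin 4 => A k) (fun k _ => hA0 k) (Finset.mem_univ k)

/-- A smooth step from `0` on `(-∞, z + ε]` to `1` on `[z + 3ε, ∞)`. -/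
noncomputable def smoothStep (z ε x : ℝ) : ℝ :=
  Real.smoothTransition ((2 * ε)⁻¹ * (x - (z + ε)))

theorem contDiff_smoothStep (z ε : ℝ) : ContDiff ℝ 3 (smoothStep z ε) :=
  (Real.smoothTransition.contDiff (n := 3)).comp (by fun_prop)

theorem smoothStep_mem_Icc (z ε x : ℝ) : smoothStep z ε x ∈ Icc (0 : ℝ) 1 :=
  ⟨Real.smoothTransition.nonneg _, Real.smoothTransition.le_one _⟩

theorem smoothStep_eq_zero {z ε x : ℝ} (hε : 0 < ε) (h : x ≤ z + ε) : smoothStep z ε x = 0 :=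
  Real.smoothTransition.zero_of_nonpos
    (mul_nonpos_of_nonneg_of_nonpos (by positivity) (by linarith))

theorem smoothStep_eq_one {z ε x : ℝ} (hε : 0 < ε) (h : z + 3 * ε ≤ x) : smoothStep z ε x = 1 := by
  refine Real.smoothTransition.one_of_one_le ?_
  rw [inv_mul_eq_div, one_le_div (by positivity)]
  linarith

theorem Kg_smoothStep_le {A : ℝ} (hA0 : 0 ≤ A)
    (hA : ∀ (k : Fin 4) (x : ℝ), |iteratedDeriv k Real.smoothTransition x| ≤ A) (z : ℝ) {ε : ℝ}
    (hε : 0 < ε) : Kg (smoothStep z ε) ≤ ENNReal.ofReal ((1 + A) * max 1 (ε ^ (-3 : ℤ))) := by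
  set m := max 1 (ε ^ (-3 : ℤ)) with hm
  have hm1 : 1 ≤ m := le_max_left _ _
  have hpow : ∀ k : Fin 4, ((2 * ε)⁻¹) ^ (k : ℕ) ≤ m := fun k => by
    have h1 : (2 * ε)⁻¹ ≤ ε⁻¹ := inv_anti₀ hε (by linarith)
    refine (pow_le_pow_left₀ (by positivity) h1 _).trans ?_
    rcases le_or_gt ε⁻¹ 1 with h | h
    · exact (pow_le_one₀ (by positivity) h).trans hm1
    · refine (pow_le_pow_right₀ h.le (Nat.le_of_lt_succ k.2)).trans ?_
      rw [hm]
      refine le_trans (le_of_eq ?_) (le_max_right _ _)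
      rw [zpow_neg, inv_pow]
      norm_cast
  have hd : ∀ (k : Fin 4) (x : ℝ), |iteratedDeriv k (smoothStep z ε) x| ≤ A * m := fun k x => by
    have h1 : iteratedDeriv k (smoothStep z ε) x
        = ((2 * ε)⁻¹) ^ (k : ℕ)
          * iteratedDeriv k Real.smoothTransition ((2 * ε)⁻¹ * (x - (z + ε))) := by
      have h2 := iteratedDeriv_comp_sub_const (k : ℕ)
        (fun y => Real.smoothTransition ((2 * ε)⁻¹ * y)) (z + ε)
      have h3 := iteratedDeriv_comp_const_mul
        (Real.smoothTransition.contDiff (n := (k : ℕ))) (2 * ε)⁻¹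
      rw [h3] at h2
      exact congrFun h2 x
    rw [h1, abs_mul, abs_of_nonneg (by positivity), mul_comm]
    exact mul_le_mul (hA k _) (hpow k) (by positivity) hA0
  rw [Kg, show (1 + A) * m = m + A * m by ring, ENNReal.ofReal_add (by positivity) (by positivity)]
  refine add_le_add (by simpa using hm1) ?_
  exact iSup₂_le fun k x => ENNReal.ofReal_le_ofReal (hd k x)

theorem ofReal_integral_smoothStep {Ω : Type*} [MeasurableSpace Ω] {μ : Measure Ω}
    [IsProbabilityMeasure μ] {U : Ω → ℝ} (hU : AEMeasurable U μ) (z ε : ℝ) :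
    ENNReal.ofReal (∫ ω, smoothStep z ε (U ω) ∂μ)
      = ∫⁻ ω, ENNReal.ofReal (smoothStep z ε (U ω)) ∂μ := by
  refine ofReal_integral_eq_lintegral_ofReal ?_
    (Filter.Eventually.of_forall fun ω => (smoothStep_mem_Icc z ε _).1)
  refine Integrable.of_bound ((contDiff_smoothStep z ε).continuous.measurable.comp_aemeasurable
    hU).aestronglyMeasurable 1 (Filter.Eventually.of_forall fun ω => ?_)
  rw [Real.norm_of_nonneg (smoothStep_mem_Icc z ε _).1]
  exact (smoothStep_mem_Icc z ε _).2

theorem measure_lt_le_add_ofReal_abs_sub {Ω Ω' : Type*} [MeasurableSpace Ω] [MeasurableSpace Ω']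
    {μ : Measure Ω} {ν : Measure Ω'} [IsProbabilityMeasure μ] [IsProbabilityMeasure ν]
    {U : Ω → ℝ} {V : Ω' → ℝ} (hU : AEMeasurable U μ) (hV : AEMeasurable V ν) (z : ℝ) {ε : ℝ}
    (hε : 0 < ε) :
    μ {ω | z + 3 * ε < U ω} ≤ ν {ω | z + ε < V ω}
      + ENNReal.ofReal |∫ ω, smoothStep z ε (U ω) ∂μ - ∫ ω, smoothStep z ε (V ω) ∂ν| := by
  have hgm : Measurable (smoothStep z ε) := (contDiff_smoothStep z ε).continuous.measurable
  have h1 : μ {ω | z + 3 * ε < U ω} ≤ ENNReal.ofReal (∫ ω, smoothStep z ε (U ω) ∂μ) := by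
    rw [ofReal_integral_smoothStep hU]
    have h := mul_meas_ge_le_lintegral₀ (μ := μ)
      (f := fun ω => ENNReal.ofReal (smoothStep z ε (U ω)))
      (hgm.comp_aemeasurable hU).ennreal_ofReal 1
    rw [one_mul] at h
    refine (measure_mono fun ω hω => ?_).trans h
    simp only [mem_ofPred_eq] at hω ⊢
    simp [smoothStep_eq_one hε hω.le]
  have h2 : ENNReal.ofReal (∫ ω, smoothStep z ε (V ω) ∂ν) ≤ ν {ω | z + ε < V ω} := by
    rw [ofReal_integral_smoothStep hV]
    refine (lintegral_mono fun ω => ?_).trans (lintegral_indicator_one_le {ω | z + ε < V ω})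
    by_cases h : z + ε < V ω
    · simpa [indicator, h] using (smoothStep_mem_Icc z ε (V ω)).2
    · simp [smoothStep_eq_zero hε (not_lt.1 h)]
  refine h1.trans (le_trans ?_ (add_le_add_left h2 _))
  refine (ENNReal.ofReal_le_ofReal ?_).trans ENNReal.ofReal_add_le
  linarith [le_abs_self (∫ ω, smoothStep z ε (U ω) ∂μ - ∫ ω, smoothStep z ε (V ω) ∂ν)]

end SmoothStep

section Rate

variable {n p d : ℕ} {q : Fin 4 → ℝ} {ρbar : ℝ} {Lℓ : Fin n → ℝ} {Dl Ml : ℝ → ℝ}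
  {R : EuclideanSpace ℝ (Fin p) → ℝ} {L : ℝ}

theorem le_mul_rateR {a c : ℝ≥0∞} (hc0 : c ≠ 0) (hc : c ≠ ⊤)
    (hD : ∀ ρ ∈ Ioo 0 ρbar, 1 ≤ Dl ρ)
    (h : ∀ ρ ∈ Ioo 0 ρbar, ∀ δ ∈ Ioo 0 (omegaN n p d q),
      a ≤ c * (ENNReal.ofReal (Ml ρ) + ENNReal.ofReal (Dl ρ ^ 3) * (modR R L δ +
        ENNReal.ofReal (avL q Lℓ ^ (1 / 3 : ℝ) * L ^ (((bq0 q : ℝ) + 3) / 3)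
          * logPlus (L / δ) ^ (2 / 3 : ℝ) * sigmaN n p d q ^ (1 / 3 : ℝ))))) :
    a ≤ c * rateR d q ρbar Lℓ Dl Ml R L := by
  rw [rateR, ENNReal.mul_iInf_of_ne hc0 hc]
  refine le_iInf fun ρ => ?_
  rw [ENNReal.mul_iInf_of_ne hc0 hc]
  refine le_iInf fun hρ => ?_
  have hD0 : ENNReal.ofReal (Dl ρ ^ 3) ≠ 0 := by
    have := hD ρ hρ
    rw [Ne, ENNReal.ofReal_eq_zero, not_le]
    positivity
  rw [ENNReal.mul_iInf_of_ne hD0 ENNReal.ofReal_ne_top, ENNReal.add_iInf,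
    ENNReal.mul_iInf_of_ne hc0 hc]
  refine le_iInf fun δ => ?_
  rw [ENNReal.mul_iInf_of_ne hD0 ENNReal.ofReal_ne_top, ENNReal.add_iInf,
    ENNReal.mul_iInf_of_ne hc0 hc]
  exact le_iInf fun hδ => h ρ hρ δ hδ

theorem rateR_ne_zero (hn : 0 < n) (hp : 0 < p) (hd : 1 ≤ d) (hq : ∀ k, 0 ≤ q k)
    (hLℓ : ∀ i, 1 ≤ Lℓ i) (hD : ∀ ρ ∈ Ioo 0 ρbar, 1 ≤ Dl ρ) (hL : 1 ≤ L) :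
    rateR d q ρbar Lℓ Dl Ml R L ≠ 0 := by
  have hσ := sigmaN_pos (q := q) hn hp hd
  have hav := one_le_avL hn hq hLℓ
  have h : ENNReal.ofReal (avL q Lℓ ^ (1 / 3 : ℝ) * L ^ (((bq0 q : ℝ) + 3) / 3)
      * sigmaN n p d q ^ (1 / 3 : ℝ)) ≤ 1 * rateR d q ρbar Lℓ Dl Ml R L := by
    refine le_mul_rateR one_ne_zero ENNReal.one_ne_top hD fun ρ hρ δ _ => ?_
    rw [one_mul]
    refine le_trans ?_ le_add_self
    have hD1 : 1 ≤ ENNReal.ofReal (Dl ρ ^ 3) := by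
      rw [ENNReal.one_le_ofReal]
      exact one_le_pow₀ (hD ρ hρ)
    refine le_trans (le_trans ?_ le_add_self) (le_mul_of_one_le_left zero_le hD1)
    refine ENNReal.ofReal_le_ofReal (mul_le_mul_of_nonneg_right ?_ (by positivity))
    exact le_mul_of_one_le_right (by positivity)
      (Real.one_le_rpow (le_max_left _ _) (by norm_num))
  rw [one_mul] at h
  intro h0
  rw [h0, nonpos_iff_eq_zero, ENNReal.ofReal_eq_zero] at h
  have : 0 < avL q Lℓ ^ (1 / 3 : ℝ) * L ^ (((bq0 q : ℝ) + 3) / 3)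
      * sigmaN n p d q ^ (1 / 3 : ℝ) := by positivity
  linarith

theorem LossAssumption.exists_smoothApprox {ℓ : Fin n → ℝ → ℝ}
    (h : LossAssumption q ρbar Lℓ Dl Ml ℓ) {ρ : ℝ} (hρ : ρ ∈ Ioo 0 ρbar) :
    ∃ f, SmoothApprox q (Ml ρ) (Dl ρ) Lℓ ℓ f := by
  obtain ⟨ℓs, hs⟩ := h.approx
  exact ⟨ℓs ρ, h.q_nonneg, h.one_le_Lℓ, (h.Ml_mem ρ hρ).1, (h.Ml_mem ρ hρ).2, h.one_le_Dl ρ hρ,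
    h.growth, fun i => (hs ρ hρ i).2.2.1, fun i =>
      selfBounded_of_contDiff (hs ρ hρ i).1 (hs ρ hρ i).2.1 (hs ρ hρ i).2.2.2⟩

theorem abs_sub_le_modR {δ : ℝ} (h : modR R L δ ≠ ⊤) {w w' : EuclideanSpace ℝ (Fin p)}
    (hw : w ∈ cube p L) (hw' : w' ∈ cube p L) (hd : ∀ j, |w j - w' j| ≤ δ) :
    |R w - R w'| ≤ (modR R L δ).toReal := by
  rw [← ENNReal.ofReal_le_iff_le_toReal h]
  exact le_iSup₂_of_le w hw (le_iSup₂_of_le w' hw' (le_iSup_of_le hd le_rfl))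

theorem one_le_Kg (g : ℝ → ℝ) : 1 ≤ Kg g := le_self_add

theorem bq0_add_three_le_qStar (q : Fin 4 → ℝ) : bq0 q + 3 ≤ qStar q := by
  unfold qStar bq0
  set J := ⌈q 0 * bq q / 2⌉₊
  have h : (2 * J + 4) / 2 = J + 2 := by omega
  have h2 : J + 1 ≤ 2 ^ J := Nat.lt_two_pow_self
  rw [h, pow_add]
  omega

end Rate

section Laws

variable {n p d Q : ℕ} {M : ℝ} {Cov : Matrix (Fin p) (Fin p) ℝ}

theorem RowLaw.mono {P : Measure (EuclideanSpace ℝ (Fin p))} (h : RowLaw n Q M Cov P) {M' : ℝ}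
    (hM : M ≤ M') : RowLaw n Q M' Cov P :=
  ⟨h.mean, h.cov, fun j => (h.moment j).trans (ENNReal.ofReal_le_ofReal hM)⟩

variable {Ω : Type*} [MeasurableSpace Ω] {μ : Measure Ω}

theorem rowLaw_map {X : Ω → EuclideanSpace ℝ (Fin p)} (hX : AEMeasurable X μ)
    (h1 : ∀ j, ∫ ω, X ω j ∂μ = 0) (h2 : ∀ j k, ∫ ω, X ω j * X ω k ∂μ = Cov j k / n)
    (h3 : ∀ j, eLpNorm (fun ω => √(n : ℝ) * X ω j) Q μ ≤ ENNReal.ofReal M) :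
    RowLaw n Q M Cov (μ.map X) where
  mean j := by
    rw [integral_map hX (measurable_euclidean_apply j).aestronglyMeasurable]
    exact h1 j
  cov j k := by
    have := integral_map hX (f := fun x : EuclideanSpace ℝ (Fin p) => x j * x k)
      ((measurable_euclidean_apply j).mul (measurable_euclidean_apply k)).aestronglyMeasurable
    exact this.trans (h2 j k)
  moment j := by
    rw [eLpNorm_map_measure
      ((measurable_euclidean_apply j).const_mul _).aestronglyMeasurable hX]
    exact h3 j

theorem iIndepFun_map_of_comp [IsProbabilityMeasure μ] {E ι : Type*} [MeasurableSpace E]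
    [Fintype ι] {β : ι → Type*} [∀ i, MeasurableSpace (β i)] {X : Ω → E} (hX : AEMeasurable X μ)
    {f : (i : ι) → E → β i} (hf : ∀ i, Measurable (f i))
    (h : iIndepFun (fun i ω => f i (X ω)) μ) : iIndepFun f (μ.map X) := by
  have := Measure.isProbabilityMeasure_map hX
  rw [iIndepFun_iff_map_fun_eq_pi_map fun i => (hf i).aemeasurable,
    AEMeasurable.map_map_of_aemeasurable (measurable_pi_iff.2 hf).aemeasurable hX]
  refine ((iIndepFun_iff_map_fun_eq_pi_map (f := fun i ω => f i (X ω))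
    fun i => (hf i).comp_aemeasurable hX).1 h).trans ?_
  congr 1
  funext i
  rw [AEMeasurable.map_map_of_aemeasurable (hf i).aemeasurable hX]
  rfl

theorem integral_comp_eq_integral_pi [IsProbabilityMeasure μ] {ι E : Type*} [Fintype ι]
    [MeasurableSpace E] {X : ι → Ω → E} (hX : ∀ i, AEMeasurable (X i) μ) (hi : iIndepFun X μ)
    {F : (ι → E) → ℝ} (hF : Measurable F) :
    ∫ ω, F (fun i => X i ω) ∂μ = ∫ x, F x ∂(Measure.pi fun i => μ.map (X i)) := by
  rw [← (iIndepFun_iff_map_fun_eq_pi_map hX).1 hi, integral_map (aemeasurable_pi_lambda _ hX)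
    hF.aestronglyMeasurable]

end Laws

section Universality

variable {n p d : ℕ} {q : Fin 4 → ℝ} {ρbar : ℝ} {Lℓ : Fin n → ℝ} {Dl Ml : ℝ → ℝ}
  {R : EuclideanSpace ℝ (Fin p) → ℝ} {L M : ℝ} {Cov : Matrix (Fin p) (Fin p) ℝ}

/-- Universality of the minimized risk for product laws, in terms of the rate. -/
theorem ofReal_abs_integral_minRisk_sub_le {Q : ℕ} (hn : 0 < n) {τ : ℝ} (hτ : τ ∈ Ioo (0 : ℝ) 1)
    (hp' : τ ≤ (p : ℝ) / n) (hp : (p : ℝ) / n ≤ 1 / τ) {ℓ : Fin n → ℝ → ℝ}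
    (hℓ : ∀ i, Continuous (ℓ i)) (hA : LossAssumption q ρbar Lℓ Dl Ml ℓ) {g : ℝ → ℝ}
    (hg : ContDiff ℝ 3 g) (P P' : Fin n → Measure (EuclideanSpace ℝ (Fin p)))
    [∀ i, IsProbabilityMeasure (P i)] [∀ i, IsProbabilityMeasure (P' i)]
    (hP : ∀ i, RowLaw n Q M Cov (P i)) (hP' : ∀ i, RowLaw n Q M Cov (P' i)) (hM : 0 ≤ M)
    (hQ : bq0 q + 3 ≤ Q) {M₀ : ℝ} (hM₀ : 0 ≤ M₀)
    (hCov : ∀ x : Fin p → ℝ, ∑ j, ∑ k, x j * x k * Cov j k ≤ M₀ * ∑ j, x j ^ 2)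
    {κ : Fin n → ℕ} {B : (i : Fin n) → Fin (κ i) → Finset (Fin p)}
    (hB : ∀ i, IsBlockPartition d (B i))
    (hind : ∀ i, iIndepFun
      (fun (a : Fin (κ i)) (x : EuclideanSpace ℝ (Fin p)) (j : B i a) => x j) (P i))
    (hind' : ∀ i, iIndepFun
      (fun (a : Fin (κ i)) (x : EuclideanSpace ℝ (Fin p)) (j : B i a) => x j) (P' i))
    {S : Set (EuclideanSpace ℝ (Fin p))} (hL : 1 ≤ L) (hS : S ⊆ cube p L) (hne : S.Nonempty) :
    ENNReal.ofReal |∫ x, g (minRisk ℓ R S x) ∂(Measure.pi P)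
      - ∫ x, g (minRisk ℓ R S x) ∂(Measure.pi P')|
    ≤ ENNReal.ofReal (univConst q τ M₀ M) * Kg g * rateR d q ρbar Lℓ Dl Ml R L := by
  have hC : 0 < univConst q τ M₀ M := univConst_pos hτ.1 hM₀ hM
  have hC0 : ENNReal.ofReal (univConst q τ M₀ M) ≠ 0 := by simpa using hC
  have hp0 : 0 < p := by
    rcases Nat.eq_zero_or_pos p with h | h
    · rw [h] at hp'; simp at hp'; linarith [hτ.1]
    · exact h
  have hd1 : 1 ≤ d := (hB ⟨0, hn⟩).one_le hp0
  by_cases hK : Kg g = ⊤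
  · rw [hK, ENNReal.mul_top hC0, ENNReal.top_mul
      (rateR_ne_zero hn hp0 hd1 hA.q_nonneg hA.one_le_Lℓ hA.one_le_Dl hL)]
    exact le_top
  have hK1 : Kg g ≠ 0 := (zero_lt_one.trans_le (one_le_Kg g)).ne'
  refine le_mul_rateR (mul_ne_zero hC0 hK1) (ENNReal.mul_ne_top ENNReal.ofReal_ne_top hK)
    hA.one_le_Dl fun ρ hρ δ hδ => ?_
  have hD1 := hA.one_le_Dl ρ hρ
  by_cases hm : modR R L δ = ⊤
  · rw [hm, top_add, ENNReal.mul_top, add_top, ENNReal.mul_top (mul_ne_zero hC0 hK1)]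
    · exact le_top
    · rw [Ne, ENNReal.ofReal_eq_zero, not_le]
      positivity
  obtain ⟨f, hf⟩ := hA.exists_smoothApprox hρ
  have h := abs_integral_minRisk_sub_le (R := R) hn hτ hp' hp hf hℓ (boundedDerivs_of_Kg hg hK)
    P P' hP hP' hM hQ hM₀ hCov hB hind hind' hL hδ hS hne (ENNReal.toReal_nonneg)
    (fun w hw w' hw' hd => abs_sub_le_modR hm hw hw' hd)
  refine (ENNReal.ofReal_le_ofReal h).trans (le_of_eq ?_)
  have hσ := sigmaN_pos (q := q) hn hp0 hd1
  have hav := one_le_avL hn hA.q_nonneg hA.one_le_Lℓ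
  have hl1 : 1 ≤ logPlus (L / δ) := le_max_left _ _
  rw [ENNReal.ofReal_mul (by positivity), ENNReal.ofReal_mul hC.le, ENNReal.ofReal_toReal hK,
    ENNReal.ofReal_add hf.ε_nonneg (by positivity), ENNReal.ofReal_mul (by positivity),
    ENNReal.ofReal_add ENNReal.toReal_nonneg (by positivity), ENNReal.ofReal_toReal hm]

end Universality

theorem theorem1 :
    -- `c` is the absolute factor in `C₁ = c * C₀`
    ∃ c : ℝ, 0 < c ∧
    ∀ (τ : ℝ) (q : Fin 4 → ℝ) (M : ℝ), τ ∈ Ioo (0 : ℝ) 1 →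
    ∃ C₀ : ℝ, 0 < C₀ ∧ ∃ n₀ : ℕ, ∀ (n p d : ℕ), n₀ ≤ n →
    -- proportional dimensions
    0 < n → τ ≤ (p : ℝ) / n → (p : ℝ) / n ≤ 1 / τ →
    -- losses and regularizer
    ∀ (ℓ : Fin n → ℝ → ℝ) (R : EuclideanSpace ℝ (Fin p) → ℝ)
      (ρbar : ℝ) (Lℓ : Fin n → ℝ) (Dl Ml : ℝ → ℝ),
    (∀ i, Continuous (ℓ i)) →
    LossAssumption q ρbar Lℓ Dl Ml ℓ →
    -- i.i.d. centred covariates with covariance `Cov / n`, moment bounds, block dependence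
    ∀ (Cov : Matrix (Fin p) (Fin p) ℝ) (hCov : Cov.PosDef),
    (∀ k, hCov.isHermitian.eigenvalues k ≤ M) →
    ∀ (Ω : Type*) [MeasurableSpace Ω] (μ : Measure Ω) [IsProbabilityMeasure μ]
      (X : Fin n → Ω → EuclideanSpace ℝ (Fin p)),
    iIndepFun X μ →
    (∀ i i', IdentDistrib (X i) (X i') μ μ) →
    (∀ i j, ∫ ω, X i ω j ∂μ = 0) →
    (∀ i j k, ∫ ω, X i ω j * X i ω k ∂μ = Cov j k / n) →
    (∀ i j, eLpNorm (fun ω => √(n : ℝ) * X i ω j) (qStar q) μ ≤ ENNReal.ofReal M) →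
    (∀ i, BlockDependent d (X i) μ) →
    -- i.i.d. Gaussian vectors with the same covariance
    ∀ (Ω' : Type*) [MeasurableSpace Ω'] (ν : Measure Ω') [IsProbabilityMeasure ν]
      (G : Fin n → Ω' → EuclideanSpace ℝ (Fin p)),
    iIndepFun G ν →
    (∀ i, HasLaw (G i) (multivariateGaussian 0 ((1 / (n : ℝ)) • Cov)) ν) →
    ∀ (L : ℝ) (S : Set (EuclideanSpace ℝ (Fin p))), 1 ≤ L → S.Nonempty → S ⊆ cube p L →
    (∀ g : ℝ → ℝ, ContDiff ℝ 3 g →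
      ENNReal.ofReal
          |(∫ ω, g (minRisk ℓ R S (fun i => X i ω)) ∂μ)
            - ∫ ω, g (minRisk ℓ R S (fun i => G i ω)) ∂ν|
        ≤ ENNReal.ofReal C₀ * Kg g * rateR d q ρbar Lℓ Dl Ml R L) ∧
    (∀ z ε : ℝ, 0 < ε →
      μ {ω | z + 3 * ε < minRisk ℓ R S (fun i => X i ω)}
          ≤ ν {ω | z + ε < minRisk ℓ R S (fun i => G i ω)}
            + ENNReal.ofReal (c * C₀ * max 1 (ε ^ (-3 : ℤ)))
              * rateR d q ρbar Lℓ Dl Ml R L ∧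
      ν {ω | z + 3 * ε < minRisk ℓ R S (fun i => G i ω)}
          ≤ μ {ω | z + ε < minRisk ℓ R S (fun i => X i ω)}
            + ENNReal.ofReal (c * C₀ * max 1 (ε ^ (-3 : ℤ)))
              * rateR d q ρbar Lℓ Dl Ml R L) := by
  obtain ⟨A, hA0, hA⟩ := exists_abs_iteratedDeriv_smoothTransition_le
  refine ⟨1 + A, by positivity, fun τ q M hτ => ?_⟩
  have hM₀ : 0 ≤ max M 0 := le_max_right _ _
  have hγ : 0 ≤ √(max M 0) * gaussianNorm (qStar q) :=
    mul_nonneg (Real.sqrt_nonneg _) ENNReal.toReal_nonneg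
  set M₁ := max M 0 + √(max M 0) * gaussianNorm (qStar q)
  have hM₁ : 0 ≤ M₁ := add_nonneg hM₀ hγ
  have hC : 0 < univConst q τ (max M 0) M₁ := univConst_pos hτ.1 hM₀ hM₁
  refine ⟨univConst q τ (max M 0) M₁, hC, 1, ?_⟩
  intro n p d _ hn hp' hp ℓ R ρbar Lℓ Dl Ml hℓ hloss Cov hCov heig Ω _ μ _ X hX hid hmean hcov hmom
    hblock Ω' _ ν _ G hG hlaw L S hL hne hS
  have hXm : ∀ i, AEMeasurable (X i) μ := fun i => (hid i i).aemeasurable_fst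
  have hGm : ∀ i, AEMeasurable (G i) ν := fun i => (hlaw i).aemeasurable
  have hquad : ∀ x : Fin p → ℝ, ∑ j, ∑ k, x j * x k * Cov j k ≤ max M 0 * ∑ j, x j ^ 2 :=
    hCov.isHermitian.quadForm_le fun k => (heig k).trans (le_max_left _ _)
  choose κ _ B hdisj hcover hcard hind using hblock
  have hXP : ∀ i, IsProbabilityMeasure (μ.map (X i)) := fun i =>
    Measure.isProbabilityMeasure_map (hXm i)
  have hGP : ∀ i, IsProbabilityMeasure (ν.map (G i)) := fun i =>
    Measure.isProbabilityMeasure_map (hGm i)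
  have hXrow : ∀ i, RowLaw n (qStar q) M Cov (μ.map (X i)) := fun i =>
    rowLaw_map (hXm i) (hmean i) (hcov i) (hmom i)
  have hGrow : ∀ i, RowLaw n (qStar q) (√(max M 0) * gaussianNorm (qStar q)) Cov (ν.map (G i)) :=
    fun i => by
      rw [(hlaw i).map_eq]
      exact rowLaw_multivariateGaussian hCov hn hquad _
  have hXind : ∀ i, iIndepFun
      (fun (a : Fin (κ i)) (x : EuclideanSpace ℝ (Fin p)) (j : B i a) => x j) (μ.map (X i)) :=
    fun i => iIndepFun_map_of_comp (hXm i)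
      (fun a => measurable_pi_iff.2 fun j => measurable_euclidean_apply j.1) (hind i)
  have hGind : ∀ i, iIndepFun
      (fun (a : Fin (κ i)) (x : EuclideanSpace ℝ (Fin p)) (j : B i a) => x j) (ν.map (G i)) :=
    fun i => by
      rw [(hlaw i).map_eq]
      exact iIndepFun_blocks_multivariateGaussian hCov fun a b hab j hj k hk =>
        (hXrow i).cov_eq_zero hn (hXind i) hab hj hk
  have hmin := measurable_minRisk hℓ R hS
  have main : ∀ g : ℝ → ℝ, ContDiff ℝ 3 g →
      ENNReal.ofReal |(∫ ω, g (minRisk ℓ R S (fun i => X i ω)) ∂μ)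
          - ∫ ω, g (minRisk ℓ R S (fun i => G i ω)) ∂ν|
        ≤ ENNReal.ofReal (univConst q τ (max M 0) M₁) * Kg g
          * rateR d q ρbar Lℓ Dl Ml R L := fun g hg => by
    have hgm := hg.continuous.measurable.comp hmin
    have e1 := integral_comp_eq_integral_pi hXm hX hgm
    have e2 := integral_comp_eq_integral_pi hGm hG hgm
    simp only [Function.comp_apply] at e1 e2
    rw [e1, e2]
    exact ofReal_abs_integral_minRisk_sub_le hn hτ hp' hp hℓ hloss hg _ _
      (fun i => (hXrow i).mono ((le_max_left _ _).trans (le_add_of_nonneg_right hγ)))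
      (fun i => (hGrow i).mono (le_add_of_nonneg_left hM₀)) hM₁ (bq0_add_three_le_qStar q) hM₀
      hquad (fun i => ⟨hdisj i, hcover i, hcard i⟩) hXind hGind hL hS hne
  have step : ∀ z ε : ℝ, 0 < ε →
      ENNReal.ofReal |(∫ ω, smoothStep z ε (minRisk ℓ R S (fun i => X i ω)) ∂μ)
          - ∫ ω, smoothStep z ε (minRisk ℓ R S (fun i => G i ω)) ∂ν|
        ≤ ENNReal.ofReal ((1 + A) * univConst q τ (max M 0) M₁ * max 1 (ε ^ (-3 : ℤ)))
          * rateR d q ρbar Lℓ Dl Ml R L := fun z ε hε => by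
    refine (main _ (contDiff_smoothStep z ε)).trans (mul_le_mul_left ?_ _)
    rw [mul_comm (1 + A), mul_assoc, ENNReal.ofReal_mul hC.le]
    exact mul_le_mul_right (Kg_smoothStep_le hA0 hA z hε) _
  have hmX : AEMeasurable (fun ω => minRisk ℓ R S (fun i => X i ω)) μ :=
    hmin.comp_aemeasurable (aemeasurable_pi_lambda _ hXm)
  have hmG : AEMeasurable (fun ω => minRisk ℓ R S (fun i => G i ω)) ν :=
    hmin.comp_aemeasurable (aemeasurable_pi_lambda _ hGm)
  refine ⟨main, fun z ε hε => ⟨?_, ?_⟩⟩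
  · exact (measure_lt_le_add_ofReal_abs_sub hmX hmG z hε).trans (add_le_add_right (step z ε hε) _)
  · refine (measure_lt_le_add_ofReal_abs_sub hmG hmX z hε).trans (add_le_add_right ?_ _)
    rw [abs_sub_comm]
    exact step z ε hε
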